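/- Let $a\in\mathbb R$ and $a<b\le\infty$, let $p,q,r$ be real functions on $(a,b)$ with $p,r$ continuous and positive and $q\in L^1_{loc}(a,b)$, and let $$\tau u=\frac{-(pu')'+qu}{r}\quad\text{on }(a,b).$$ The domain of $\tau$ consists of the differentiable functions $u:(a,b)\to\mathbb C$ for which $pu'$ is locally absolutely continuous on $(a,b)$, and equations $\tau u=h$ are understood almost everywhere. A function $u$ is called square integrable at $a$ if $\int_a^{c}|u|^2r\,dx<\infty$ for some $c\in(a,b)$. Suppose that $\tau$ is in the limit point case at $a$, that is, for no $\lambda\in\mathbb C$ are all solutions of $\tau u=\lambda u$ square integrable at $a$, and that the following assumption holds. **(A)** $\varphi:(a,b)\times\mathbb C\to\mathbb C$ is such that for every $\lambda\in\mathbb C$ the function $\varphi(\cdot,\lambda)$ is a solution, not identically zero, of $\tau u=\lambda u$ on $(a,b)$ that is square integrable at $a$; for each $x\in(a,b)$ the function $\varphi(x,\cdot)$ is entire; and $\varphi(x,\lambda)$ is real for $x\in(a,b)$ and $\lambda\in\mathbb R$. Let $A$ be the minimal closed operator associated with $\tau$ in $L^2_r(a,b)$, that is, the closure of the operator $g\mapsto\tau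 g$ defined on all $g\in L^2_r(a,b)$ in the domain of $\tau$ that have compact support in $(a,b)$ and satisfy $\tau g\in L^2_r(a,b)$. Let $\mathcal L$ be the space of all $f\in L^2_r(a,b)$ that vanish almost everywhere on $(c,b)$ for some $c\in(a,b)$ (compact support in $[a,b)$), with the inner product of $L^2_r(a,b)$, and let $A_0$ be the restriction of $A$ to $\mathcal L\cap\operatorname{dom}A$. Then $A$ is well defined (the operator whose closure is taken is closable), $A_0$ is a symmetric operator in $\mathcal L$ with domain $\mathcal L\cap\operatorname{dom}A$ (in particular it maps this domain into $\mathcal L$) that is dense in $\mathcal L$, the integral $$\Phi(f;\lambda)=\int_a^b\varphi(x,\lambda)f(x)r(x)\,dx,\qquad f\in\mathcal L,\ \lambda\in\mathbb C,$$ converges absolutely, and $\Phi$ is a directing functional for $A$, that is: 1. for each $\lambda\in\mathbb R$, $\Phi(\cdot;\lambda)$ is a linear functional on $\mathcal L$; 2. for each $f\in\mathcal L$, $\Phi(f;\cdot)$ is real analytic on $\mathbb R$ (a power series expansion with positive radius of convergence exists at each $\lambda_0\in\mathbb R$); 3. for all $f\in\mathcal L$ and $\lambda\in\mathbb R$, the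 equation $A_0g-\lambda g=f$ has a solution $g\in\operatorname{dom}A_0=\mathcal L\cap\operatorname{dom}A$ if and only if $\Phi(f;\lambda)=0$. -/

import Mathlib

open MeasureTheory Set

noncomputable section

/-- The data of a Sturm-Liouville differential expression
`(τ u)(x) = (-(p u')'(x) + q(x) u(x)) / r(x)` on an open interval `(a, b)`,
where `a` is a real number and `b` is a real number or `∞`. The values of the coefficients outside
`(a, b)` play no role. -/
structure SturmLiouville where
  a : ℝ
  b : EReal
  p : ℝ → ℝ
  q : ℝ → ℝ
  r : ℝ → ℝ
  a_lt_b : (a : EReal) < b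
  continuousOn_p : ContinuousOn p {x : ℝ | a < x ∧ (x : EReal) < b}
  continuousOn_r : ContinuousOn r {x : ℝ | a < x ∧ (x : EReal) < b}
  p_pos : ∀ x ∈ {x : ℝ | a < x ∧ (x : EReal) < b}, 0 < p x
  r_pos : ∀ x ∈ {x : ℝ | a < x ∧ (x : EReal) < b}, 0 < r x
  locallyIntegrableOn_q : LocallyIntegrableOn q {x : ℝ | a < x ∧ (x : EReal) < b} volume

namespace SturmLiouville

variable (τ : SturmLiouville)

/-- The open interval `(a, b)`. -/
def I : Set ℝ := {x : ℝ | τ.a < x ∧ (x : EReal) < τ.b}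

/-- The measure `r(x) dx` on `(a, b)`. -/
def μ : Measure ℝ :=
  (volume.restrict τ.I).withDensity (fun x => ENNReal.ofReal (τ.r x))

/-- The Hilbert space `L²_r(a, b)`. -/
abbrev L2 : Type := Lp ℂ 2 τ.μ

/-- The quasi-derivative `p y'`. -/
def quasiDeriv (y : ℝ → ℂ) (x : ℝ) : ℂ := (τ.p x : ℂ) * deriv y x

/-- `τ.Eqn y h` says that `y` is in the domain of the differential expression on `(a, b)` and that
`τ y = h` holds there: `y` is differentiable, `p y'` is locally absolutely continuous, and
`-(p y')' + q y = r h` almost everywhere on `(a, b)`. (As `p` is continuous and positive,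
such a `y` is continuously differentiable, in particular locally absolutely continuous.) -/
structure Eqn (y h : ℝ → ℂ) : Prop where
  differentiableOn : DifferentiableOn ℝ y τ.I
  locallyAC : ∀ c ∈ τ.I, ∀ d ∈ τ.I, AbsolutelyContinuousOnInterval (τ.quasiDeriv y) c d
  eqn : ∀ᵐ x ∂(volume.restrict τ.I),
    HasDerivAt (τ.quasiDeriv y) ((τ.q x : ℂ) * y x - (τ.r x : ℂ) * h x) x

/-- `u` is a solution of `τ u = lam u` on `(a, b)`. -/
def IsSolution (lam : ℂ) (u : ℝ → ℂ) : Prop := τ.Eqn u (fun x => lam * u x)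

/-- `u` is square integrable at `a`: the integral of `|u|² r` over `(a, c)` is finite
for some `c ∈ (a, b)`. (For continuous `u` it is then finite for all such `c`.) -/
def SqIntegrableAtLeft (u : ℝ → ℂ) : Prop :=
  ∃ c ∈ τ.I, IntegrableOn (fun x => ‖u x‖ ^ 2 * τ.r x) (Ioo τ.a c) volume

/-- The limit circle case at `a`: for some `lam` all solutions of `τ u = lam u` are square
integrable at `a`. (By Weyl's alternative this does not depend on `lam`.) -/
def IsLimitCircleAtLeft : Prop :=
  ∃ lam : ℂ, ∀ u : ℝ → ℂ, τ.IsSolution lam u → τ.SqIntegrableAtLeft u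

/-- The limit point case at `a`. -/
def IsLimitPointAtLeft : Prop := ¬ τ.IsLimitCircleAtLeft

/-- Assumption (A) on `φ`: for every complex `lam`, `φ(·, lam)` is a non-trivial solution of `τ u = lam u`, entire in
`lam`, square integrable at `a`, and real for real `lam`. -/
structure AssumptionA (φ : ℝ → ℂ → ℂ) : Prop where
  isSolution : ∀ lam : ℂ, τ.IsSolution lam (fun x => φ x lam)
  nontrivial : ∀ lam : ℂ, ∃ x ∈ τ.I, φ x lam ≠ 0
  entire : ∀ x ∈ τ.I, Differentiable ℂ (φ x)
  sqIntegrable : ∀ lam : ℂ, τ.SqIntegrableAtLeft (fun x => φ x lam)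
  real : ∀ x ∈ τ.I, ∀ lam : ℝ, (φ x (lam : ℂ)).im = 0

lemma I_eq : τ.I = ((↑) : ℝ → EReal) ⁻¹' Ioo (τ.a : EReal) τ.b := by
  ext x
  simp [I]

lemma isOpen_I : IsOpen τ.I := by
  rw [I_eq]
  exact isOpen_Ioo.preimage continuous_coe_real_ereal

lemma uIcc_subset_I {c d : ℝ} (hc : c ∈ τ.I) (hd : d ∈ τ.I) : uIcc c d ⊆ τ.I := by
  intro x hx
  rcases le_total c d with h | h
  · rw [uIcc_of_le h] at hx
    exact ⟨hc.1.trans_le hx.1, (EReal.coe_le_coe_iff.2 hx.2).trans_lt hd.2⟩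
  · rw [uIcc_of_ge h] at hx
    exact ⟨hd.1.trans_le hx.1, (EReal.coe_le_coe_iff.2 hx.2).trans_lt hc.2⟩

lemma ae_μ_iff {P : ℝ → Prop} : (∀ᵐ x ∂τ.μ, P x) ↔ ∀ᵐ x ∂(volume.restrict τ.I), P x := by
  have hm : AEMeasurable (fun x => ENNReal.ofReal (τ.r x)) (volume.restrict τ.I) :=
    (ContinuousOn.aemeasurable (s := τ.I) τ.continuousOn_r
      τ.isOpen_I.measurableSet).ennreal_ofReal
  rw [μ, ae_withDensity_iff' hm]
  have hI := ae_restrict_mem (μ := volume) τ.isOpen_I.measurableSet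
  constructor
  · intro h
    filter_upwards [h, hI] with x hx hxI
    exact hx (by simpa using τ.r_pos x hxI)
  · intro h
    filter_upwards [h] with x hx _
    exact hx

variable {τ}

lemma ac_congr {f g : ℝ → ℂ} {c d : ℝ} (hf : AbsolutelyContinuousOnInterval f c d)
    (hfg : EqOn f g (uIcc c d)) : AbsolutelyContinuousOnInterval g c d := by
  rw [absolutelyContinuousOnInterval_iff] at hf ⊢
  intro ε hε
  obtain ⟨δ, hδ, h⟩ := hf ε hε
  refine ⟨δ, hδ, fun E hE hlt => ?_⟩
  have := h E hE hlt
  rwa [Finset.sum_congr rfl (fun i hi => by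
    rw [hfg (hE.1 i hi).1, hfg (hE.1 i hi).2])] at this

lemma Eqn.congr_right {y h k : ℝ → ℂ} (hy : τ.Eqn y h)
    (hk : h =ᵐ[volume.restrict τ.I] k) : τ.Eqn y k := by
  refine ⟨hy.1, hy.2, ?_⟩
  filter_upwards [hy.3, hk] with x hx hxk
  rwa [← hxk]

lemma Eqn.add {y h z k : ℝ → ℂ} (hy : τ.Eqn y h) (hz : τ.Eqn z k) :
    τ.Eqn (y + z) (h + k) := by
  have key : EqOn (τ.quasiDeriv y + τ.quasiDeriv z) (τ.quasiDeriv (y + z)) τ.I := by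
    intro x hx
    have h1 := hy.1.differentiableAt (τ.isOpen_I.mem_nhds hx)
    have h2 := hz.1.differentiableAt (τ.isOpen_I.mem_nhds hx)
    simp only [quasiDeriv, Pi.add_apply, deriv_add h1 h2]
    ring
  refine ⟨hy.1.add hz.1, fun c hc d hd => ?_, ?_⟩
  · exact ac_congr ((hy.2 c hc d hd).add (hz.2 c hc d hd)) (key.mono (τ.uIcc_subset_I hc hd))
  · filter_upwards [hy.3, hz.3, ae_restrict_mem (μ := volume) τ.isOpen_I.measurableSet]
      with x h1 h2 hx
    have h3 := (h1.add h2).congr_of_eventuallyEq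
      (key.symm.eventuallyEq_of_mem (τ.isOpen_I.mem_nhds hx))
    refine h3.congr_deriv ?_
    simp only [Pi.add_apply]
    ring

lemma Eqn.const_smul {y h : ℝ → ℂ} (c : ℂ) (hy : τ.Eqn y h) : τ.Eqn (c • y) (c • h) := by
  have key : EqOn (c • τ.quasiDeriv y) (τ.quasiDeriv (c • y)) τ.I := by
    intro x hx
    have h1 := hy.1.differentiableAt (τ.isOpen_I.mem_nhds hx)
    simp only [quasiDeriv, Pi.smul_apply, deriv_const_smul c h1, smul_eq_mul]
    ring
  refine ⟨hy.1.const_smul c, fun s hs d hd => ?_, ?_⟩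
  · exact ac_congr ((hy.2 s hs d hd).const_smul c) (key.mono (τ.uIcc_subset_I hs hd))
  · filter_upwards [hy.3, ae_restrict_mem (μ := volume) τ.isOpen_I.measurableSet] with x h1 hx
    have h3 := (h1.const_smul c).congr_of_eventuallyEq
      (key.symm.eventuallyEq_of_mem (τ.isOpen_I.mem_nhds hx))
    refine h3.congr_deriv ?_
    simp only [Pi.smul_apply, smul_eq_mul]
    ring

lemma eqn_zero : τ.Eqn 0 0 := by
  have key : τ.quasiDeriv 0 = fun _ => 0 := by
    funext x
    have : deriv (0 : ℝ → ℂ) x = 0 := by simp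
    simp [quasiDeriv, this]
  refine ⟨differentiableOn_const 0, fun c _ d _ => ?_, ?_⟩
  · rw [key]
    simp [AbsolutelyContinuousOnInterval, tendsto_const_nhds]
  · rw [key]
    filter_upwards with x
    simpa using hasDerivAt_const x (0 : ℂ)

/-- `τ y` is determined by the class of `y`. -/
lemma Eqn.ae_eq_zero {y h : ℝ → ℂ} (hy : τ.Eqn y h) (h0 : y =ᵐ[volume.restrict τ.I] 0) :
    h =ᵐ[volume.restrict τ.I] 0 := by
  have hy0 : EqOn y 0 τ.I :=
    Measure.eqOn_open_of_ae_eq h0 τ.isOpen_I hy.1.continuousOn continuousOn_const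
  have hd : EqOn (τ.quasiDeriv y) 0 τ.I := by
    intro x hx
    have : deriv y x = 0 := by
      rw [(hy0.eventuallyEq_of_mem (τ.isOpen_I.mem_nhds hx)).deriv_eq]
      simp
    simp [quasiDeriv, this]
  filter_upwards [hy.3, ae_restrict_mem (μ := volume) τ.isOpen_I.measurableSet] with x h1 hx
  have h2 : HasDerivAt (τ.quasiDeriv y) 0 x :=
    (hasDerivAt_const x (0 : ℂ)).congr_of_eventuallyEq
      (hd.eventuallyEq_of_mem (τ.isOpen_I.mem_nhds hx))
  have h3 := h1.unique h2
  have hr : (τ.r x : ℂ) ≠ 0 := by exact_mod_cast (τ.r_pos x hx).ne'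
  have hyx : y x = 0 := hy0 hx
  rw [hyx] at h3
  simpa [hr] using h3

variable (τ)

/-- The graph of the maximal operator: all pairs `(f, h)` of elements of `L²_r(a, b)` such that
`f` has a representative `y` in the domain of `τ` with `τ y = h`. -/
def maximalGraph : Submodule ℂ (τ.L2 × τ.L2) where
  carrier := {fh | ∃ y : ℝ → ℂ, fh.1 =ᵐ[τ.μ] y ∧ τ.Eqn y fh.2}
  zero_mem' := by
    refine ⟨0, Lp.coeFn_zero ℂ 2 τ.μ, eqn_zero.congr_right ?_⟩
    exact τ.ae_μ_iff.1 (Lp.coeFn_zero ℂ 2 τ.μ).symm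
  add_mem' := by
    rintro ⟨f, h⟩ ⟨g, k⟩ ⟨y, hfy, hy⟩ ⟨z, hgz, hz⟩
    refine ⟨y + z, (Lp.coeFn_add f g).trans (hfy.add hgz), (hy.add hz).congr_right ?_⟩
    exact τ.ae_μ_iff.1 (Lp.coeFn_add h k).symm
  smul_mem' := by
    rintro c ⟨f, h⟩ ⟨y, hfy, hy⟩
    refine ⟨c • y, (Lp.coeFn_smul c f).trans (hfy.const_smul c), (hy.const_smul c).congr_right ?_⟩
    exact τ.ae_μ_iff.1 (Lp.coeFn_smul c h).symm

lemma maximalGraph_snd_eq_zero (x : τ.L2 × τ.L2) (hx : x ∈ τ.maximalGraph) (hx0 : x.1 = 0) :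
    x.2 = 0 := by
  obtain ⟨y, hfy, hy⟩ := hx
  have h0 : y =ᵐ[τ.μ] 0 := by
    rw [hx0] at hfy
    exact hfy.symm.trans (Lp.coeFn_zero ℂ 2 τ.μ)
  have h1 : x.2 =ᵐ[τ.μ] 0 := τ.ae_μ_iff.2 (hy.ae_eq_zero (τ.ae_μ_iff.1 h0))
  exact (Lp.eq_zero_iff_ae_eq_zero).2 h1

/-- The maximal operator associated with `τ` in `L²_r(a, b)`. -/
def maximalOp : τ.L2 →ₗ.[ℂ] τ.L2 := τ.maximalGraph.toLinearPMap

lemma graph_maximalOp : τ.maximalOp.graph = τ.maximalGraph :=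
  Submodule.toLinearPMap_graph_eq _ τ.maximalGraph_snd_eq_zero

/-- The elements of `L²_r(a, b)` with compact support in the open interval `(a, b)`. -/
def compactSupp : Submodule ℂ τ.L2 where
  carrier := {f | ∃ c ∈ τ.I, ∃ d ∈ τ.I, ∀ᵐ x ∂τ.μ, x ∉ Icc c d → f x = 0}
  zero_mem' := by
    obtain ⟨c, hc⟩ := EReal.lt_iff_exists_real_btwn.1 τ.a_lt_b
    have hc' : c ∈ τ.I := ⟨EReal.coe_lt_coe_iff.1 hc.1, hc.2⟩
    refine ⟨c, hc', c, hc', ?_⟩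
    filter_upwards [Lp.coeFn_zero ℂ 2 τ.μ] with x hx _
    simpa using hx
  add_mem' := by
    rintro f g ⟨c, hc, d, hd, h⟩ ⟨c', hc', d', hd', h'⟩
    refine ⟨min c c', ?_, max d d', ?_, ?_⟩
    · rcases min_choice c c' with e | e <;> rw [e] <;> assumption
    · rcases max_choice d d' with e | e <;> rw [e] <;> assumption
    · filter_upwards [h, h', Lp.coeFn_add f g] with x hx hx' hfg hn
      rw [hfg, Pi.add_apply, hx, hx', add_zero]
      · exact fun hm => hn ⟨(min_le_right _ _).trans hm.1, hm.2.trans (le_max_right _ _)⟩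
      · exact fun hm => hn ⟨(min_le_left _ _).trans hm.1, hm.2.trans (le_max_left _ _)⟩
  smul_mem' := by
    rintro s f ⟨c, hc, d, hd, h⟩
    refine ⟨c, hc, d, hd, ?_⟩
    filter_upwards [h, Lp.coeFn_smul s f] with x hx hs hn
    rw [hs, Pi.smul_apply, hx hn, smul_zero]

/-- The linear manifold `𝓛` of all elements of `L²_r(a, b)` with compact support in `[a, b)`,
that is, which vanish almost everywhere on `(c, b)` for some `c ∈ (a, b)`. -/
def manifoldL : Submodule ℂ τ.L2 where
  carrier := {f | ∃ c ∈ τ.I, ∀ᵐ x ∂τ.μ, c < x → f x = 0}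
  zero_mem' := by
    obtain ⟨c, hc⟩ := EReal.lt_iff_exists_real_btwn.1 τ.a_lt_b
    refine ⟨c, ⟨EReal.coe_lt_coe_iff.1 hc.1, hc.2⟩, ?_⟩
    filter_upwards [Lp.coeFn_zero ℂ 2 τ.μ] with x hx _
    simpa using hx
  add_mem' := by
    rintro f g ⟨c, hc, h⟩ ⟨c', hc', h'⟩
    refine ⟨max c c', ?_, ?_⟩
    · rcases max_choice c c' with e | e <;> rw [e] <;> assumption
    · filter_upwards [h, h', Lp.coeFn_add f g] with x hx hx' hfg hn
      rw [hfg, Pi.add_apply, hx ((le_max_left _ _).trans_lt hn),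
        hx' ((le_max_right _ _).trans_lt hn), add_zero]
  smul_mem' := by
    rintro s f ⟨c, hc, h⟩
    refine ⟨c, hc, ?_⟩
    filter_upwards [h, Lp.coeFn_smul s f] with x hx hs hn
    rw [hs, Pi.smul_apply, hx hn, smul_zero]

/-- The preminimal operator: the restriction of the maximal operator to the functions with compact
support in `(a, b)`. -/
def preminimalOp : τ.L2 →ₗ.[ℂ] τ.L2 := τ.maximalOp.domRestrict τ.compactSupp

/-- The minimal closed operator `A` associated with `τ` in `L²_r(a, b)`: the closure of the
preminimal operator. -/
def minimalOp : τ.L2 →ₗ.[ℂ] τ.L2 := τ.preminimalOp.closure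

/-- The graph of the part of `A` in `𝓛`. -/
def graphA₀ : Submodule ℂ (τ.manifoldL × τ.manifoldL) :=
  τ.minimalOp.graph.comap (τ.manifoldL.subtype.prodMap τ.manifoldL.subtype)

/-- The operator `A₀` in `𝓛`, the restriction of `A` to `𝓛 ∩ dom A`. As an operator in `𝓛`, it is
defined on those `g ∈ 𝓛 ∩ dom A` for which `A g ∈ 𝓛`. -/
def A₀ : τ.manifoldL →ₗ.[ℂ] τ.manifoldL := τ.graphA₀.toLinearPMap

lemma graph_A₀ : τ.A₀.graph = τ.graphA₀ := by
  refine Submodule.toLinearPMap_graph_eq _ fun x hx hx0 => ?_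
  have h1 : ((x.1 : τ.L2), (x.2 : τ.L2)) ∈ τ.minimalOp.graph := hx
  exact Subtype.ext (LinearPMap.graph_fst_eq_zero_snd _ h1 (by simp [hx0]))

/-- `Φ(f; lam) = ∫_a^b φ(x, lam) f(x) r(x) dx`. -/
def Φ (φ : ℝ → ℂ → ℂ) (f : τ.manifoldL) (lam : ℂ) : ℂ :=
  ∫ x, φ x lam * (f : τ.L2) x ∂τ.μ

end SturmLiouville

/-- A linear operator `A₀` in a complex linear space with a positive semi-definite inner product is
symmetric. -/
def SymmetricOp {L : Type*} [SeminormedAddCommGroup L] [InnerProductSpace ℂ L]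
    (A₀ : L →ₗ.[ℂ] L) : Prop :=
  ∀ f g : A₀.domain, inner ℂ (A₀ f) (g : L) = inner ℂ (f : L) (A₀ g)

/-- A directing functional `Φ` for a linear operator `A₀` in `L`. -/
structure IsDirectingFunctional {L : Type*} [AddCommGroup L] [Module ℂ L]
    (A₀ : L →ₗ.[ℂ] L) (Φ : L → ℝ → ℂ) : Prop where
  linear : ∀ lam : ℝ, IsLinearMap ℂ (fun f => Φ f lam)
  analytic : ∀ (f : L) (lam₀ : ℝ), AnalyticAt ℝ (Φ f) lam₀
  solvable_iff : ∀ (f : L) (lam : ℝ),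
    (∃ g : A₀.domain, A₀ g - (lam : ℂ) • (g : L) = f) ↔ Φ f lam = 0

end

/-! Everything rests on the Lagrange identity, which expresses the increment of a Wronskian `W(y, z)
= y (p z') - (p y') z` as an integral of `τy · z - y · τz`.

Operator part. For compactly supported elements the boundary terms vanish, so the preminimal
operator is symmetric. Its domain is dense by duality: let `h` be orthogonal to it and solve `τ H =
h̄` on a compact interval. If `f` annihilates the kernel of `τ` there, the solution of `τ y = f`
with zero data at one end has zero data at the other, so it lies in the domain and `∫ f H r = ∫ y h̄
r = 0`. Thus `H` is itself in the kernel and `h = 0` (`ae_eq_zero_of_inner_preminimalOp`). Symmetry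
and density give closability. The same argument on `(c, b)` shows that `A` is local
(`snd_mem_manifoldL`), so `A₀` really maps into `𝓛`.

Analyticity. Over compact intervals, integrals of `φ` are entire in the parameter because initial
value problems are solved by a Neumann series of Volterra operators. At `a` a locally uniform bound
for `∫_a^c |φ|² r` is needed. In the limit point case `W(φ, φ̄)` tends to zero at `a`
(`IsSolution.selfWronskian_eq`), so `W(φ, φ̄)(c) = 2i Im λ ∫_a^c |φ|² r`. Since `φ` and `p φ'` are
real for real `λ`, the left side is `O(|Im λ|)`, and the integral stays bounded near the real line
(`exists_bound`).

Solvability. Necessity of `Φ(f; λ) = 0` is orthogonality of the range to `φ`, which is continued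
beyond the support by a cutoff. For sufficiency, choose `c` beyond the support of `f` with `φ(c, λ)
≠ 0`, and a solution `θ` that is not square integrable at `a`. If `f` vanishes near `a` and is
orthogonal to both `φ` and `θ`, the equation has a compactly supported solution. Such `f` are dense
among those orthogonal to `φ` alone, precisely because `θ` is not in `L²`
(`mem_closure_of_integral_eq_zero`). The limit is possible thanks to `‖g‖ ≤ C ‖f‖` with `C`
independent of the support (`exists_apriori`): the solutions of the Dirichlet problem on `(a, c)`
depend holomorphically on the parameter near `λ` and are bounded by `‖f‖ / |Im|`, and the maximum
principle, after multiplication by a factor that compensates the singularity, gives a bound at `λ`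
itself. -/

/-! ### Absolutely continuous functions as indefinite integrals. -/

/-- `F` is on `[s, d]` an indefinite integral of the integrable function `f`. -/
structure IsPrimitiveOn {𝕜 : Type*} [RCLike 𝕜] (s d : ℝ) (F f : ℝ → 𝕜) : Prop where
  le : s ≤ d
  integrable : IntervalIntegrable f volume s d
  eq : ∀ x ∈ Icc s d, F x = F s + ∫ t in s..x, f t

/-- Increments of the integral are dominated by those of the integral of `‖f‖`, which reduces the
claim to the real-valued case. -/
lemma IntervalIntegrable.absolutelyContinuousOnInterval_integral {E : Type*}
    [NormedAddCommGroup E] [NormedSpace ℝ E] {f : ℝ → E} {s d c : ℝ}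
    (hf : IntervalIntegrable f volume s d) (hc : c ∈ uIcc s d) :
    AbsolutelyContinuousOnInterval (fun x => ∫ t in c..x, f t) s d := by
  have h := hf.norm.absolutelyContinuousOnInterval_intervalIntegral hc
  rw [absolutelyContinuousOnInterval_iff] at h ⊢
  intro ε hε
  obtain ⟨δ, hδ, h⟩ := h ε hε
  refine ⟨δ, hδ, fun E hE hlt => lt_of_le_of_lt (Finset.sum_le_sum fun i hi => ?_) (h E hE hlt)⟩
  obtain ⟨h1, h2⟩ := hE.1 i hi
  have key : ∀ {u v : ℝ}, u ∈ uIcc s d → v ∈ uIcc s d → uIcc u v ⊆ uIcc s d :=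
    fun hu hv => uIcc_subset_uIcc hu hv
  rw [dist_eq_norm, dist_eq_norm, intervalIntegral.integral_interval_sub_left
    (hf.mono_set (key hc h1)) (hf.mono_set (key hc h2)), intervalIntegral.integral_interval_sub_left
    (hf.norm.mono_set (key hc h1)) (hf.norm.mono_set (key hc h2))]
  exact intervalIntegral.norm_integral_le_abs_integral_norm.trans (Real.norm_eq_abs _).ge

lemma AbsolutelyContinuousOnInterval.congr_eqOn {E : Type*} [PseudoMetricSpace E] {f g : ℝ → E}
    {c d : ℝ} (hf : AbsolutelyContinuousOnInterval f c d) (hfg : EqOn f g (uIcc c d)) :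
    AbsolutelyContinuousOnInterval g c d := by
  rw [absolutelyContinuousOnInterval_iff] at hf ⊢
  intro ε hε
  obtain ⟨δ, hδ, h⟩ := hf ε hε
  refine ⟨δ, hδ, fun E hE hlt => ?_⟩
  rw [Finset.sum_congr rfl fun i hi => by rw [← hfg (hE.1 i hi).1, ← hfg (hE.1 i hi).2]]
  exact h E hE hlt

namespace IsPrimitiveOn

variable {𝕜 : Type*} [RCLike 𝕜] {s d : ℝ} {F G f g : ℝ → 𝕜}

lemma congr (hF : IsPrimitiveOn s d F f) (hFG : ∀ x ∈ Icc s d, F x = G x)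
    (hfg : ∀ᵐ x, x ∈ Ioc s d → f x = g x) : IsPrimitiveOn s d G g := by
  have hfg' : ∀ᵐ x, x ∈ uIoc s d → f x = g x := by rwa [uIoc_of_le hF.le]
  refine ⟨hF.le, hF.integrable.congr_ae ((ae_restrict_iff' measurableSet_uIoc).2 hfg'),
    fun x hx => ?_⟩
  rw [← hFG x hx, ← hFG s ⟨le_rfl, hF.le⟩, hF.eq x hx]
  congr 1
  refine intervalIntegral.integral_congr_ae ?_
  filter_upwards [hfg] with t ht hts
  rw [uIoc_of_le hx.1] at hts
  exact ht ⟨hts.1, hts.2.trans hx.2⟩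

lemma integral (hsd : s ≤ d) (hf : IntervalIntegrable f volume s d) (c : 𝕜) :
    IsPrimitiveOn s d (fun x => c + ∫ t in s..x, f t) f :=
  ⟨hsd, hf, fun x _ => by simp⟩

lemma ac (hF : IsPrimitiveOn s d F f) : AbsolutelyContinuousOnInterval F s d := by
  have h := hF.integrable.absolutelyContinuousOnInterval_integral (c := s) left_mem_uIcc
  have h1 : AbsolutelyContinuousOnInterval (fun _ : ℝ => F s) s d := by
    simp [AbsolutelyContinuousOnInterval, tendsto_const_nhds]
  have h2 : AbsolutelyContinuousOnInterval (fun x => F s + ∫ t in s..x, f t) s d := h1.add h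
  refine h2.congr_eqOn fun x hx => ?_
  rw [uIcc_of_le hF.le] at hx
  exact (hF.eq x hx).symm

lemma continuousOn (hF : IsPrimitiveOn s d F f) : ContinuousOn F (Icc s d) := by
  simpa [uIcc_of_le hF.le] using hF.ac.continuousOn

lemma ae_hasDerivAt (hF : IsPrimitiveOn s d F f) :
    ∀ᵐ x, x ∈ Icc s d → HasDerivAt F (f x) x := by
  have h₁ : ∀ᵐ x : ℝ, x ≠ s := by simp [ae_iff, measure_singleton]
  have h₂ : ∀ᵐ x : ℝ, x ≠ d := by simp [ae_iff, measure_singleton]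
  filter_upwards [hF.integrable.ae_hasDerivAt_integral, h₁, h₂] with x hx hs hd hxI
  rw [uIcc_of_le hF.le] at hx
  refine ((hx hxI s ⟨le_rfl, hF.le⟩).const_add (F s)).congr_of_eventuallyEq ?_
  filter_upwards [Icc_mem_nhds (lt_of_le_of_ne hxI.1 hs.symm) (lt_of_le_of_ne hxI.2 hd)] with t ht
  exact hF.eq t ht

/-- The difference between `F` and the integral of `f` is absolutely continuous with derivative zero
almost everywhere, hence constant. This turns almost-everywhere equations into integral identities.
-/
lemma of_ac (hsd : s ≤ d) (hF : AbsolutelyContinuousOnInterval F s d)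
    (hf : IntervalIntegrable f volume s d) (h : ∀ᵐ x, x ∈ Icc s d → HasDerivAt F (f x) x) :
    IsPrimitiveOn s d F f := by
  refine ⟨hsd, hf, fun x hx => ?_⟩
  have h0 := integral hsd hf (F s)
  obtain ⟨C, hC⟩ := (hF.sub h0.ac).const_of_ae_hasDerivAt_zero (by
    filter_upwards [h, h0.ae_hasDerivAt] with x h1 h2 hx
    rw [uIcc_of_le hsd] at hx
    simpa using (h1 hx).sub (h2 hx))
  rw [uIcc_of_le hsd] at hC
  have h1 := hC s ⟨le_rfl, hsd⟩
  have h2 := hC x hx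
  simp only [Pi.sub_apply, intervalIntegral.integral_same] at h1 h2
  rw [← h1] at h2
  linear_combination h2

lemma sub (hF : IsPrimitiveOn s d F f) (hG : IsPrimitiveOn s d G g) :
    IsPrimitiveOn s d (fun x => F x - G x) (fun x => f x - g x) :=
  of_ac hF.le (hF.ac.sub hG.ac) (hF.integrable.sub hG.integrable) (by
    filter_upwards [hF.ae_hasDerivAt, hG.ae_hasDerivAt] with x h1 h2 hx
    exact (h1 hx).sub (h2 hx))

lemma const_mul (hF : IsPrimitiveOn s d F f) (c : 𝕜) :
    IsPrimitiveOn s d (fun x => c * F x) (fun x => c * f x) :=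
  ⟨hF.le, hF.integrable.const_mul c, fun x hx => by
    simp only [hF.eq x hx, mul_add, intervalIntegral.integral_const_mul]⟩

/-- The product rule. -/
lemma mul (hF : IsPrimitiveOn s d F f) (hG : IsPrimitiveOn s d G g) :
    IsPrimitiveOn s d (fun x => F x * G x) (fun x => f x * G x + F x * g x) := by
  have hFc := hF.continuousOn
  have hGc := hG.continuousOn
  rw [← uIcc_of_le hF.le] at hFc hGc
  exact of_ac hF.le (hF.ac.smul hG.ac)
    ((hF.integrable.mul_continuousOn hGc).add (hG.integrable.continuousOn_mul hFc)) (by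
    filter_upwards [hF.ae_hasDerivAt, hG.ae_hasDerivAt] with x h1 h2 hx
    exact (h1 hx).mul (h2 hx))

lemma mono {s' d' : ℝ} (hF : IsPrimitiveOn s d F f) (h : s ≤ s') (h' : s' ≤ d') (h'' : d' ≤ d) :
    IsPrimitiveOn s' d' F f := by
  have hi : ∀ {u v : ℝ}, u ∈ Icc s d → v ∈ Icc s d → IntervalIntegrable f volume u v := by
    intro u v hu hv
    refine hF.integrable.mono_set (uIcc_subset_uIcc ?_ ?_) <;> rwa [uIcc_of_le hF.le]
  have hs : s ∈ Icc s d := ⟨le_rfl, hF.le⟩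
  have hs' : s' ∈ Icc s d := ⟨h, h'.trans h''⟩
  refine ⟨h', hi hs' ⟨h.trans h', h''⟩, fun x hx => ?_⟩
  have hx' : x ∈ Icc s d := ⟨h.trans hx.1, hx.2.trans h''⟩
  rw [hF.eq x hx', hF.eq s' hs', add_assoc,
    intervalIntegral.integral_add_adjacent_intervals (hi hs hs') (hi hs' hx')]

lemma sub_eq (hF : IsPrimitiveOn s d F f) : F d - F s = ∫ t in s..d, f t := by
  rw [hF.eq d ⟨hF.le, le_rfl⟩]
  ring

lemma conj {F f : ℝ → ℂ} (hF : IsPrimitiveOn s d F f) :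
    IsPrimitiveOn s d (fun x => starRingEnd ℂ (F x)) (fun x => starRingEnd ℂ (f x)) := by
  refine ⟨hF.le, ?_, fun x hx => ?_⟩
  · have := hF.integrable
    rw [intervalIntegrable_iff] at this ⊢
    exact (Complex.conjLIE.toContinuousLinearEquiv : ℂ →L[ℝ] ℂ).integrable_comp this
  · simp only [hF.eq x hx, map_add]
    congr 1
    simp only [intervalIntegral, map_sub, ← integral_conj]

/-- An indefinite integral that vanishes identically has zero derivative. -/
lemma ae_eq_zero (hF : IsPrimitiveOn s d F f) (h : ∀ x ∈ Icc s d, F x = 0) :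
    ∀ᵐ x, x ∈ Ioo s d → f x = 0 := by
  filter_upwards [hF.ae_hasDerivAt] with x hx hxI
  have h1 := hx (Ioo_subset_Icc_self hxI)
  have h2 : HasDerivAt F 0 x := (hasDerivAt_const x (0 : 𝕜)).congr_of_eventuallyEq (by
    filter_upwards [Icc_mem_nhds hxI.1 hxI.2] with t ht
    exact h t ht)
  exact h1.unique h2

end IsPrimitiveOn

/-! ### Volterra integral operators. -/

/-- The unit `1 - x ^ k` is the product of `1 - x` and a geometric sum commuting with it, and
commuting factors of a unit are units. -/
lemma isUnit_one_sub_of_norm_pow_lt_one {R : Type*} [NormedRing R] [HasSummableGeomSeries R]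
    {x : R} {k : ℕ} (h : ‖x ^ k‖ < 1) : IsUnit (1 - x) := by
  have hu : IsUnit ((1 - x) * ∑ i ∈ Finset.range k, x ^ i) := by
    rw [mul_neg_geom_sum]
    exact isUnit_one_sub_of_norm_lt_one h
  have hc : Commute (1 - x) (∑ i ∈ Finset.range k, x ^ i) :=
    Commute.sum_right _ _ _ fun i _ => ((Commute.one_left x).sub_left (Commute.refl x)).pow_right i
  exact (hc.isUnit_mul_iff.1 hu).1

section Volterra

variable {s d : ℝ}

/-- The integral operator `y ↦ ∫_s^x m y` on continuous functions. -/
noncomputable def volterra (hsd : s ≤ d) (m : ℝ → ℂ) (hm : IntervalIntegrable m volume s d) :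
    C(Icc s d, ℂ) →L[ℂ] C(Icc s d, ℂ) :=
  LinearMap.mkContinuous
    { toFun := fun y => ⟨fun x => ∫ t in s..x, m t * IccExtend hsd y t, by
        have h : IntervalIntegrable (fun t => m t * IccExtend hsd y t) volume s d :=
          hm.mul_continuousOn (y.continuous.Icc_extend' (h := hsd)).continuousOn
        have := (IsPrimitiveOn.integral hsd h 0).continuousOn
        simp only [zero_add] at this
        exact this.comp_continuous continuous_subtype_val fun x => x.2⟩
      map_add' := fun y z => by
        have h : ∀ y : C(Icc s d, ℂ), ∀ x ∈ Icc s d,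
            IntervalIntegrable (fun t => m t * IccExtend hsd y t) volume s x := fun y x hx =>
          (hm.mono_set (by rw [uIcc_of_le hsd, uIcc_of_le hx.1]; exact Icc_subset_Icc_right hx.2)
            ).mul_continuousOn (y.continuous.Icc_extend' (h := hsd)).continuousOn
        ext x
        change (∫ t in s..(x : ℝ), m t * IccExtend hsd (⇑(y + z)) t) =
          (∫ t in s..(x : ℝ), m t * IccExtend hsd y t) +
            ∫ t in s..(x : ℝ), m t * IccExtend hsd z t
        rw [← intervalIntegral.integral_add (h y x x.2) (h z x x.2)]
        simp [IccExtend, mul_add]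
      map_smul' := fun c y => by
        ext x
        change (∫ t in s..(x : ℝ), m t * IccExtend hsd (⇑(c • y)) t) =
          c * ∫ t in s..(x : ℝ), m t * IccExtend hsd y t
        rw [← intervalIntegral.integral_const_mul]
        simp [IccExtend, mul_left_comm] }
    (∫ t in s..d, ‖m t‖) (fun y => by
      have h0 : 0 ≤ ∫ t in s..d, ‖m t‖ :=
        intervalIntegral.integral_nonneg hsd fun _ _ => norm_nonneg _
      refine (ContinuousMap.norm_le _ (by positivity)).2 fun x => ?_
      have hx : IntervalIntegrable m volume s x := hm.mono_set (by
        rw [uIcc_of_le hsd, uIcc_of_le x.2.1]; exact Icc_subset_Icc_right x.2.2)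
      calc ‖∫ t in s..x, m t * IccExtend hsd y t‖
          ≤ ∫ t in s..x, ‖m t‖ * ‖y‖ := by
            refine intervalIntegral.norm_integral_le_of_norm_le x.2.1 ?_ (hx.norm.mul_const _)
            refine Filter.Eventually.of_forall fun t _ => ?_
            rw [norm_mul]
            exact mul_le_mul_of_nonneg_left (y.norm_coe_le_norm _) (norm_nonneg _)
        _ = (∫ t in s..x, ‖m t‖) * ‖y‖ := intervalIntegral.integral_mul_const _ _
        _ ≤ _ := mul_le_mul_of_nonneg_right (intervalIntegral.integral_mono_interval le_rfl x.2.1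
            x.2.2 (Filter.Eventually.of_forall fun _ => norm_nonneg _) hm.norm) (norm_nonneg _))

lemma volterra_apply (hsd : s ≤ d) (m : ℝ → ℂ) (hm : IntervalIntegrable m volume s d)
    (y : C(Icc s d, ℂ)) (x : Icc s d) :
    volterra hsd m hm y x = ∫ t in s..x, m t * IccExtend hsd y t := rfl

lemma volterra_congr (hsd : s ≤ d) (m : ℝ → ℂ) (hm : IntervalIntegrable m volume s d)
    (y : C(Icc s d, ℂ)) (z : ℝ → ℂ) (hz : ∀ t (ht : t ∈ Icc s d), y ⟨t, ht⟩ = z t)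
    (x : Icc s d) : volterra hsd m hm y x = ∫ t in s..x, m t * z t := by
  rw [volterra_apply]
  refine intervalIntegral.integral_congr fun t ht => ?_
  rw [uIcc_of_le x.2.1] at ht
  have ht' : t ∈ Icc s d := ⟨ht.1, ht.2.trans x.2.2⟩
  simp only [IccExtend_of_mem hsd _ ht', hz t ht']

lemma isPrimitiveOn_volterra (hsd : s ≤ d) (m : ℝ → ℂ) (hm : IntervalIntegrable m volume s d)
    (y : C(Icc s d, ℂ)) (c : ℂ) :
    IsPrimitiveOn s d (fun x => c + IccExtend hsd (volterra hsd m hm y) x)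
      (fun t => m t * IccExtend hsd y t) := by
  have h : IntervalIntegrable (fun t => m t * IccExtend hsd y t) volume s d :=
    hm.mul_continuousOn (y.continuous.Icc_extend' (h := hsd)).continuousOn
  refine (IsPrimitiveOn.integral hsd h c).congr (fun x hx => ?_) (by simp)
  simp only [IccExtend_of_mem hsd _ hx, volterra_apply]

lemma volterra_add_smul (hsd : s ≤ d) (m n : ℝ → ℂ) (hm : IntervalIntegrable m volume s d)
    (hn : IntervalIntegrable n volume s d) (c : ℂ)
    (hmn : IntervalIntegrable (fun t => m t + c * n t) volume s d) :
    volterra hsd _ hmn = volterra hsd m hm + c • volterra hsd n hn := by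
  ext y x
  have hx : ∀ {m : ℝ → ℂ}, IntervalIntegrable m volume s d →
      IntervalIntegrable (fun t => m t * IccExtend hsd y t) volume s x := fun hm =>
    (hm.mono_set (by rw [uIcc_of_le hsd, uIcc_of_le x.2.1]; exact Icc_subset_Icc_right x.2.2)
      ).mul_continuousOn (y.continuous.Icc_extend' (h := hsd)).continuousOn
  simp only [add_apply, smul_apply,
    ContinuousMap.add_apply, ContinuousMap.smul_apply, volterra_apply, smul_eq_mul]
  rw [← intervalIntegral.integral_const_mul, ← intervalIntegral.integral_add (hx hm)
    ((hx hn).const_mul c)]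
  refine intervalIntegral.integral_congr fun t _ => ?_
  ring

lemma integral_mul_pow_div_factorial (hsd : s ≤ d) {m : ℝ → ℝ}
    (hm : IntervalIntegrable m volume s d) (k : ℕ) :
    IsPrimitiveOn s d (fun x => (∫ t in s..x, m t) ^ (k + 1) / (k + 1).factorial)
      (fun x => m x * ((∫ t in s..x, m t) ^ k / k.factorial)) := by
  have h1 : IsPrimitiveOn s d (fun x => ∫ t in s..x, m t) m :=
    (IsPrimitiveOn.integral hsd hm 0).congr (by simp) (by simp)
  induction k with
  | zero => simpa using h1
  | succ k ih =>
    refine ((ih.mul h1).const_mul (1 / (k + 2 : ℝ))).congr (fun x _ => ?_)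
      (Filter.Eventually.of_forall fun x _ => ?_)
    · rw [Nat.factorial_succ (k + 1)]
      push_cast
      have : (k + 2 : ℝ) ≠ 0 := by positivity
      have : ((k + 1).factorial : ℝ) ≠ 0 := by positivity
      have : (k + 1 + 1 : ℝ) ≠ 0 := by positivity
      field_simp
      ring
    · rw [Nat.factorial_succ k]
      push_cast
      have : (k + 2 : ℝ) ≠ 0 := by positivity
      have : (k.factorial : ℝ) ≠ 0 := by positivity
      have : (k + 1 : ℝ) ≠ 0 := by positivity
      field_simp
      ring

/-- With `N x = ∫_s^x n`, the function `N^(k+1) / (k+1)!` is the integral of `n N^k / k!`. Each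
application therefore gains one order, and iteration produces the factorial decay behind the
convergence of the Neumann series. -/
lemma norm_volterra_le (hsd : s ≤ d) {m : ℝ → ℂ} (hm : IntervalIntegrable m volume s d)
    {n : ℝ → ℝ} (hn : IntervalIntegrable n volume s d)
    (hmn : ∀ t ∈ Icc s d, ‖m t‖ ≤ n t) (k : ℕ) {C : ℝ} {y : C(Icc s d, ℂ)}
    (hy : ∀ x : Icc s d, ‖y x‖ ≤ C * ((∫ t in s..x, n t) ^ k / k.factorial)) (x : Icc s d) :
    ‖volterra hsd m hm y x‖ ≤ C * ((∫ t in s..x, n t) ^ (k + 1) / (k + 1).factorial) := by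
  have hp := ((integral_mul_pow_div_factorial hsd hn k).const_mul C).mono le_rfl x.2.1 x.2.2
  have h0 := hp.sub_eq
  simp only [intervalIntegral.integral_same, ne_eq, Nat.add_eq_zero_iff, one_ne_zero, and_false,
    not_false_eq_true, zero_pow, zero_div, mul_zero, sub_zero] at h0
  rw [h0, volterra_apply]
  refine intervalIntegral.norm_integral_le_of_norm_le x.2.1
    (Filter.Eventually.of_forall fun t ht => ?_) hp.integrable
  have ht' : t ∈ Icc s d := ⟨ht.1.le, ht.2.trans x.2.2⟩
  rw [norm_mul, IccExtend_of_mem hsd _ ht', mul_left_comm]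
  exact mul_le_mul (hmn t ht') (hy ⟨t, ht'⟩) (norm_nonneg _) ((norm_nonneg _).trans (hmn t ht'))

lemma isUnit_one_sub_volterra_comp (hsd : s ≤ d) {m n : ℝ → ℂ}
    (hm : IntervalIntegrable m volume s d) (hn : IntervalIntegrable n volume s d) :
    IsUnit (1 - volterra hsd m hm ∘L volterra hsd n hn) := by
  set V := volterra hsd m hm ∘L volterra hsd n hn with hV
  -- One majorant for both kernels, so that every power of `V` gains two orders of the same function
  -- `G`.
  have hl : IntervalIntegrable (fun t => ‖m t‖ + ‖n t‖) volume s d := hm.norm.add hn.norm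
  set G : ℝ → ℝ := fun x => ∫ t in s..x, (‖m t‖ + ‖n t‖) with hG
  have hG0 : ∀ x : Icc s d, 0 ≤ G x := fun x =>
    intervalIntegral.integral_nonneg x.2.1 fun _ _ => by positivity
  have hGd : ∀ x : Icc s d, G x ≤ G d := fun x =>
    intervalIntegral.integral_mono_interval le_rfl x.2.1 x.2.2
      (Filter.Eventually.of_forall fun _ => by positivity) hl
  have key : ∀ (k : ℕ) (y : C(Icc s d, ℂ)) (x : Icc s d),
      ‖(V ^ k) y x‖ ≤ ‖y‖ * (G x ^ (2 * k) / (2 * k).factorial) := by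
    intro k y
    induction k with
    | zero => intro x; simpa using y.norm_coe_le_norm x
    | succ k ih =>
      have h1 := norm_volterra_le hsd hn hl (fun t _ => le_add_of_nonneg_left (norm_nonneg _))
        (2 * k) ih
      have h2 := norm_volterra_le hsd hm hl (fun t _ => le_add_of_nonneg_right (norm_nonneg _))
        (2 * k + 1) h1
      rw [pow_succ']
      exact h2
  obtain ⟨k, hk⟩ : ∃ k : ℕ, G d ^ (2 * k) / (2 * k).factorial < 1 := by
    have h1 := (FloorSemiring.tendsto_pow_div_factorial_atTop (G d)).comp
      (Filter.tendsto_id.const_mul_atTop' (show 0 < 2 by norm_num))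
    exact (h1.eventually (gt_mem_nhds one_pos)).exists
  have hk' : ‖V ^ k‖ < 1 := by
    refine lt_of_le_of_lt (ContinuousLinearMap.opNorm_le_bound _ ?_ fun y => ?_) hk
    · exact div_nonneg (pow_nonneg (hG0 ⟨d, hsd, le_rfl⟩) _) (by positivity)
    · have h0 : 0 ≤ G d ^ (2 * k) / (2 * k).factorial :=
        div_nonneg (pow_nonneg (hG0 ⟨d, hsd, le_rfl⟩) _) (by positivity)
      refine (ContinuousMap.norm_le _ (by positivity)).2 fun x => (key k y x).trans ?_
      rw [mul_comm]
      gcongr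
      · exact hG0 x
      · exact hGd x
  exact isUnit_one_sub_of_norm_pow_lt_one
    (R := C(Icc s d, ℂ) →L[ℂ] C(Icc s d, ℂ)) (x := V) (k := k) hk'

end Volterra

/-! ### The equation in integrated form and the Lagrange identity. -/

namespace SturmLiouville

variable (τ : SturmLiouville)

/-- `τ y = h` on `[s, d]` in integrated form, with quasi-derivative `w = p y'`. -/
structure SolOn (s d : ℝ) (y w h : ℝ → ℂ) : Prop where
  left_mem : s ∈ τ.I
  right_mem : d ∈ τ.I
  prim : IsPrimitiveOn s d y (fun x => w x / τ.p x)
  quasi : IsPrimitiveOn s d w (fun x => τ.q x * y x - τ.r x * h x)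

variable {τ} {s d : ℝ} {y w h z v k : ℝ → ℂ}

lemma Icc_subset_I (hs : s ∈ τ.I) (hd : d ∈ τ.I) : Icc s d ⊆ τ.I :=
  Icc_subset_uIcc.trans (τ.uIcc_subset_I hs hd)

lemma measurableSet_I : MeasurableSet τ.I := τ.isOpen_I.measurableSet

lemma p_ne_zero {x : ℝ} (hx : x ∈ τ.I) : (τ.p x : ℂ) ≠ 0 := by
  exact_mod_cast (τ.p_pos x hx).ne'

lemma r_ne_zero {x : ℝ} (hx : x ∈ τ.I) : (τ.r x : ℂ) ≠ 0 := by
  exact_mod_cast (τ.r_pos x hx).ne'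

lemma continuousOn_inv_p : ContinuousOn (fun x => (τ.p x : ℂ)⁻¹) τ.I :=
  (Complex.continuous_ofReal.comp_continuousOn τ.continuousOn_p).inv₀ fun _ hx => p_ne_zero hx

lemma continuousOn_r' : ContinuousOn (fun x => (τ.r x : ℂ)) τ.I :=
  Complex.continuous_ofReal.comp_continuousOn τ.continuousOn_r

lemma intervalIntegrable_of_continuousOn_I {f : ℝ → ℂ} (hf : ContinuousOn f τ.I) (hs : s ∈ τ.I)
    (hd : d ∈ τ.I) : IntervalIntegrable f volume s d :=
  (hf.mono (τ.uIcc_subset_I hs hd)).intervalIntegrable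

lemma intervalIntegrable_inv_p (hs : s ∈ τ.I) (hd : d ∈ τ.I) :
    IntervalIntegrable (fun x => (τ.p x : ℂ)⁻¹) volume s d :=
  intervalIntegrable_of_continuousOn_I continuousOn_inv_p hs hd

lemma intervalIntegrable_r (hs : s ∈ τ.I) (hd : d ∈ τ.I) :
    IntervalIntegrable (fun x => (τ.r x : ℂ)) volume s d :=
  intervalIntegrable_of_continuousOn_I continuousOn_r' hs hd

lemma intervalIntegrable_q (hs : s ∈ τ.I) (hd : d ∈ τ.I) :
    IntervalIntegrable (fun x => (τ.q x : ℂ)) volume s d := by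
  have h1 : IntegrableOn τ.q (uIcc s d) volume :=
    τ.locallyIntegrableOn_q.integrableOn_compact_subset (τ.uIcc_subset_I hs hd) isCompact_uIcc
  rw [intervalIntegrable_iff]
  exact (h1.mono_set uIoc_subset_uIcc).ofReal

namespace SolOn

lemma le (hy : τ.SolOn s d y w h) : s ≤ d := hy.prim.le

lemma subset (hy : τ.SolOn s d y w h) : Icc s d ⊆ τ.I := Icc_subset_I hy.left_mem hy.right_mem

lemma mono {s' d' : ℝ} (hy : τ.SolOn s d y w h) (h₁ : s ≤ s') (h' : s' ≤ d') (h'' : d' ≤ d) :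
    τ.SolOn s' d' y w h :=
  ⟨hy.subset ⟨h₁, h'.trans h''⟩, hy.subset ⟨h₁.trans h', h''⟩, hy.prim.mono h₁ h' h'',
    hy.quasi.mono h₁ h' h''⟩

lemma congr {y' w' h' : ℝ → ℂ} (hy : τ.SolOn s d y w h) (e₁ : ∀ x ∈ Icc s d, y x = y' x)
    (e₂ : ∀ x ∈ Icc s d, w x = w' x) (e₃ : ∀ᵐ x, x ∈ Ioc s d → h x = h' x) :
    τ.SolOn s d y' w' h' :=
  ⟨hy.left_mem, hy.right_mem,
    hy.prim.congr e₁ (Filter.Eventually.of_forall fun x hx => by rw [e₂ x (Ioc_subset_Icc_self hx)]),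
    hy.quasi.congr e₂ (by
      filter_upwards [e₃] with x hx hxI
      rw [e₁ x (Ioc_subset_Icc_self hxI), hx hxI])⟩

lemma sub (hy : τ.SolOn s d y w h) (hz : τ.SolOn s d z v k) :
    τ.SolOn s d (fun x => y x - z x) (fun x => w x - v x) (fun x => h x - k x) :=
  ⟨hy.left_mem, hy.right_mem,
    (hy.prim.sub hz.prim).congr (fun _ _ => rfl) (Filter.Eventually.of_forall fun x _ => by ring),
    (hy.quasi.sub hz.quasi).congr (fun _ _ => rfl)
      (Filter.Eventually.of_forall fun x _ => by ring)⟩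

lemma const_mul (hy : τ.SolOn s d y w h) (c : ℂ) :
    τ.SolOn s d (fun x => c * y x) (fun x => c * w x) (fun x => c * h x) :=
  ⟨hy.left_mem, hy.right_mem,
    (hy.prim.const_mul c).congr (fun _ _ => rfl)
      (Filter.Eventually.of_forall fun x _ => by ring),
    (hy.quasi.const_mul c).congr (fun _ _ => rfl)
      (Filter.Eventually.of_forall fun x _ => by ring)⟩

lemma conj (hy : τ.SolOn s d y w h) :
    τ.SolOn s d (fun x => starRingEnd ℂ (y x)) (fun x => starRingEnd ℂ (w x))
      (fun x => starRingEnd ℂ (h x)) :=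
  ⟨hy.left_mem, hy.right_mem,
    hy.prim.conj.congr (fun _ _ => rfl) (Filter.Eventually.of_forall fun x _ => by simp),
    hy.quasi.conj.congr (fun _ _ => rfl) (Filter.Eventually.of_forall fun x _ => by simp)⟩

/-- The Lagrange identity. -/
lemma lagrange (hy : τ.SolOn s d y w h) (hz : τ.SolOn s d z v k) :
    IsPrimitiveOn s d (fun x => y x * v x - w x * z x)
      (fun x => τ.r x * (h x * z x - y x * k x)) := by
  refine ((hy.prim.mul hz.quasi).sub (hy.quasi.mul hz.prim)).congr (fun _ _ => rfl)
    (Filter.Eventually.of_forall fun x _ => ?_)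
  ring

lemma lagrange_eq (hy : τ.SolOn s d y w h) (hz : τ.SolOn s d z v k) :
    (y d * v d - w d * z d) - (y s * v s - w s * z s) =
      ∫ x in s..d, τ.r x * (h x * z x - y x * k x) :=
  (hy.lagrange hz).sub_eq

/-- The Wronskian of two solutions for the same spectral parameter is constant. -/
lemma wronskian_eq {lam : ℂ} (hy : τ.SolOn s d y w (fun x => lam * y x))
    (hz : τ.SolOn s d z v (fun x => lam * z x)) {x : ℝ} (hx : x ∈ Icc s d) :
    y x * v x - w x * z x = y s * v s - w s * z s := by
  have h1 := ((hy.mono le_rfl hx.1 hx.2).lagrange_eq (hz.mono le_rfl hx.1 hx.2))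
  rw [intervalIntegral.integral_congr (g := fun _ => 0) fun x _ => by ring,
    intervalIntegral.integral_zero] at h1
  exact sub_eq_zero.1 h1

end SolOn

/-- The equation for `p y'` holds only almost everywhere, so absolute continuity is used to
integrate it. The quotient `(p y') / p` is then continuous, and the fundamental theorem of calculus
gives the equation for `y`. -/
lemma Eqn.solOn (hy : τ.Eqn y h) (hs : s ∈ τ.I) (hd : d ∈ τ.I) (hsd : s ≤ d) :
    τ.SolOn s d y (τ.quasiDeriv y) h := by
  have hAC := hy.locallyAC s hs d hd
  have hsub := Icc_subset_I hs hd
  have hdiff : ∀ x ∈ Icc s d, HasDerivAt y (τ.quasiDeriv y x / τ.p x) x := fun x hx => by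
    have h1 := (hy.differentiableOn.differentiableAt (τ.isOpen_I.mem_nhds (hsub hx))).hasDerivAt
    rwa [quasiDeriv, mul_div_cancel_left₀ _ (p_ne_zero (hsub hx))]
  have hae : ∀ᵐ x, x ∈ Icc s d →
      HasDerivAt (τ.quasiDeriv y) ((τ.q x : ℂ) * y x - (τ.r x : ℂ) * h x) x := by
    filter_upwards [(ae_restrict_iff' measurableSet_I).1 hy.eqn] with x hx hxI
    exact hx (hsub hxI)
  have hint : IntervalIntegrable (fun x => τ.q x * y x - τ.r x * h x) volume s d := by
    -- Integrability of the almost-everywhere derivative is obtained for real-valued absolutely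
    -- continuous functions, so real and imaginary parts are treated separately.
    have key : ∀ L : ℂ →L[ℝ] ℝ, (∀ x y, dist (L x) (L y) ≤ dist x y) →
        AbsolutelyContinuousOnInterval (fun x => L (τ.quasiDeriv y x)) s d := by
      intro L hL
      rw [absolutelyContinuousOnInterval_iff] at hAC ⊢
      intro ε hε
      obtain ⟨δ, hδ, h⟩ := hAC ε hε
      exact ⟨δ, hδ, fun E hE hlt => lt_of_le_of_lt (Finset.sum_le_sum fun i _ => hL _ _)
        (h E hE hlt)⟩
    have h1 := (key Complex.reCLM (fun x y => by
      rw [dist_eq_norm, dist_eq_norm, ← map_sub]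
      simpa using Complex.abs_re_le_norm (x - y))).intervalIntegrable_deriv
    have h2 := (key Complex.imCLM (fun x y => by
      rw [dist_eq_norm, dist_eq_norm, ← map_sub]
      simpa using Complex.abs_im_le_norm (x - y))).intervalIntegrable_deriv
    rw [intervalIntegrable_iff] at h1 h2 ⊢
    refine (h1.ofReal.add (h2.ofReal.mul_const Complex.I)).congr ?_
    rw [Filter.EventuallyEq, ae_restrict_iff' measurableSet_uIoc]
    filter_upwards [hae] with x hx hxI
    rw [uIoc_of_le hsd] at hxI
    have h3 := hx (Ioc_subset_Icc_self hxI)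
    have h4 : deriv (fun x => Complex.reCLM (τ.quasiDeriv y x)) x = _ :=
      (Complex.reCLM.hasFDerivAt.comp_hasDerivAt x h3).deriv
    have h5 : deriv (fun x => Complex.imCLM (τ.quasiDeriv y x)) x = _ :=
      (Complex.imCLM.hasFDerivAt.comp_hasDerivAt x h3).deriv
    simp only [Pi.add_apply, h4, h5]
    exact Complex.re_add_im (τ.q x * y x - τ.r x * h x)
  have hprim : IsPrimitiveOn s d (τ.quasiDeriv y) (fun x => τ.q x * y x - τ.r x * h x) :=
    .of_ac hsd hAC hint hae
  have hc : ContinuousOn (fun x => τ.quasiDeriv y x / τ.p x) (Icc s d) := by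
    simp only [div_eq_mul_inv]
    exact hprim.continuousOn.mul (continuousOn_inv_p.mono hsub)
  refine ⟨hs, hd, ⟨hsd, ?_, fun x hx => ?_⟩, hprim⟩
  · rw [← uIcc_of_le hsd] at hc
    exact hc.intervalIntegrable
  · have hsub' : uIcc s x ⊆ Icc s d := by
      rw [uIcc_of_le hx.1]
      exact Icc_subset_Icc_right hx.2
    rw [intervalIntegral.integral_eq_sub_of_hasDerivAt (fun t ht => hdiff t (hsub' ht))
      (hc.mono hsub').intervalIntegrable]
    ring

/-- A solution on `[s, d]` with zero data at both endpoints extends by zero. -/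
lemma SolOn.eqn_indicator (hy : τ.SolOn s d y w h) (hys : y s = 0) (hws : w s = 0) (hyd : y d = 0)
    (hwd : w d = 0) : τ.Eqn ((Icc s d).indicator y) ((Icc s d).indicator h) := by
  set Y := (Icc s d).indicator y with hY
  set W := (Icc s d).indicator w with hW
  set H := (Icc s d).indicator h with hH
  -- An indefinite integral with zero values at both ends remains one, on any larger interval, when
  -- it and its integrand are extended by zero.
  have ext : ∀ (F f : ℝ → ℂ), IsPrimitiveOn s d F f → F s = 0 → F d = 0 → ∀ (f' : ℝ → ℂ),
      (f' = (Icc s d).indicator f) → ∀ c e, c ≤ s → d ≤ e →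
        IsPrimitiveOn c e ((Icc s d).indicator F) f' := by
    rintro F f hF hFs hFd f' rfl c e hc he
    have hgl : Integrable ((Icc s d).indicator f) volume := by
      rw [integrable_indicator_iff measurableSet_Icc]
      exact (integrableOn_Icc_iff_integrableOn_Ioc (by simp)).2
        ((intervalIntegrable_iff_integrableOn_Ioc_of_le hF.le).1 hF.integrable)
    have hi : ∀ a b, IntervalIntegrable ((Icc s d).indicator f) volume a b :=
      fun a b => hgl.intervalIntegrable
    have h0 : ∀ x ≤ s, ∫ t in c..x, (Icc s d).indicator f t = 0 := by
      intro x hx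
      refine intervalIntegral.integral_zero_ae ?_
      have h₁ : ∀ᵐ x : ℝ, x ≠ s := by simp [ae_iff, measure_singleton]
      filter_upwards [h₁] with t ht ht'
      have hts : t ≤ s := (ht'.2.trans (max_le hc hx))
      exact indicator_of_notMem (fun hm => ht (le_antisymm hts hm.1)) _
    have hF0 : ∀ x ≤ s, (Icc s d).indicator F x = 0 := by
      intro x hx
      rcases hx.eq_or_lt with rfl | hx
      · rw [indicator_of_mem (show x ∈ Icc x d from ⟨le_rfl, hF.le⟩), hFs]
      · exact indicator_of_notMem (fun hm => hx.not_ge hm.1) _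
    have h1 : ∀ x ∈ Icc s d, ∫ t in c..x, (Icc s d).indicator f t = F x := by
      intro x hx
      rw [← intervalIntegral.integral_add_adjacent_intervals (hi c s) (hi s x), h0 s le_rfl,
        hF.eq x hx, hFs]
      congr 1
      refine intervalIntegral.integral_congr fun t ht => ?_
      rw [uIcc_of_le hx.1] at ht
      exact indicator_of_mem (show t ∈ Icc s d from ⟨ht.1, ht.2.trans hx.2⟩) _
    refine ⟨hc.trans (hF.le.trans he), hi c e, fun x hx => ?_⟩
    rw [hF0 c hc, zero_add]
    rcases le_total x s with hxs | hxs
    · rw [h0 x hxs, hF0 x hxs]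
    rcases le_or_gt x d with hxd | hxd
    · rw [h1 x ⟨hxs, hxd⟩, indicator_of_mem (show x ∈ Icc s d from ⟨hxs, hxd⟩)]
    · rw [indicator_of_notMem (fun hm => hxd.not_ge hm.2),
        ← intervalIntegral.integral_add_adjacent_intervals (hi c d) (hi d x),
        h1 d ⟨hF.le, le_rfl⟩, hFd, zero_add]
      symm
      refine intervalIntegral.integral_zero_ae (Filter.Eventually.of_forall fun t ht => ?_)
      rw [uIoc_of_le hxd.le] at ht
      exact indicator_of_notMem (fun hm => ht.1.not_ge hm.2) _
  have hYp := ext y _ hy.prim hys hyd (fun x => W x / τ.p x) (by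
    ext x; by_cases hx : x ∈ Icc s d <;> simp [hW, hx])
  have hWp := ext w _ hy.quasi hws hwd (fun x => τ.q x * Y x - τ.r x * H x) (by
    ext x; by_cases hx : x ∈ Icc s d <;> simp [hY, hH, hx])
  have hWc : ContinuousOn W τ.I := by
    intro x hx
    have := (hWp (min s (x - 1)) (max d (x + 1)) (min_le_left _ _) (le_max_left _ _)).continuousOn
    exact (this.continuousAt (Icc_mem_nhds (by simp) (by simp))).continuousWithinAt
  -- Differentiability is needed at every point, including `s` and `d`. It holds because `W / p` is
  -- continuous on all of `(a, b)`, as `w` vanishes at both ends.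
  have hder : ∀ x ∈ τ.I, HasDerivAt Y (W x / τ.p x) x := by
    intro x hx
    obtain ⟨ε, hε, hball⟩ := Metric.isOpen_iff.1 τ.isOpen_I x hx
    set c := min s (x - ε / 2)
    set e := max d (x + ε / 2)
    have hcx : c < x := (min_le_right _ _).trans_lt (by linarith)
    have hxe : x < e := lt_of_lt_of_le (by linarith) (le_max_right _ _)
    have hP := hYp c e (min_le_left _ _) (le_max_left _ _)
    have hcI : c ∈ τ.I := by
      rcases min_choice s (x - ε / 2) with h | h <;> simp only [c, h]
      · exact hy.left_mem
      · exact hball (by rw [Metric.mem_ball, Real.dist_eq, abs_lt]; constructor <;> linarith)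
    have hcont : ContinuousOn (fun x => W x / τ.p x) τ.I := by
      simp only [div_eq_mul_inv]
      exact hWc.mul continuousOn_inv_p
    have h1 : HasDerivAt (fun u => ∫ t in c..u, W t / τ.p t) (W x / τ.p x) x := by
      refine intervalIntegral.integral_hasDerivAt_right ?_ ?_ ?_
      · exact intervalIntegrable_of_continuousOn_I hcont hcI hx
      · exact hcont.stronglyMeasurableAtFilter τ.isOpen_I x hx
      · exact hcont.continuousAt (τ.isOpen_I.mem_nhds hx)
    refine (h1.const_add (Y c)).congr_of_eventuallyEq ?_
    filter_upwards [Icc_mem_nhds hcx hxe] with t ht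
    exact hP.eq t ht
  have hq : ∀ x ∈ τ.I, τ.quasiDeriv Y x = W x := by
    intro x hx
    rw [quasiDeriv, (hder x hx).deriv, mul_div_cancel₀ _ (p_ne_zero hx)]
  refine ⟨fun x hx => (hder x hx).differentiableAt.differentiableWithinAt, fun c hc e he => ?_, ?_⟩
  · have h1 := (hWp (min s (min c e)) (max d (max c e)) (min_le_left _ _) (le_max_left _ _)).ac
    refine (h1.mono ?_).congr_eqOn fun x hx => (hq x (τ.uIcc_subset_I hc he hx)).symm
    rw [uIcc_of_le ((min_le_left _ _).trans (hy.le.trans (le_max_left _ _)))]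
    exact Icc_subset_Icc (min_le_right _ _) (le_max_right _ _)
  · rw [ae_restrict_iff' measurableSet_I]
    have h1 : ∀ n : ℕ, ∀ᵐ x, x ∈ Icc (s - n) (d + n) →
        HasDerivAt W (τ.q x * Y x - τ.r x * H x) x := fun n =>
      (hWp (s - n) (d + n) (by simp) (by simp)).ae_hasDerivAt
    -- Countably many intervals cover the line, so the exceptional null sets can be united.
    filter_upwards [ae_all_iff.2 h1] with x hx hxI
    obtain ⟨n, hn⟩ := exists_nat_ge (max (s - x) (x - d))
    have h2 := hx n ⟨by linarith [le_max_left (s - x) (x - d)],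
      by linarith [le_max_right (s - x) (x - d)]⟩
    refine h2.congr_of_eventuallyEq ?_
    filter_upwards [τ.isOpen_I.mem_nhds hxI] with t ht
    exact hq t ht

end SturmLiouville

/-! ### Initial value problems and their entire dependence on the spectral parameter. -/

lemma differentiable_sub_smul {F : Type*} [NormedAddCommGroup F] [NormedSpace ℂ F] (Q R : F) :
    Differentiable ℂ (fun lam : ℂ => Q - lam • R) := by
  fun_prop

/-- Inversion is holomorphic on the units of a Banach algebra, and the operator being inverted is
affine in `lam`. -/
lemma differentiable_inverse_one_sub {E : Type*} [NormedAddCommGroup E] [NormedSpace ℂ E]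
    [CompleteSpace E] (P Q R : E →L[ℂ] E) (h : ∀ lam : ℂ, IsUnit (1 - P ∘L (Q - lam • R))) (u : E) :
    Differentiable ℂ (fun lam : ℂ => Ring.inverse (1 - P ∘L (Q - lam • R)) u) := by
  have h1 : Differentiable ℂ (fun lam : ℂ => 1 - P ∘L (Q - lam • R)) :=
    (differentiable_const _).sub ((differentiable_const P).clm_comp (differentiable_sub_smul Q R))
  have h2 : Differentiable ℂ (fun lam : ℂ => Ring.inverse (1 - P ∘L (Q - lam • R))) := fun lam =>
    DifferentiableAt.comp (g := Ring.inverse) lam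
      (differentiableAt_inverse (𝕜 := ℂ) (R := E →L[ℂ] E) (h lam)) (h1 lam)
  exact h2.clm_apply (differentiable_const u)

namespace SturmLiouville

variable {τ : SturmLiouville} {s d : ℝ}

/-- The Volterra operator of the equation `τ y = lam y` on `[s, d]`. -/
noncomputable def volterraOp (hs : s ∈ τ.I) (hd : d ∈ τ.I) (hsd : s ≤ d) (lam : ℂ) :
    C(Icc s d, ℂ) →L[ℂ] C(Icc s d, ℂ) :=
  volterra hsd _ (intervalIntegrable_inv_p hs hd) ∘L
    (volterra hsd _ (intervalIntegrable_q hs hd) -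
      lam • volterra hsd _ (intervalIntegrable_r hs hd))

lemma volterra_q_sub_smul_r (hs : s ∈ τ.I) (hd : d ∈ τ.I) (hsd : s ≤ d) (lam : ℂ) :
    volterra hsd _ (intervalIntegrable_q hs hd) - lam • volterra hsd _ (intervalIntegrable_r hs hd)
      = volterra hsd _ ((intervalIntegrable_q hs hd).add
        ((intervalIntegrable_r hs hd).const_mul (-lam))) := by
  rw [volterra_add_smul hsd _ _ (intervalIntegrable_q hs hd) (intervalIntegrable_r hs hd) (-lam)]
  ext y x
  simp [sub_eq_add_neg]

lemma isUnit_one_sub_volterraOp (hs : s ∈ τ.I) (hd : d ∈ τ.I) (hsd : s ≤ d) (lam : ℂ) :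
    IsUnit (1 - volterraOp hs hd hsd lam) := by
  rw [volterraOp, volterra_q_sub_smul_r hs hd]
  exact isUnit_one_sub_volterra_comp hsd _ _

/-- The continuous function on `[s, d]` that solves `p y' = w`, `w' = -g` with data
`(y₀, w₀)` at `s`. -/
noncomputable def source (hs : s ∈ τ.I) (hd : d ∈ τ.I) (hsd : s ≤ d) {g : ℝ → ℂ}
    (hg : IntervalIntegrable g volume s d) (y₀ w₀ : ℂ) : C(Icc s d, ℂ) :=
  ContinuousMap.const _ y₀ + w₀ • volterra hsd _ (intervalIntegrable_inv_p hs hd) 1 -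
    volterra hsd _ (intervalIntegrable_inv_p hs hd) (volterra hsd g hg 1)

/-- The solution on `[s, d]` of `-(p y')' + q y = r lam y + g` with data `(y₀, w₀)` at `s`. -/
noncomputable def sol (hs : s ∈ τ.I) (hd : d ∈ τ.I) (hsd : s ≤ d) {g : ℝ → ℂ}
    (hg : IntervalIntegrable g volume s d) (y₀ w₀ : ℂ) (lam : ℂ) : C(Icc s d, ℂ) :=
  Ring.inverse (1 - volterraOp hs hd hsd lam) (source hs hd hsd hg y₀ w₀)

lemma differentiable_sol (hs : s ∈ τ.I) (hd : d ∈ τ.I) (hsd : s ≤ d) {g : ℝ → ℂ}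
    (hg : IntervalIntegrable g volume s d) (y₀ w₀ : ℂ) :
    Differentiable ℂ (sol hs hd hsd hg y₀ w₀) :=
  differentiable_inverse_one_sub _ _ _ (isUnit_one_sub_volterraOp hs hd hsd) _

/-- Eliminating the quasi-derivative from the integrated first-order system leaves this fixed-point
equation; its unique solvability carries both existence and uniqueness. -/
lemma eq_sol_iff (hs : s ∈ τ.I) (hd : d ∈ τ.I) (hsd : s ≤ d) {g : ℝ → ℂ}
    (hg : IntervalIntegrable g volume s d) (y₀ w₀ lam : ℂ) (y : C(Icc s d, ℂ)) :
    y = sol hs hd hsd hg y₀ w₀ lam ↔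
      y = source hs hd hsd hg y₀ w₀ + volterraOp hs hd hsd lam y := by
  have hu := isUnit_one_sub_volterraOp hs hd hsd lam
  constructor
  · rintro rfl
    have h1 := DFunLike.congr_fun (Ring.mul_inverse_cancel _ hu) (source hs hd hsd hg y₀ w₀)
    rw [mul_apply_eq_comp, one_apply_eq_self] at h1
    change (1 - volterraOp hs hd hsd lam) (sol hs hd hsd hg y₀ w₀ lam) = _ at h1
    rw [sub_apply, one_apply_eq_self] at h1
    exact eq_add_of_sub_eq h1
  · intro h
    have h1 := DFunLike.congr_fun (Ring.inverse_mul_cancel _ hu) y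
    rw [mul_apply_eq_comp, one_apply_eq_self,
      sub_apply, one_apply_eq_self, sub_eq_of_eq_add h] at h1
    exact h1.symm

lemma sol_apply_left (hs : s ∈ τ.I) (hd : d ∈ τ.I) (hsd : s ≤ d) {g : ℝ → ℂ}
    (hg : IntervalIntegrable g volume s d) (y₀ w₀ lam : ℂ) :
    sol hs hd hsd hg y₀ w₀ lam ⟨s, le_rfl, hsd⟩ = y₀ := by
  have h := DFunLike.congr_fun ((eq_sol_iff hs hd hsd hg y₀ w₀ lam _).1 rfl) ⟨s, le_rfl, hsd⟩
  rw [h]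
  simp [source, volterraOp, volterra_apply]

/-- The quasi-derivative of `sol`. -/
noncomputable def solQuasi (hs : s ∈ τ.I) (hd : d ∈ τ.I) (hsd : s ≤ d) {g : ℝ → ℂ}
    (hg : IntervalIntegrable g volume s d) (y₀ w₀ lam : ℂ) : C(Icc s d, ℂ) :=
  ContinuousMap.const _ w₀ + (volterra hsd _ (intervalIntegrable_q hs hd) -
    lam • volterra hsd _ (intervalIntegrable_r hs hd)) (sol hs hd hsd hg y₀ w₀ lam) -
    volterra hsd g hg 1

lemma solQuasi_apply_left (hs : s ∈ τ.I) (hd : d ∈ τ.I) (hsd : s ≤ d) {g : ℝ → ℂ}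
    (hg : IntervalIntegrable g volume s d) (y₀ w₀ lam : ℂ) :
    solQuasi hs hd hsd hg y₀ w₀ lam ⟨s, le_rfl, hsd⟩ = w₀ := by
  simp [solQuasi, volterra_apply]

lemma solOn_sol (hs : s ∈ τ.I) (hd : d ∈ τ.I) (hsd : s ≤ d) {f : ℝ → ℂ}
    (hf : IntervalIntegrable (fun x => τ.r x * f x) volume s d) (y₀ w₀ lam : ℂ) :
    τ.SolOn s d (IccExtend hsd (sol hs hd hsd hf y₀ w₀ lam))
      (IccExtend hsd (solQuasi hs hd hsd hf y₀ w₀ lam))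
      (fun x => lam * IccExtend hsd (sol hs hd hsd hf y₀ w₀ lam) x + f x) := by
  set y := sol hs hd hsd hf y₀ w₀ lam with hy
  set w := solQuasi hs hd hsd hf y₀ w₀ lam with hw
  have e1 : y = ContinuousMap.const _ y₀ + volterra hsd _ (intervalIntegrable_inv_p hs hd) w := by
    conv_lhs => rw [(eq_sol_iff hs hd hsd hf y₀ w₀ lam y).1 hy]
    have : ContinuousMap.const (Icc s d) w₀ = w₀ • 1 := by ext; simp
    rw [hw, solQuasi, map_sub, map_add, source, volterraOp, this, map_smul,
      ContinuousLinearMap.comp_apply]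
    abel
  refine ⟨hs, hd, ?_, ?_⟩
  · refine (isPrimitiveOn_volterra hsd _ (intervalIntegrable_inv_p hs hd) w y₀).congr
      (fun x hx => ?_) (Filter.Eventually.of_forall fun x hx => ?_)
    · conv_rhs => rw [e1]
      simp [IccExtend]
    · rw [div_eq_inv_mul]
  · have h1 := isPrimitiveOn_volterra hsd _ ((intervalIntegrable_q hs hd).add
        ((intervalIntegrable_r hs hd).const_mul (-lam))) y w₀
    have h2 := isPrimitiveOn_volterra hsd _ hf 1 0
    refine (h1.sub h2).congr (fun x hx => ?_) (Filter.Eventually.of_forall fun x hx => ?_)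
    · rw [hw, solQuasi, volterra_q_sub_smul_r hs hd]
      simp [IccExtend, hy]
    · simp [IccExtend]
      ring

lemma exists_solOn (hs : s ∈ τ.I) (hd : d ∈ τ.I) (hsd : s ≤ d) {f : ℝ → ℂ}
    (hf : IntervalIntegrable (fun x => τ.r x * f x) volume s d) (y₀ w₀ lam : ℂ) :
    ∃ y w, τ.SolOn s d y w (fun x => lam * y x + f x) ∧ y s = y₀ ∧ w s = w₀ := by
  refine ⟨_, _, solOn_sol hs hd hsd hf y₀ w₀ lam, ?_, ?_⟩
  · rw [IccExtend_of_mem hsd _ ⟨le_rfl, hsd⟩, sol_apply_left]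
  · rw [IccExtend_of_mem hsd _ ⟨le_rfl, hsd⟩, solQuasi_apply_left]

namespace SolOn

variable {y w h : ℝ → ℂ} {lam : ℂ}

/-- Every solution obeys the fixed-point equation, so it coincides with the constructed one. Besides
uniqueness, this lets a family such as `φ` inherit the analytic dependence of `sol`. -/
lemma eq_sol (hsd : s ≤ d) {f : ℝ → ℂ}
    (hf : IntervalIntegrable (fun x => τ.r x * f x) volume s d)
    (hy : τ.SolOn s d y w (fun x => lam * y x + f x)) :
    (⟨fun x : Icc s d => y x, hy.prim.continuousOn.comp_continuous continuous_subtype_val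
      fun x => x.2⟩ : C(Icc s d, ℂ)) = sol hy.left_mem hy.right_mem hsd hf (y s) (w s) lam := by
  set Y : C(Icc s d, ℂ) := ⟨fun x : Icc s d => y x, _⟩
  set W : C(Icc s d, ℂ) := ⟨fun x : Icc s d => w x,
    hy.quasi.continuousOn.comp_continuous continuous_subtype_val fun x => x.2⟩
  have hs := hy.left_mem
  have hd := hy.right_mem
  have e1 : Y = ContinuousMap.const _ (y s) +
      volterra hsd _ (intervalIntegrable_inv_p hs hd) W := by
    ext x
    rw [ContinuousMap.add_apply, volterra_congr hsd _ _ _ w fun t ht => rfl]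
    simp only [← div_eq_inv_mul]
    exact hy.prim.eq x x.2
  have e2 : W = ContinuousMap.const _ (w s) + (volterra hsd _ (intervalIntegrable_q hs hd) -
    lam • volterra hsd _ (intervalIntegrable_r hs hd)) Y - volterra hsd _ hf 1 := by
    ext x
    have hi : ∀ {g : ℝ → ℂ}, IntervalIntegrable g volume s d →
        IntervalIntegrable g volume s x := fun hg => hg.mono_set (by
      rw [uIcc_of_le hsd, uIcc_of_le x.2.1]; exact Icc_subset_Icc_right x.2.2)
    rw [volterra_q_sub_smul_r hs hd, ContinuousMap.sub_apply, ContinuousMap.add_apply,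
      volterra_congr hsd _ _ _ y fun t ht => rfl, volterra_congr hsd _ _ _ (fun _ => 1)
      fun t ht => rfl, ContinuousMap.const_apply, add_sub_assoc, ← intervalIntegral.integral_sub]
    · refine (hy.quasi.eq x x.2).trans ?_
      congr 1
      refine intervalIntegral.integral_congr fun t _ => ?_
      ring
    · refine (hi ((intervalIntegrable_q hs hd).add
        ((intervalIntegrable_r hs hd).const_mul (-lam)))).mul_continuousOn ?_
      refine hy.prim.continuousOn.mono ?_
      rw [uIcc_of_le x.2.1]; exact Icc_subset_Icc_right x.2.2
    · simpa using hi hf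
  rw [eq_sol_iff, source, volterraOp, ContinuousLinearMap.comp_apply]
  conv_lhs => rw [e1, e2]
  have : ContinuousMap.const (Icc s d) (w s) = w s • 1 := by ext; simp
  rw [map_sub, map_add, this, map_smul]
  abel

/-- Uniqueness for the initial value problem at the left endpoint. -/
lemma eq_zero_of_left (hy : τ.SolOn s d y w (fun x => lam * y x)) (h₁ : y s = 0) (h₂ : w s = 0) :
    (∀ x ∈ Icc s d, y x = 0) ∧ ∀ x ∈ Icc s d, w x = 0 := by
  have hy' : τ.SolOn s d y w (fun x => lam * y x + (fun _ => 0) x) := by simpa using hy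
  have h0 : IntervalIntegrable (fun x => (τ.r x : ℂ) * (fun _ => (0 : ℂ)) x) volume s d := by simp
  have h3 := hy'.eq_sol hy.le h0
  rw [h₁, h₂] at h3
  have h4 : (0 : C(Icc s d, ℂ)) = sol hy.left_mem hy.right_mem hy.le h0 0 0 lam := by
    rw [eq_sol_iff]
    ext x
    simp [source, volterra_apply, IccExtend]
  have h5 : ∀ x ∈ Icc s d, y x = 0 := fun x hx => DFunLike.congr_fun (h3.trans h4.symm) ⟨x, hx⟩
  refine ⟨h5, fun x hx => ?_⟩
  rw [hy.quasi.eq x hx, h₂, zero_add]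
  refine (intervalIntegral.integral_congr (g := fun _ => 0) fun t ht => ?_).trans (by simp)
  rw [uIcc_of_le hx.1] at ht
  simp [h5 t ⟨ht.1, ht.2.trans hx.2⟩]

/-- Uniqueness for the initial value problem at the right endpoint. -/
lemma eq_zero_of_right (hy : τ.SolOn s d y w (fun x => lam * y x)) (h₁ : y d = 0) (h₂ : w d = 0) :
    ∀ x ∈ Icc s d, y x = 0 := by
  have h0 : IntervalIntegrable (fun x => (τ.r x : ℂ) * (fun _ => (0 : ℂ)) x) volume s d := by simp
  -- The Wronskians of `y` with a fundamental system vanish at `d`, hence also at `s`, where they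
  -- are the data of `y` up to sign. This reduces the claim to the left endpoint.
  obtain ⟨θ, ν, hθ, hθs, hνs⟩ := exists_solOn hy.left_mem hy.right_mem hy.le h0 0 1 lam
  obtain ⟨η, ξ, hη, hηs, hξs⟩ := exists_solOn hy.left_mem hy.right_mem hy.le h0 1 0 lam
  simp only [add_zero] at hθ hη
  have hd : d ∈ Icc s d := ⟨hy.le, le_rfl⟩
  have e1 := hy.wronskian_eq hθ hd
  have e2 := hy.wronskian_eq hη hd
  rw [h₁, h₂, hθs, hνs] at e1
  rw [h₁, h₂, hηs, hξs] at e2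
  exact (hy.eq_zero_of_left (by linear_combination -e1) (by linear_combination e2)).1

end SolOn

end SturmLiouville

/-! ### The weighted measure and its `L²` space. -/

namespace SturmLiouville

variable {τ : SturmLiouville} {s d : ℝ}

lemma ae_of_ae_μ {P : ℝ → Prop} (h : ∀ᵐ x ∂τ.μ, P x) : ∀ᵐ x, x ∈ τ.I → P x :=
  (ae_restrict_iff' measurableSet_I).1 (τ.ae_μ_iff.1 h)

lemma ae_μ_of_ae {P : ℝ → Prop} (h : ∀ᵐ x, x ∈ τ.I → P x) : ∀ᵐ x ∂τ.μ, P x :=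
  τ.ae_μ_iff.2 ((ae_restrict_iff' measurableSet_I).2 h)

lemma ae_μ_mem_I : ∀ᵐ x ∂τ.μ, x ∈ τ.I := ae_μ_of_ae (Filter.Eventually.of_forall fun _ h => h)

lemma restrict_μ {S : Set ℝ} (hS : MeasurableSet S) (hSI : S ⊆ τ.I) :
    τ.μ.restrict S = (volume.restrict S).withDensity (fun x => (Real.toNNReal (τ.r x) : ENNReal)) := by
  rw [μ, restrict_withDensity hS, Measure.restrict_restrict hS, inter_eq_left.2 hSI]
  rfl

lemma aemeasurable_toNNReal_r {S : Set ℝ} (hS : MeasurableSet S) (hSI : S ⊆ τ.I) :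
    AEMeasurable (fun x => Real.toNNReal (τ.r x)) (volume.restrict S) :=
  ((τ.continuousOn_r.mono hSI).aemeasurable hS).real_toNNReal

section

variable {E : Type*} [NormedAddCommGroup E] [NormedSpace ℝ E] {S : Set ℝ} {F : ℝ → E}

lemma integrableOn_μ_iff (hS : MeasurableSet S) (hSI : S ⊆ τ.I) :
    IntegrableOn F S τ.μ ↔ IntegrableOn (fun x => τ.r x • F x) S volume := by
  rw [IntegrableOn, restrict_μ hS hSI,
    integrable_withDensity_iff_integrable_smul₀ (aemeasurable_toNNReal_r hS hSI), IntegrableOn]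
  refine integrable_congr ?_
  filter_upwards [ae_restrict_mem hS] with x hx
  rw [NNReal.smul_def, Real.coe_toNNReal _ (τ.r_pos x (hSI hx)).le]

lemma setIntegral_μ (hS : MeasurableSet S) (hSI : S ⊆ τ.I) :
    ∫ x in S, F x ∂τ.μ = ∫ x in S, τ.r x • F x := by
  rw [restrict_μ hS hSI, integral_withDensity_eq_integral_smul₀ (aemeasurable_toNNReal_r hS hSI)]
  refine integral_congr_ae ?_
  filter_upwards [ae_restrict_mem hS] with x hx
  rw [NNReal.smul_def, Real.coe_toNNReal _ (τ.r_pos x (hSI hx)).le]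

lemma setIntegral_Icc_μ (hs : s ∈ τ.I) (hd : d ∈ τ.I) (hsd : s ≤ d) :
    ∫ x in Icc s d, F x ∂τ.μ = ∫ x in s..d, τ.r x • F x := by
  rw [setIntegral_μ measurableSet_Icc (Icc_subset_I hs hd), integral_Icc_eq_integral_Ioc,
    intervalIntegral.integral_of_le hsd]

lemma setIntegral_Icc_μ' {F : ℝ → ℂ} (hs : s ∈ τ.I) (hd : d ∈ τ.I) (hsd : s ≤ d) :
    ∫ x in Icc s d, F x ∂τ.μ = ∫ x in s..d, τ.r x * F x := by
  simp only [setIntegral_Icc_μ hs hd hsd, Complex.real_smul]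

end

lemma μ_Icc_lt_top (hs : s ∈ τ.I) (hd : d ∈ τ.I) : τ.μ (Icc s d) < ⊤ := by
  have h : IntegrableOn (fun _ : ℝ => (1 : ℝ)) (Icc s d) τ.μ := by
    rw [integrableOn_μ_iff measurableSet_Icc (Icc_subset_I hs hd)]
    simpa using (τ.continuousOn_r.mono (Icc_subset_I hs hd)).integrableOn_Icc
  simpa using (integrableOn_const_iff (by simp)).1 h

lemma isFiniteMeasure_restrict_Icc (hs : s ∈ τ.I) (hd : d ∈ τ.I) :
    IsFiniteMeasure (τ.μ.restrict (Icc s d)) :=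
  ⟨by simpa using μ_Icc_lt_top hs hd⟩

lemma intervalIntegrable_r_mul_iff {F : ℝ → ℂ} (hs : s ∈ τ.I) (hd : d ∈ τ.I) (hsd : s ≤ d) :
    IntervalIntegrable (fun x => τ.r x * F x) volume s d ↔ IntegrableOn F (Icc s d) τ.μ := by
  rw [intervalIntegrable_iff_integrableOn_Icc_of_le hsd (by finiteness),
    integrableOn_μ_iff measurableSet_Icc (Icc_subset_I hs hd)]
  simp only [Complex.real_smul]

lemma memLp_of_continuousOn {F : ℝ → ℂ} (hs : s ∈ τ.I) (hd : d ∈ τ.I)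
    (hF : ContinuousOn F (Icc s d)) : MemLp F 2 (τ.μ.restrict (Icc s d)) := by
  have := isFiniteMeasure_restrict_Icc hs hd
  obtain ⟨C, hC⟩ := isCompact_Icc.exists_bound_of_continuousOn hF
  refine MemLp.of_bound (hF.aestronglyMeasurable measurableSet_Icc) C ?_
  filter_upwards [ae_restrict_mem measurableSet_Icc] with x hx using hC x hx

lemma memLp_L2 (f : τ.L2) (S : Set ℝ) : MemLp f 2 (τ.μ.restrict S) := (Lp.memLp f).restrict S

lemma intervalIntegrable_r_mul_of_memLp {F : ℝ → ℂ} (hs : s ∈ τ.I) (hd : d ∈ τ.I) (hsd : s ≤ d)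
    (hF : MemLp F 2 (τ.μ.restrict (Icc s d))) :
    IntervalIntegrable (fun x => τ.r x * F x) volume s d := by
  have := isFiniteMeasure_restrict_Icc hs hd
  exact (intervalIntegrable_r_mul_iff hs hd hsd).2 (hF.integrable (by norm_num))

/-- The class in `L²_r(a, b)` of a function that is square integrable on `S`, extended by zero. -/
noncomputable def cut (S : Set ℝ) (hS : MeasurableSet S) (F : ℝ → ℂ)
    (hF : MemLp F 2 (τ.μ.restrict S)) : τ.L2 :=
  ((memLp_indicator_iff_restrict hS).2 hF).toLp _

lemma coeFn_cut {S : Set ℝ} {hS : MeasurableSet S} {F : ℝ → ℂ}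
    {hF : MemLp F 2 (τ.μ.restrict S)} : cut S hS F hF =ᵐ[τ.μ] S.indicator F :=
  MemLp.coeFn_toLp _

lemma inner_L2 (f g : τ.L2) : inner ℂ f g = ∫ x, starRingEnd ℂ (f x) * g x ∂τ.μ := by
  simp only [L2.inner_def, RCLike.inner_apply']

lemma integrable_conj_mul (f g : τ.L2) : Integrable (fun x => starRingEnd ℂ (f x) * g x) τ.μ := by
  simpa only [RCLike.inner_apply'] using L2.integrable_inner (𝕜 := ℂ) f g

/-- The integral of a function with support in `[s, d]`. -/
lemma integral_μ_of_supp {F : ℝ → ℂ} (hs : s ∈ τ.I) (hd : d ∈ τ.I) (hsd : s ≤ d)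
    (hF : ∀ᵐ x ∂τ.μ, x ∉ Icc s d → F x = 0) : ∫ x, F x ∂τ.μ = ∫ x in s..d, τ.r x * F x := by
  rw [← setIntegral_Icc_μ' hs hd hsd, setIntegral_eq_integral_of_ae_compl_eq_zero hF]

/-! ### The preminimal operator -/

lemma mem_graph_preminimalOp {x : τ.L2 × τ.L2} :
    x ∈ τ.preminimalOp.graph ↔ x ∈ τ.maximalGraph ∧ x.1 ∈ τ.compactSupp := by
  rw [← graph_maximalOp]
  simp only [LinearPMap.mem_graph_iff]
  constructor
  · rintro ⟨⟨y, hy1, hy2⟩, hyx, hyx'⟩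
    exact ⟨⟨⟨y, hy2⟩, hyx, by rw [← hyx']; rfl⟩, by rw [← hyx]; exact hy1⟩
  · rintro ⟨⟨⟨y, hy⟩, hyx, hyx'⟩, h⟩
    exact ⟨⟨y, by rw [← hyx] at h; exact h, hy⟩, hyx, by rw [← hyx']; rfl⟩

lemma exists_mem_I_lt {c : ℝ} (hc : c ∈ τ.I) : ∃ c' ∈ τ.I, c' < c := by
  obtain ⟨c', h1, h2⟩ := exists_between hc.1
  exact ⟨c', ⟨h1, (EReal.coe_lt_coe_iff.2 h2).trans hc.2⟩, h2⟩

lemma exists_mem_I_gt {c : ℝ} (hc : c ∈ τ.I) : ∃ c' ∈ τ.I, c < c' := by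
  obtain ⟨c', h1, h2⟩ := EReal.lt_iff_exists_real_btwn.1 hc.2
  have h1' := EReal.coe_lt_coe_iff.1 h1
  exact ⟨c', ⟨hc.1.trans h1', h2⟩, h1'⟩

/-- On an open set where `y` vanishes, so do `p y'` and `τ y`. -/
lemma Eqn.eq_zero_on {y h : ℝ → ℂ} (hy : τ.Eqn y h) {O : Set ℝ} (hO : IsOpen O) (hOI : O ⊆ τ.I)
    (h0 : ∀ᵐ x ∂τ.μ, x ∈ O → y x = 0) :
    (∀ x ∈ O, y x = 0) ∧ (∀ x ∈ O, τ.quasiDeriv y x = 0) ∧ ∀ᵐ x ∂τ.μ, x ∈ O → h x = 0 := by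
  have h0 : EqOn y 0 O := by
    refine Measure.eqOn_open_of_ae_eq (μ := volume) ?_ hO
      (hy.differentiableOn.continuousOn.mono hOI) continuousOn_const
    rw [Filter.EventuallyEq, ae_restrict_iff' hO.measurableSet]
    filter_upwards [ae_of_ae_μ h0] with x hx hxO using hx (hOI hxO) hxO
  have h1 : EqOn (τ.quasiDeriv y) 0 O := by
    intro x hx
    have : deriv y x = 0 := by
      rw [(h0.eventuallyEq_of_mem (hO.mem_nhds hx)).deriv_eq]
      simp
    simp [quasiDeriv, this]
  refine ⟨h0, h1, ae_μ_of_ae ?_⟩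
  filter_upwards [(ae_restrict_iff' measurableSet_I).1 hy.eqn] with x hx hxI hxO
  have h2 : HasDerivAt (τ.quasiDeriv y) 0 x :=
    (hasDerivAt_const x (0 : ℂ)).congr_of_eventuallyEq (h1.eventuallyEq_of_mem (hO.mem_nhds hxO))
  have h3 := (hx hxI).unique h2
  rw [h0 hxO] at h3
  simpa [r_ne_zero hxI] using h3

/-- A representative of an element of the domain of the preminimal operator. -/
lemma exists_rep_of_mem_preminimalOp {f h : τ.L2} (hf : (f, h) ∈ τ.preminimalOp.graph) :
    ∃ y, f =ᵐ[τ.μ] y ∧ τ.Eqn y h ∧ ∃ s ∈ τ.I, ∃ d ∈ τ.I, s < d ∧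
      (∀ x ∈ τ.I, x ∉ Ioo s d → y x = 0) ∧ (∀ x ∈ τ.I, x ∉ Ioo s d → τ.quasiDeriv y x = 0) ∧
      ∀ᵐ x ∂τ.μ, x ∉ Ioo s d → h x = 0 := by
  obtain ⟨⟨y, hfy, hy⟩, c, hc, d, hd, hcd⟩ := mem_graph_preminimalOp.1 hf
  refine ⟨y, hfy, hy, ?_⟩
  have hO : IsOpen (τ.I ∩ (Icc c d)ᶜ) := τ.isOpen_I.inter isClosed_Icc.isOpen_compl
  obtain ⟨h0, h1, hh⟩ := hy.eq_zero_on hO inter_subset_left (by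
    filter_upwards [hfy, hcd] with x h1 h2 hx
    rw [← h1]
    exact h2 hx.2)
  -- The interval is widened strictly, so that `y` and `p y'` vanish also at the new endpoints
  -- themselves. The minimum and maximum cover the case of an empty `Icc c d`.
  obtain ⟨c', hc', hcc'⟩ := exists_mem_I_lt (show min c d ∈ τ.I by
    rcases min_choice c d with h | h <;> rw [h] <;> assumption)
  obtain ⟨d', hd', hdd'⟩ := exists_mem_I_gt (show max c d ∈ τ.I by
    rcases max_choice c d with h | h <;> rw [h] <;> assumption)
  have hsub : Icc c d ⊆ Ioo c' d' := fun x hx =>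
    ⟨(hcc'.trans_le (min_le_left _ _)).trans_le hx.1,
      hx.2.trans_lt ((le_max_right _ _).trans_lt hdd')⟩
  refine ⟨c', hc', d', hd', hcc'.trans ((min_le_left _ _).trans_lt
    ((le_max_left _ _).trans_lt hdd')), fun x hx hxn => h0 x ⟨hx, fun h => hxn (hsub h)⟩,
    fun x hx hxn => h1 x ⟨hx, fun h => hxn (hsub h)⟩, ?_⟩
  filter_upwards [hh, ae_μ_mem_I] with x hx hxI hxn using hx ⟨hxI, fun h => hxn (hsub h)⟩

/-- A solution on `[s, d]` with zero data at both endpoints gives an element of the graph of the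
preminimal operator. -/
lemma SolOn.mem_preminimalOp {y w h : ℝ → ℂ} (hy : τ.SolOn s d y w h) (hys : y s = 0)
    (hws : w s = 0) (hyd : y d = 0) (hwd : w d = 0) {f k : τ.L2}
    (hf : f =ᵐ[τ.μ] (Icc s d).indicator y) (hk : k =ᵐ[τ.μ] (Icc s d).indicator h) :
    (f, k) ∈ τ.preminimalOp.graph := by
  refine mem_graph_preminimalOp.2 ⟨⟨_, hf, (hy.eqn_indicator hys hws hyd hwd).congr_right
    (τ.ae_μ_iff.1 hk.symm)⟩, s, hy.left_mem, d, hy.right_mem, ?_⟩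
  filter_upwards [hf] with x hx hxn
  rw [hx, indicator_of_notMem hxn]

/-- The preminimal operator is symmetric. -/
lemma inner_preminimalOp {f h g k : τ.L2} (hf : (f, h) ∈ τ.preminimalOp.graph)
    (hg : (g, k) ∈ τ.preminimalOp.graph) : inner ℂ h g = inner ℂ f k := by
  obtain ⟨y, hfy, hy, s, hs, d, hd, hsd, hy0, hy0', hh⟩ := exists_rep_of_mem_preminimalOp hf
  obtain ⟨z, hgz, hz, -⟩ := exists_rep_of_mem_preminimalOp hg
  have hys := (hy.solOn hs hd hsd.le).conj
  have hzs := hz.solOn hs hd hsd.le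
  have e := hys.lagrange_eq hzs
  simp only [hy0 s hs (by simp), hy0 d hd (by simp), hy0' s hs (by simp), hy0' d hd (by simp),
    map_zero, zero_mul, sub_zero] at e
  rw [inner_L2, inner_L2, ← sub_eq_zero, ← integral_sub (integrable_conj_mul _ _)
    (integrable_conj_mul _ _), integral_μ_of_supp hs hd hsd.le, e]
  · refine intervalIntegral.integral_congr_ae ?_
    filter_upwards [ae_of_ae_μ hfy, ae_of_ae_μ hgz] with x h1 h2 hx
    rw [uIoc_of_le hsd.le] at hx
    have hxI := Icc_subset_I hs hd (Ioc_subset_Icc_self hx)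
    rw [h1 hxI, h2 hxI]
  · filter_upwards [hfy, hh, ae_μ_mem_I] with x h1 h2 hxI hx
    have hx' : x ∉ Ioo s d := fun h => hx (Ioo_subset_Icc_self h)
    rw [h1, h2 hx', hy0 x hxI hx']
    simp

end SturmLiouville

/-! ### Duality: density, closability and locality of the minimal operator. -/

namespace SturmLiouville

variable {τ : SturmLiouville}

variable (τ) in
/-- The elements of `L²_r(a, b)` with support in `[s, d]` for some `s ∈ (c, d)`. -/
def suppIoc (c d : ℝ) (hcd : c < d) : Submodule ℂ τ.L2 where
  carrier := {f | ∃ s ∈ Ioo c d, ∀ᵐ x ∂τ.μ, x ∉ Icc s d → f x = 0}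
  zero_mem' := by
    obtain ⟨s, hs⟩ := exists_between hcd
    refine ⟨s, hs, ?_⟩
    filter_upwards [Lp.coeFn_zero ℂ 2 τ.μ] with x hx _
    simpa using hx
  add_mem' := by
    rintro f g ⟨s, hs, h⟩ ⟨s', hs', h'⟩
    refine ⟨min s s', ⟨lt_min hs.1 hs'.1, (min_le_left _ _).trans_lt hs.2⟩, ?_⟩
    filter_upwards [h, h', Lp.coeFn_add f g] with x hx hx' hfg hn
    rw [hfg, Pi.add_apply, hx fun hm => hn ⟨(min_le_left _ _).trans hm.1, hm.2⟩,
      hx' fun hm => hn ⟨(min_le_right _ _).trans hm.1, hm.2⟩, add_zero]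
  smul_mem' := by
    rintro t f ⟨s, hs, h⟩
    refine ⟨s, hs, ?_⟩
    filter_upwards [h, Lp.coeFn_smul t f] with x hx hs hn
    rw [hs, Pi.smul_apply, hx hn, smul_zero]

variable (τ) in
/-- Square integrability on all `[s, d]` with `s ∈ (c, d)`. -/
def LocSqIntegrable (c d : ℝ) (g : ℝ → ℂ) : Prop :=
  ∀ s ∈ Ioo c d, MemLp g 2 (τ.μ.restrict (Icc s d))

variable {c d : ℝ} {g g₁ g₂ : ℝ → ℂ}

lemma LocSqIntegrable.integrable_mul (hg : τ.LocSqIntegrable c d g) {hcd : c < d} {f : τ.L2}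
    (hf : f ∈ τ.suppIoc c d hcd) : Integrable (fun x => f x * g x) τ.μ := by
  obtain ⟨s, hs, h⟩ := hf
  have h1 : IntegrableOn (fun x => f x * g x) (Icc s d) τ.μ :=
    (memLp_L2 f _).integrable_mul (hg s hs)
  refine h1.integrable_of_ae_notMem_eq_zero ?_
  filter_upwards [h] with x hx hn
  rw [hx hn, zero_mul]

/-- The functional `f ↦ ∫ f g r`. -/
noncomputable def pairing (hg : τ.LocSqIntegrable c d g) (hcd : c < d) :
    τ.suppIoc c d hcd →ₗ[ℂ] ℂ where
  toFun f := ∫ x, (f : τ.L2) x * g x ∂τ.μ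
  map_add' f f' := by
    rw [← integral_add (hg.integrable_mul f.2) (hg.integrable_mul f'.2)]
    refine integral_congr_ae ?_
    filter_upwards [Lp.coeFn_add (f : τ.L2) (f' : τ.L2)] with x hx
    simp only [Submodule.coe_add, hx, Pi.add_apply, add_mul]
  map_smul' t f := by
    rw [RingHom.id_apply, smul_eq_mul, ← integral_const_mul]
    refine integral_congr_ae ?_
    filter_upwards [Lp.coeFn_smul t (f : τ.L2)] with x hx
    simp only [SetLike.val_smul, hx, Pi.smul_apply, smul_eq_mul, mul_assoc]

/-- Testing with the conjugate of `g`, cut off to `[s, d]`, gives `∫ |g|² r = 0` there. Letting `s`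
run through a sequence decreasing to `c` exhausts `(c, d]`. -/
lemma LocSqIntegrable.ae_eq_zero (hcd : c < d) (hg : τ.LocSqIntegrable c d g)
    (h : ∀ f ∈ τ.suppIoc c d hcd, ∫ x, f x * g x ∂τ.μ = 0) :
    ∀ᵐ x ∂τ.μ, x ∈ Ioc c d → g x = 0 := by
  have key : ∀ s ∈ Ioo c d, ∀ᵐ x ∂τ.μ, x ∈ Icc s d → g x = 0 := by
    intro s hs
    set f : τ.L2 := cut (Icc s d) measurableSet_Icc _ (hg s hs).star with hf
    have hf' : f =ᵐ[τ.μ] (Icc s d).indicator (star g) := coeFn_cut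
    have hfm : f ∈ τ.suppIoc c d hcd := by
      refine ⟨s, hs, ?_⟩
      filter_upwards [hf'] with x hx hn
      rw [hx, indicator_of_notMem hn]
    have h1 := h f hfm
    have h2 : ∫ x in Icc s d, ‖g x‖ ^ 2 ∂τ.μ = 0 := by
      rw [← Complex.ofReal_inj, ← integral_complex_ofReal, Complex.ofReal_zero, ← h1,
        ← integral_indicator measurableSet_Icc]
      refine integral_congr_ae ?_
      filter_upwards [hf'] with x hx
      rw [hx]
      by_cases hxI : x ∈ Icc s d
      · simp only [indicator_of_mem hxI, Pi.star_apply, RCLike.star_def, Complex.conj_mul']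
        push_cast
        rfl
      · simp [indicator_of_notMem hxI]
    rw [integral_eq_zero_iff_of_nonneg (fun x => by positivity)
      ((memLp_two_iff_integrable_sq_norm (hg s hs).1).1 (hg s hs)), Filter.EventuallyEq,
      ae_restrict_iff' measurableSet_Icc] at h2
    filter_upwards [h2] with x hx hxI
    simpa using hx hxI
  obtain ⟨u, -, hu, hlim⟩ := exists_seq_strictAnti_tendsto' hcd
  filter_upwards [ae_all_iff.2 fun n => key (u n) (hu n)] with x hx hxI
  obtain ⟨n, hn⟩ := (hlim.eventually (gt_mem_nhds hxI.1)).exists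
  exact hx n ⟨hn.le, hxI.2⟩

/-- A function that annihilates all `f` annihilated by `g₁` and `g₂` is a linear combination of
`g₁` and `g₂`. -/
lemma LocSqIntegrable.exists_ae_eq (hcd : c < d) (hg : τ.LocSqIntegrable c d g)
    (hg₁ : τ.LocSqIntegrable c d g₁) (hg₂ : τ.LocSqIntegrable c d g₂)
    (h : ∀ f ∈ τ.suppIoc c d hcd, ∫ x, f x * g₁ x ∂τ.μ = 0 → ∫ x, f x * g₂ x ∂τ.μ = 0 →
      ∫ x, f x * g x ∂τ.μ = 0) :
    ∃ α β : ℂ, ∀ᵐ x ∂τ.μ, x ∈ Ioc c d → g x = α * g₁ x + β * g₂ x := by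
  -- A functional that vanishes on the common kernel of two others lies in their span.
  have h1 : pairing hg hcd ∈ Submodule.span ℂ (range ![pairing hg₁ hcd, pairing hg₂ hcd]) := by
    refine mem_span_of_iInf_ker_le_ker fun f hf => ?_
    simp only [Submodule.mem_iInf, Fin.forall_fin_two, LinearMap.mem_ker] at hf
    exact h f f.2 hf.1 hf.2
  rw [Matrix.range_cons, Matrix.range_cons, Matrix.range_empty, union_empty, singleton_union,
    Submodule.mem_span_pair] at h1
  obtain ⟨α, β, hαβ⟩ := h1
  refine ⟨α, β, ?_⟩
  have hG : τ.LocSqIntegrable c d (fun x => g x - (α * g₁ x + β * g₂ x)) := fun s hs =>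
    (hg s hs).sub (((hg₁ s hs).const_mul α).add ((hg₂ s hs).const_mul β))
  suffices h0 : ∀ f ∈ τ.suppIoc c d hcd, ∫ x, f x * (g x - (α * g₁ x + β * g₂ x)) ∂τ.μ = 0 by
    filter_upwards [hG.ae_eq_zero hcd h0] with x hx hxI using sub_eq_zero.1 (hx hxI)
  intro f hf
  have h2 := LinearMap.congr_fun hαβ ⟨f, hf⟩
  change α * (∫ x, f x * g₁ x ∂τ.μ) + β * (∫ x, f x * g₂ x ∂τ.μ) = ∫ x, f x * g x ∂τ.μ at h2
  have h3 : ∀ x, f x * (g x - (α * g₁ x + β * g₂ x)) =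
      f x * g x - (α * (f x * g₁ x) + β * (f x * g₂ x)) := fun x => by ring
  simp only [h3]
  have i : Integrable (fun x => α * (f x * g₁ x) + β * (f x * g₂ x)) τ.μ :=
    ((hg₁.integrable_mul hf).const_mul α).add ((hg₂.integrable_mul hf).const_mul β)
  rw [integral_sub (hg.integrable_mul hf) i, integral_add ((hg₁.integrable_mul hf).const_mul α)
    ((hg₂.integrable_mul hf).const_mul β), integral_const_mul, integral_const_mul, h2, sub_self]

lemma locSqIntegrable_of_continuousOn (hc : τ.a ≤ c) (hd : d ∈ τ.I)
    (hg : ContinuousOn g (Ioc c d)) : τ.LocSqIntegrable c d g := fun _ hs =>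
  memLp_of_continuousOn ⟨hc.trans_lt hs.1, (EReal.coe_lt_coe_iff.2 hs.2).trans hd.2⟩ hd
    (hg.mono fun _ hx => ⟨hs.1.trans_le hx.1, hx.2⟩)

lemma eq_zero_of_ae_Ioc {s : ℝ} (hsd : s < d)
    (hg : ContinuousOn g (Icc s d)) (h : ∀ᵐ x, x ∈ Ioo s d → g x = 0) : ∀ x ∈ Icc s d, g x = 0 := by
  have h1 : EqOn g 0 (Ioo s d) := Measure.eqOn_open_of_ae_eq (μ := volume)
    ((ae_restrict_iff' measurableSet_Ioo).2 h) isOpen_Ioo (hg.mono Ioo_subset_Icc_self)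
    continuousOn_const
  have h2 : EqOn g 0 (Icc s d) := h1.of_subset_closure hg continuousOn_const Ioo_subset_Icc_self
    (by rw [closure_Ioo hsd.ne])
  exact h2

/-- Elements that are orthogonal to all elements of the domain of the preminimal operator with
support in `(c, d]` vanish on `(c, d]`. -/
lemma ae_eq_zero_of_inner_preminimalOp (hcd : c < d) (hc : τ.a ≤ c) (hd : d ∈ τ.I) (h : τ.L2)
    (hh : ∀ f k, (f, k) ∈ τ.preminimalOp.graph → f ∈ τ.suppIoc c d hcd → inner ℂ h f = 0) :
    ∀ᵐ x ∂τ.μ, x ∈ Ioc c d → h x = 0 := by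
  have key : ∀ s ∈ Ioo c d, ∀ᵐ x, x ∈ Ioo s d → h x = 0 := by
    intro s hs
    have hsI : s ∈ τ.I := ⟨hc.trans_lt hs.1, (EReal.coe_lt_coe_iff.2 hs.2).trans hd.2⟩
    have hsd := hs.2
    have hi : IntervalIntegrable (fun x => τ.r x * starRingEnd ℂ (h x)) volume s d :=
      intervalIntegrable_r_mul_of_memLp hsI hd hsd.le (memLp_L2 h _).star
    -- `H` solves `τ H = h̄`, and `θ₁`, `θ₂` form a fundamental system of `τ θ = 0`. The plan is to
    -- show that `H` is a combination of `θ₁` and `θ₂`, whence `h̄ = τ H = 0`. For this, `H` is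
    -- tested with every `f` that annihilates both `θ₁` and `θ₂`.
    obtain ⟨H, HW, hH, -, -⟩ := exists_solOn hsI hd hsd.le hi 0 0 0
    have h0 : IntervalIntegrable (fun x => (τ.r x : ℂ) * (fun _ => (0 : ℂ)) x) volume s d := by
      simp
    obtain ⟨θ₁, ν₁, hθ₁, e₁, e₁'⟩ := exists_solOn hsI hd hsd.le h0 1 0 0
    obtain ⟨θ₂, ν₂, hθ₂, e₂, e₂'⟩ := exists_solOn hsI hd hsd.le h0 0 1 0
    simp only [zero_mul, zero_add] at hH hθ₁ hθ₂
    have hloc : ∀ {y w k : ℝ → ℂ}, τ.SolOn s d y w k → τ.LocSqIntegrable s d y := fun hy =>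
      locSqIntegrable_of_continuousOn hsI.1.le hd (hy.prim.continuousOn.mono Ioc_subset_Icc_self)
    obtain ⟨α, β, hαβ⟩ := (hloc hH).exists_ae_eq hsd (hloc hθ₁) (hloc hθ₂) fun f hf hf₁ hf₂ => by
      obtain ⟨t, ht, hft⟩ := hf
      have hfs : ∀ᵐ x ∂τ.μ, x ∉ Icc s d → f x = 0 := by
        filter_upwards [hft] with x hx hn using hx fun hm => hn ⟨ht.1.le.trans hm.1, hm.2⟩
      have hfi : IntervalIntegrable (fun x => τ.r x * f x) volume s d :=
        intervalIntegrable_r_mul_of_memLp hsI hd hsd.le (memLp_L2 f _)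
      obtain ⟨y, w, hy, hys, hws⟩ := exists_solOn hsI hd hsd.le hfi 0 0 0
      simp only [zero_mul, zero_add] at hy
      have hL : ∀ {θ ν k : ℝ → ℂ}, τ.SolOn s d θ ν k →
          y d * ν d - w d * θ d = ∫ x in s..d, τ.r x * (f x * θ x - y x * k x) := fun hθ => by
        rw [← hy.lagrange_eq hθ, hys, hws]
        ring
      have hL0 : ∀ {θ ν : ℝ → ℂ}, τ.SolOn s d θ ν (fun _ => 0) → ∫ x, f x * θ x ∂τ.μ = 0 →
          y d * ν d - w d * θ d = 0 := fun hθ hz => by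
        rw [hL hθ]
        refine Eq.trans ?_ hz
        rw [integral_μ_of_supp hsI hd hsd.le]
        · simp only [mul_zero, sub_zero]
        · filter_upwards [hfs] with x hx hn
          rw [hx hn, zero_mul]
      have d₁ := hL0 hθ₁ hf₁
      have d₂ := hL0 hθ₂ hf₂
      have hW : θ₁ d * ν₂ d - ν₁ d * θ₂ d = 1 := by
        have := SolOn.wronskian_eq (lam := 0) (by simpa using hθ₁) (by simpa using hθ₂)
          (right_mem_Icc.2 hsd.le)
        rw [this, e₁, e₁', e₂, e₂']
        ring
      -- The two relations at `d` are a linear system for the data of `y` whose determinant is the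
      -- Wronskian, equal to one.
      have hyd : y d = 0 := by
        linear_combination (-y d) * hW + θ₁ d * d₂ - θ₂ d * d₁
      have hwd : w d = 0 := by
        linear_combination (-w d) * hW + ν₁ d * d₂ - ν₂ d * d₁
      set F : τ.L2 := cut (Icc s d) measurableSet_Icc y
        (memLp_of_continuousOn hsI hd hy.prim.continuousOn) with hF
      have hFy : F =ᵐ[τ.μ] (Icc s d).indicator y := coeFn_cut
      have hmem : (F, f) ∈ τ.preminimalOp.graph := by
        refine hy.mem_preminimalOp hys hws hyd hwd hFy ?_
        filter_upwards [hfs] with x hx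
        by_cases hxI : x ∈ Icc s d
        · rw [indicator_of_mem hxI]
        · rw [indicator_of_notMem hxI, hx hxI]
      have h1 := hh F f hmem ⟨s, hs, by
        filter_upwards [hFy] with x hx hn
        rw [hx, indicator_of_notMem hn]⟩
      have h2 := hL hH
      rw [hyd, hwd, zero_mul, zero_mul, sub_zero, ← setIntegral_Icc_μ' hsI hd hsd.le] at h2
      have h3 : ∫ x in Icc s d, y x * starRingEnd ℂ (h x) ∂τ.μ = 0 := by
        rw [← h1, inner_L2, ← integral_indicator measurableSet_Icc]
        refine integral_congr_ae ?_
        filter_upwards [hFy] with x hx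
        rw [hx]
        by_cases hxI : x ∈ Icc s d
        · simp only [indicator_of_mem hxI, mul_comm]
        · simp [indicator_of_notMem hxI]
      have i1 : IntegrableOn (fun x => f x * H x) (Icc s d) τ.μ :=
        (memLp_L2 f _).integrable_mul (memLp_of_continuousOn hsI hd hH.prim.continuousOn)
      have i2 : IntegrableOn (fun x => y x * starRingEnd ℂ (h x)) (Icc s d) τ.μ :=
        (memLp_of_continuousOn hsI hd hy.prim.continuousOn).integrable_mul (memLp_L2 h _).star
      rw [integral_sub i1 i2, h3, sub_zero] at h2
      rw [← setIntegral_eq_integral_of_ae_compl_eq_zero (s := Icc s d), ← h2]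
      filter_upwards [hfs] with x hx hn
      rw [hx hn, zero_mul]
    have hsol := (hH.sub (hθ₁.const_mul α)).sub (hθ₂.const_mul β)
    have hz : ∀ x ∈ Icc s d, H x - α * θ₁ x - β * θ₂ x = 0 := by
      refine eq_zero_of_ae_Ioc hsd hsol.prim.continuousOn ?_
      filter_upwards [ae_of_ae_μ hαβ] with x hx hxI
      rw [hx (Icc_subset_I hsI hd (Ioo_subset_Icc_self hxI)) (Ioo_subset_Ioc_self hxI)]
      ring
    have hz' := eq_zero_of_ae_Ioc hsd hsol.quasi.continuousOn (by
      filter_upwards [hsol.prim.ae_eq_zero hz] with x hx hxI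
      have hp := p_ne_zero (Icc_subset_I hsI hd (Ioo_subset_Icc_self hxI))
      exact (div_eq_zero_iff.1 (hx hxI)).resolve_right hp)
    filter_upwards [hsol.quasi.ae_eq_zero hz'] with x hx hxI
    have h1 := hx hxI
    rw [hz x (Ioo_subset_Icc_self hxI)] at h1
    have hr := r_ne_zero (Icc_subset_I hsI hd (Ioo_subset_Icc_self hxI))
    simpa [hr] using h1
  obtain ⟨u, -, hu, hlim⟩ := exists_seq_strictAnti_tendsto' hcd
  have hne : ∀ᵐ x : ℝ, x ≠ d := by simp [ae_iff, measure_singleton]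
  refine ae_μ_of_ae ?_
  filter_upwards [ae_all_iff.2 fun n => key (u n) (hu n), hne] with x hx hxd _ hxI
  obtain ⟨n, hn⟩ := (hlim.eventually (gt_mem_nhds hxI.1)).exists
  exact hx n ⟨hn, lt_of_le_of_ne hxI.2 hxd⟩

lemma exists_seq_right_endpoint : ∃ u : ℕ → ℝ, (∀ n, u n ∈ τ.I) ∧ ∀ x ∈ τ.I, ∃ n, x < u n := by
  obtain ⟨v, -, hv, hlim⟩ := exists_seq_strictMono_tendsto' τ.a_lt_b
  have h1 : ∀ n, ∃ t : ℝ, v n < t ∧ (t : EReal) < τ.b := fun n =>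
    EReal.lt_iff_exists_real_btwn.1 (hv n).2
  choose u hu using h1
  refine ⟨u, fun n => ⟨EReal.coe_lt_coe_iff.1 ((hv n).1.trans (hu n).1), (hu n).2⟩,
    fun x hx => ?_⟩
  obtain ⟨n, hn⟩ := (hlim.eventually (lt_mem_nhds hx.2)).exists
  exact ⟨n, EReal.coe_lt_coe_iff.1 (hn.trans (hu n).1)⟩

lemma ae_eq_zero_of_inner_preminimalOp_Ioi {h : τ.L2} (hc : τ.a ≤ c)
    (hh : ∀ f k, (f, k) ∈ τ.preminimalOp.graph → (∀ᵐ x ∂τ.μ, x ∉ Ioi c → f x = 0) →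
      inner ℂ h f = 0) :
    ∀ᵐ x ∂τ.μ, c < x → h x = 0 := by
  obtain ⟨u, hu, hu'⟩ := exists_seq_right_endpoint (τ := τ)
  have key : ∀ n, ∀ᵐ x ∂τ.μ, x ∈ Ioc c (u n) → h x = 0 := fun n => by
    by_cases hcu : c < u n
    · refine ae_eq_zero_of_inner_preminimalOp hcu hc (hu n) h fun f k hf ⟨_, hs, hfs⟩ => hh f k hf ?_
      filter_upwards [hfs] with x hx hn using hx fun hm => hn (hs.1.trans_le hm.1)
    · exact Filter.Eventually.of_forall fun x hx => (hcu (hx.1.trans_le hx.2)).elim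
  filter_upwards [ae_all_iff.2 key, ae_μ_mem_I] with x hx hxI hcx
  obtain ⟨n, hn⟩ := hu' x hxI
  exact hx n ⟨hcx, hn.le⟩

lemma eq_zero_of_inner_preminimalOp {h : τ.L2}
    (hh : ∀ f k, (f, k) ∈ τ.preminimalOp.graph → inner ℂ h f = 0) : h = 0 := by
  refine Lp.eq_zero_iff_ae_eq_zero.2 ?_
  filter_upwards [ae_eq_zero_of_inner_preminimalOp_Ioi (h := h) le_rfl fun f k hf _ => hh f k hf,
    ae_μ_mem_I] with x hx hxI using hx hxI.1

lemma dense_preminimalOp : Dense (τ.preminimalOp.domain : Set τ.L2) := by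
  rw [Submodule.dense_iff_topologicalClosure_eq_top, Submodule.topologicalClosure_eq_top_iff,
    Submodule.eq_bot_iff]
  intro h hh
  refine eq_zero_of_inner_preminimalOp fun f k hf => ?_
  exact (Submodule.mem_orthogonal' _ _).1 hh f (LinearPMap.mem_domain_of_mem_graph hf)

lemma inner_of_mem_closure {x : τ.L2 × τ.L2} (hx : x ∈ τ.preminimalOp.graph.topologicalClosure)
    {g k : τ.L2} (hg : ∀ y ∈ τ.preminimalOp.graph, inner ℂ y.2 g = inner ℂ y.1 k) :
    inner ℂ x.2 g = inner ℂ x.1 k := by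
  have hcl : IsClosed {x : τ.L2 × τ.L2 | inner ℂ x.2 g = inner ℂ x.1 k} :=
    isClosed_eq (by fun_prop) (by fun_prop)
  exact closure_minimal (fun y hy => hg y hy) hcl hx

-- If `(0, h)` lies in the closure of the graph, symmetry passes to the limit and makes `h`
-- orthogonal to the domain, which is dense.
variable (τ) in
lemma isClosable_preminimalOp : τ.preminimalOp.IsClosable := by
  refine ⟨τ.preminimalOp.graph.topologicalClosure.toLinearPMap,
    (Submodule.toLinearPMap_graph_eq _ fun x hx hx0 => ?_).symm⟩
  refine eq_zero_of_inner_preminimalOp fun f k hf => ?_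
  rw [inner_of_mem_closure hx fun y hy => inner_preminimalOp hy hf, hx0, inner_zero_left]

lemma graph_minimalOp : τ.minimalOp.graph = τ.preminimalOp.graph.topologicalClosure :=
  (isClosable_preminimalOp τ).graph_closure_eq_closure_graph.symm

lemma inner_minimalOp {f h g k : τ.L2} (hf : (f, h) ∈ τ.minimalOp.graph)
    (hg : (g, k) ∈ τ.minimalOp.graph) : inner ℂ h g = inner ℂ f k := by
  rw [graph_minimalOp] at hf hg
  refine inner_of_mem_closure hf fun x hx => ?_
  have h1 := inner_of_mem_closure hg fun y hy =>
    inner_preminimalOp (f := y.1) (h := y.2) (g := x.1) (k := x.2) hy hx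
  rw [← inner_conj_symm, ← h1, inner_conj_symm]

lemma graph_preminimalOp_le : τ.preminimalOp.graph ≤ τ.minimalOp.graph := by
  rw [graph_minimalOp]
  exact Submodule.le_topologicalClosure _

/-- The minimal operator is local: it maps elements with compact support in `[a, b)` to such
elements. -/
lemma snd_mem_manifoldL {g h : τ.L2} (hg : (g, h) ∈ τ.minimalOp.graph) (hgL : g ∈ τ.manifoldL) :
    h ∈ τ.manifoldL := by
  obtain ⟨c, hc, hgc⟩ := hgL
  refine ⟨c, hc, ae_eq_zero_of_inner_preminimalOp_Ioi hc.1.le fun f k hf hfc => ?_⟩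
  -- By symmetry the pairing of `h` with `f` equals that of `g` with `k`. Since `f` vanishes to the
  -- left of `c`, so does `k`, while `g` vanishes to the right.
  rw [inner_minimalOp hg (graph_preminimalOp_le hf), inner_L2]
  refine integral_eq_zero_of_ae ?_
  have hk : ∀ᵐ x ∂τ.μ, x ∉ Ici c → k x = 0 := by
    obtain ⟨y, hfy, hy, -⟩ := exists_rep_of_mem_preminimalOp hf
    obtain ⟨-, -, hk⟩ := hy.eq_zero_on (τ.isOpen_I.inter (isOpen_Iio (a := c))) inter_subset_left (by
      filter_upwards [hfy, hfc] with x h1 h2 hx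
      rw [← h1]
      exact h2 (notMem_Ioi.2 hx.2.le))
    filter_upwards [hk, ae_μ_mem_I] with x hx hxI hxn using hx ⟨hxI, notMem_Ici.1 hxn⟩
  have hne : ∀ᵐ x ∂τ.μ, x ≠ c := ae_μ_of_ae (by
    have : ∀ᵐ x : ℝ, x ≠ c := by simp [ae_iff, measure_singleton]
    filter_upwards [this] with x hx _ using hx)
  filter_upwards [hgc, hk, hne] with x h1 h2 h3
  rcases lt_or_ge c x with hx | hx
  · simp [h1 hx]
  · simp [h2 (not_le.2 (lt_of_le_of_ne hx h3))]

lemma mem_graph_A₀ {x : τ.manifoldL × τ.manifoldL} :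
    x ∈ τ.A₀.graph ↔ ((x.1 : τ.L2), (x.2 : τ.L2)) ∈ τ.minimalOp.graph := by
  rw [graph_A₀]
  rfl

lemma mem_domain_A₀ (g : τ.manifoldL) :
    g ∈ τ.A₀.domain ↔ (g : τ.L2) ∈ τ.minimalOp.domain := by
  simp only [LinearPMap.mem_domain_iff]
  constructor
  · rintro ⟨h, hh⟩
    exact ⟨h, mem_graph_A₀.1 hh⟩
  · rintro ⟨h, hh⟩
    exact ⟨⟨h, snd_mem_manifoldL hh g.2⟩, mem_graph_A₀.2 hh⟩

variable (τ) in
lemma symmetricOp_A₀ : SymmetricOp τ.A₀ := by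
  intro f g
  exact inner_minimalOp (mem_graph_A₀.1 (τ.A₀.mem_graph f)) (mem_graph_A₀.1 (τ.A₀.mem_graph g))

lemma compactSupp_le_manifoldL : τ.compactSupp ≤ τ.manifoldL := by
  rintro f ⟨c, hc, d, hd, h⟩
  refine ⟨d, hd, ?_⟩
  filter_upwards [h] with x hx hdx using hx fun hm => hm.2.not_gt hdx

variable (τ) in
lemma dense_domain_A₀ : Dense (τ.A₀.domain : Set τ.manifoldL) := by
  rw [Subtype.dense_iff]
  intro f _
  refine closure_mono ?_ (dense_preminimalOp f)
  intro g hg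
  obtain ⟨k, hk⟩ := LinearPMap.mem_domain_iff.1 hg
  have hgL : g ∈ τ.manifoldL := compactSupp_le_manifoldL (mem_graph_preminimalOp.1 hk).2
  exact ⟨⟨g, hgL⟩, (mem_domain_A₀ _).2 (LinearPMap.mem_domain_of_mem_graph
    (graph_preminimalOp_le hk)), rfl⟩

end SturmLiouville

/-! ### Weyl's limit point argument at the endpoint `a`. -/

open Filter Topology

/-- The Cauchy-Schwarz inequality for square integrable functions. -/
lemma integral_norm_mul_norm_le_sqrt {X : Type*} [MeasurableSpace X] {ν : Measure X} {f g : X → ℂ}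
    (hf : MemLp f 2 ν) (hg : MemLp g 2 ν) :
    ∫ x, ‖f x‖ * ‖g x‖ ∂ν ≤ √(∫ x, ‖f x‖ ^ 2 ∂ν) * √(∫ x, ‖g x‖ ^ 2 ∂ν) := by
  have h := integral_mul_norm_le_Lp_mul_Lq (p := 2) (q := 2) Real.HolderConjugate.two_two
    (f := f) (g := g) (by simpa using hf) (by simpa using hg)
  simpa [Real.sqrt_eq_rpow] using h

lemma norm_integral_mul_le_sqrt {X : Type*} [MeasurableSpace X] {ν : Measure X} {f g : X → ℂ}
    (hf : MemLp f 2 ν) (hg : MemLp g 2 ν) :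
    ‖∫ x, f x * g x ∂ν‖ ≤ √(∫ x, ‖f x‖ ^ 2 ∂ν) * √(∫ x, ‖g x‖ ^ 2 ∂ν) := by
  refine (norm_integral_le_integral_norm _).trans ?_
  simp only [norm_mul]
  exact integral_norm_mul_norm_le_sqrt hf hg

lemma MeasureTheory.MemLp.integrable_norm_sq {X : Type*} [MeasurableSpace X] {ν : Measure X}
    {f : X → ℂ} (hf : MemLp f 2 ν) : Integrable (fun x => ‖f x‖ ^ 2) ν :=
  (memLp_two_iff_integrable_sq_norm hf.1).1 hf

lemma exists_lipschitz_of_differentiable {f : ℂ → ℂ} (hf : Differentiable ℂ f) (z₀ : ℂ) (R : ℝ) :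
    ∃ K, 0 ≤ K ∧ (∀ z ∈ Metric.closedBall z₀ R, ‖f z‖ ≤ K) ∧
      ∀ z ∈ Metric.closedBall z₀ R, ∀ z' ∈ Metric.closedBall z₀ R, ‖f z - f z'‖ ≤ K * ‖z - z'‖ := by
  have hc : Continuous (deriv f) := (hf.contDiff (n := 1)).continuous_deriv le_rfl
  obtain ⟨K₁, h₁⟩ := (isCompact_closedBall z₀ R).exists_bound_of_continuousOn hc.continuousOn
  obtain ⟨K₂, h₂⟩ := (isCompact_closedBall z₀ R).exists_bound_of_continuousOn
    hf.continuous.continuousOn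
  refine ⟨max 0 (max K₁ K₂), le_max_left _ _, fun z hz => (h₂ z hz).trans
    ((le_max_right _ _).trans (le_max_right _ _)), fun z hz z' hz' => ?_⟩
  refine (convex_closedBall z₀ R).norm_image_sub_le_of_norm_deriv_le (fun x _ => hf x)
    (fun x hx => (h₁ x hx).trans ((le_max_left _ _).trans (le_max_right _ _))) hz' hz

namespace SturmLiouville

variable {τ : SturmLiouville} {s c : ℝ} {u : ℝ → ℂ}

lemma Ioc_subset_I (hc : c ∈ τ.I) : Ioc τ.a c ⊆ τ.I := fun _ hx =>
  ⟨hx.1, (EReal.coe_le_coe_iff.2 hx.2).trans_lt hc.2⟩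

lemma Ioo_union_Icc (hs : τ.a < s) (hsc : s ≤ c) : Ioo τ.a s ∪ Icc s c = Ioc τ.a c := by
  ext x
  simp only [mem_union, mem_Ioo, mem_Icc, mem_Ioc]
  grind

lemma disjoint_Ioo_Icc : Disjoint (Ioo τ.a s) (Icc s c) :=
  Set.disjoint_left.2 fun _ hx hx' => hx.2.not_ge hx'.1

lemma setIntegral_Ioc_eq {E : Type*} [NormedAddCommGroup E] [NormedSpace ℝ E] {F : ℝ → E}
    (hF : IntegrableOn F (Ioc τ.a c) τ.μ) (hs : τ.a < s) (hsc : s ≤ c) :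
    ∫ x in Ioc τ.a c, F x ∂τ.μ = ∫ x in Ioo τ.a s, F x ∂τ.μ + ∫ x in Icc s c, F x ∂τ.μ := by
  rw [← Ioo_union_Icc hs hsc] at hF ⊢
  exact setIntegral_union disjoint_Ioo_Icc measurableSet_Icc (hF.mono_set subset_union_left)
    (hF.mono_set subset_union_right)

lemma exists_seq_left_endpoint (hc : c ∈ τ.I) : ∃ v : ℕ → ℝ, StrictAnti v ∧
    (∀ n, v n ∈ Ioo τ.a c) ∧ Tendsto v atTop (𝓝 τ.a) :=
  exists_seq_strictAnti_tendsto' hc.1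

lemma tendsto_setIntegral_Ioo_left {E : Type*} [NormedAddCommGroup E] [NormedSpace ℝ E] {F : ℝ → E}
    (hF : IntegrableOn F (Ioc τ.a c) τ.μ) {v : ℕ → ℝ} (hv : StrictAnti v)
    (hv' : ∀ n, v n ∈ Ioo τ.a c) (hlim : Tendsto v atTop (𝓝 τ.a)) :
    Tendsto (fun n => ∫ x in Ioo τ.a (v n), F x ∂τ.μ) atTop (𝓝 0) := by
  have h := tendsto_setIntegral_of_antitone (μ := τ.μ) (f := F) (s := fun n => Ioo τ.a (v n))
    (fun _ => measurableSet_Ioo) (fun m n hmn => Ioo_subset_Ioo_right (hv.antitone hmn))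
    ⟨0, hF.mono_set (Ioo_subset_Ioc_self.trans (Ioc_subset_Ioc_right (hv' 0).2.le))⟩
  have h0 : ⋂ n, Ioo τ.a (v n) = ∅ := by
    refine eq_empty_of_forall_notMem fun x hx => ?_
    rw [mem_iInter] at hx
    obtain ⟨n, hn⟩ := (hlim.eventually (gt_mem_nhds (hx 0).1)).exists
    exact (hx n).2.not_gt hn
  simpa [h0] using h

lemma SqIntegrableAtLeft.memLp (hu : ContinuousOn u τ.I) (h : τ.SqIntegrableAtLeft u)
    (hc : c ∈ τ.I) : MemLp u 2 (τ.μ.restrict (Ioc τ.a c)) := by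
  have hm : AEStronglyMeasurable u (τ.μ.restrict (Ioc τ.a c)) :=
    (hu.mono (Ioc_subset_I hc)).aestronglyMeasurable measurableSet_Ioc
  rw [memLp_two_iff_integrable_sq_norm hm]
  change IntegrableOn (fun x => ‖u x‖ ^ 2) (Ioc τ.a c) τ.μ
  obtain ⟨c', hc', h⟩ := h
  have h1 : IntegrableOn (fun x => ‖u x‖ ^ 2) (Ioo τ.a c') τ.μ := by
    rw [integrableOn_μ_iff measurableSet_Ioo (Ioo_subset_Ioc_self.trans (Ioc_subset_I hc'))]
    simpa [mul_comm] using h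
  have h2 : IntegrableOn (fun x => ‖u x‖ ^ 2) (Icc c' c) τ.μ :=
    (memLp_of_continuousOn hc' hc (hu.mono (Icc_subset_I hc' hc))).integrable_norm_sq
  refine (h1.union h2).mono_set fun x hx => ?_
  rcases lt_or_ge x c' with h | h
  · exact Or.inl ⟨hx.1, h⟩
  · exact Or.inr ⟨h, hx.2⟩

/-- A uniform bound for the integrals of `|u|² r` over `[s, c]` gives square integrability. -/
lemma sqIntegrableAtLeft_of_bound (hu : ContinuousOn u τ.I) (hc : c ∈ τ.I) (B : ℝ)
    (h : ∀ s ∈ Ioo τ.a c, ∫ x in Icc s c, ‖u x‖ ^ 2 ∂τ.μ ≤ B) : τ.SqIntegrableAtLeft u := by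
  obtain ⟨v, -, hv, hlim⟩ := exists_seq_left_endpoint hc
  refine ⟨c, hc, ?_⟩
  have hvI : ∀ n, v n ∈ τ.I := fun n => Ioc_subset_I hc (Ioo_subset_Ioc_self (hv n))
  have hi : ∀ n, IntegrableOn (fun x => ‖u x‖ ^ 2 * τ.r x) (Icc (v n) c) := fun n => by
    have h1 := (memLp_of_continuousOn (hvI n) hc (hu.mono (Icc_subset_I (hvI n) hc))
      ).integrable_norm_sq
    simpa [mul_comm] using (integrableOn_μ_iff measurableSet_Icc (Icc_subset_I (hvI n) hc)).1 h1
  refine (integrableOn_Ioc_of_intervalIntegral_norm_bounded_left (I := B)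
    (fun n => (hi n).mono_set Ioc_subset_Icc_self) hlim (Eventually.of_forall fun n => ?_)
    ).mono_set Ioo_subset_Ioc_self
  rw [← integral_Icc_eq_integral_Ioc]
  refine le_trans (le_of_eq ?_) (h (v n) (hv n))
  rw [setIntegral_μ measurableSet_Icc (Icc_subset_I (hvI n) hc)]
  refine setIntegral_congr_fun measurableSet_Icc fun x hx => ?_
  have := (τ.r_pos x (Icc_subset_I (hvI n) hc hx)).le
  simp only [norm_mul, norm_pow, norm_norm, Real.norm_of_nonneg this, smul_eq_mul, mul_comm]

lemma SolOn.lagrange_conj {d : ℝ} {y w h : ℝ → ℂ} (hy : τ.SolOn s d y w h) :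
    (y d * starRingEnd ℂ (w d) - w d * starRingEnd ℂ (y d)) -
      (y s * starRingEnd ℂ (w s) - w s * starRingEnd ℂ (y s)) =
      ∫ x in Icc s d, (h x * starRingEnd ℂ (y x) - y x * starRingEnd ℂ (h x)) ∂τ.μ := by
  rw [hy.lagrange_eq hy.conj, setIntegral_Icc_μ' hy.left_mem hy.right_mem hy.le]

lemma Eqn.continuousOn {y h : ℝ → ℂ} (hy : τ.Eqn y h) : ContinuousOn y τ.I :=
  hy.differentiableOn.continuousOn

section Weyl

variable {y : ℝ → ℂ} {lam : ℂ}

/-- `W(y, ȳ)(x)`. -/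
noncomputable def selfWronskian (τ : SturmLiouville) (y : ℝ → ℂ) (x : ℝ) : ℂ :=
  y x * starRingEnd ℂ (τ.quasiDeriv y x) - τ.quasiDeriv y x * starRingEnd ℂ (y x)

lemma IsSolution.selfWronskian_sub (hy : τ.IsSolution lam y) (hs : s ∈ τ.I) (hc : c ∈ τ.I)
    (hsc : s ≤ c) : τ.selfWronskian y c - τ.selfWronskian y s =
      (lam - starRingEnd ℂ lam) * ((∫ x in Icc s c, ‖y x‖ ^ 2 ∂τ.μ : ℝ) : ℂ) := by
  have h := (Eqn.solOn hy hs hc hsc).lagrange_conj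
  rw [selfWronskian, selfWronskian, h, ← integral_complex_ofReal, ← integral_const_mul]
  refine integral_congr_ae (Eventually.of_forall fun x => ?_)
  simp only [map_mul]
  push_cast
  rw [← Complex.mul_conj']
  ring

/-- If the Wronskian `W(y, ȳ)` of a square integrable solution is bounded away from zero near `a`,
then all solutions are square integrable at `a`. -/
lemma IsSolution.sqIntegrableAtLeft_of_selfWronskian (hy : τ.IsSolution lam y)
    (hy2 : τ.SqIntegrableAtLeft y) (hu : τ.IsSolution lam u) {δ : ℝ} (hδ : 0 < δ) (hc : c ∈ τ.I)
    (hW : ∀ x ∈ Ioc τ.a c, δ ≤ ‖τ.selfWronskian y x‖)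
    (hsmall : ‖lam - starRingEnd ℂ lam‖ * ∫ x in Ioc τ.a c, ‖y x‖ ^ 2 ∂τ.μ ≤ δ / 2) :
    τ.SqIntegrableAtLeft u := by
  set κ := ‖lam - starRingEnd ℂ lam‖ with hκ
  have hyL := hy2.memLp (Eqn.continuousOn hy) hc
  set M := √(∫ x in Ioc τ.a c, ‖y x‖ ^ 2 ∂τ.μ) with hM
  have hM2 : M ^ 2 = ∫ x in Ioc τ.a c, ‖y x‖ ^ 2 ∂τ.μ :=
    Real.sq_sqrt (integral_nonneg fun _ => by positivity)
  set w := τ.quasiDeriv y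
  set v := τ.quasiDeriv u
  set ω := y c * v c - w c * u c with hω
  set B := ‖u c * starRingEnd ℂ (w c) - v c * starRingEnd ℂ (y c)‖ with hB
  have hmono : ∀ s ∈ Ioo τ.a c, √(∫ x in Icc s c, ‖y x‖ ^ 2 ∂τ.μ) ≤ M := fun s hs =>
    Real.sqrt_le_sqrt (setIntegral_mono_set hyL.integrable_norm_sq
      (Eventually.of_forall fun _ => by positivity)
      (LE.le.eventuallyLE fun x hx => ⟨hs.1.trans_le hx.1, hx.2⟩))
  have hM0 : 0 ≤ M := Real.sqrt_nonneg _
  refine sqIntegrableAtLeft_of_bound (Eqn.continuousOn hu) hc ((2 * (M * (‖ω‖ + B)) / δ) ^ 2)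
    fun s hs => ?_
  have hsI : s ∈ τ.I := Ioc_subset_I hc (Ioo_subset_Ioc_self hs)
  set N := √(∫ x in Icc s c, ‖u x‖ ^ 2 ∂τ.μ) with hN
  have hN0 : 0 ≤ N := Real.sqrt_nonneg _
  have hN2 : N ^ 2 = ∫ x in Icc s c, ‖u x‖ ^ 2 ∂τ.μ :=
    Real.sq_sqrt (integral_nonneg fun _ => by positivity)
  have hyc : MemLp y 2 (τ.μ.restrict (Icc s c)) :=
    memLp_of_continuousOn hsI hc ((Eqn.continuousOn hy).mono (Icc_subset_I hsI hc))
  have huc : MemLp u 2 (τ.μ.restrict (Icc s c)) :=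
    memLp_of_continuousOn hsI hc ((Eqn.continuousOn hu).mono (Icc_subset_I hsI hc))
  have key : ∀ t ∈ Icc s c, δ * ‖u t‖ ≤ (‖ω‖ + B + κ * (N * M)) * ‖y t‖ := by
    intro t ht
    have htI : t ∈ τ.I := Icc_subset_I hsI hc ht
    have hyt := Eqn.solOn hy htI hc ht.2
    have hut := Eqn.solOn hu htI hc ht.2
    have e1 := hyt.wronskian_eq hut (right_mem_Icc.2 ht.2)
    have e2 := hut.lagrange_eq hyt.conj
    rw [← setIntegral_Icc_μ' htI hc ht.2] at e2
    have e3 : ∫ x in Icc t c, (lam * u x * starRingEnd ℂ (y x) -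
        u x * starRingEnd ℂ (lam * y x)) ∂τ.μ =
        (lam - starRingEnd ℂ lam) * ∫ x in Icc t c, u x * starRingEnd ℂ (y x) ∂τ.μ := by
      rw [← integral_const_mul]
      refine integral_congr_ae (Eventually.of_forall fun x => ?_)
      simp only [map_mul]
      ring
    rw [e3] at e2
    have hsub : Icc t c ⊆ Icc s c := Icc_subset_Icc_left ht.1
    have e4 : ‖∫ x in Icc t c, u x * starRingEnd ℂ (y x) ∂τ.μ‖ ≤ N * M := by
      refine (norm_integral_mul_le_sqrt (huc.mono_measure (Measure.restrict_mono_set _ hsub))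
        (hyc.mono_measure (Measure.restrict_mono_set _ hsub)).star).trans ?_
      refine mul_le_mul (Real.sqrt_le_sqrt ?_) ?_ (Real.sqrt_nonneg _) hN0
      · exact setIntegral_mono_set huc.integrable_norm_sq
          (Eventually.of_forall fun _ => by positivity) (LE.le.eventuallyLE hsub)
      · refine le_trans (Real.sqrt_le_sqrt ?_) (hmono s hs)
        simp only [Pi.star_apply, norm_star]
        exact setIntegral_mono_set hyc.integrable_norm_sq
          (Eventually.of_forall fun _ => by positivity) (LE.le.eventuallyLE hsub)
    set J := ∫ x in Icc t c, u x * starRingEnd ℂ (y x) ∂τ.μ with hJ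
    -- This is the identity `W(y, ȳ) u = ȳ W(y, u) + y W(u, ȳ)`. Here `W(y, u)` is constant, and the
    -- Lagrange identity carries `W(u, ȳ)` from `c` to `t`.
    have e5 : τ.selfWronskian y t * u t = (starRingEnd ℂ (y t)) * ω +
        (u c * starRingEnd ℂ (w c) - v c * starRingEnd ℂ (y c) -
          (lam - starRingEnd ℂ lam) * J) * y t := by
      rw [← e2, hω, e1, selfWronskian]
      ring
    calc δ * ‖u t‖ ≤ ‖τ.selfWronskian y t‖ * ‖u t‖ :=
          mul_le_mul_of_nonneg_right (hW t ⟨hs.1.trans_le ht.1, ht.2⟩) (norm_nonneg _)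
      _ = ‖τ.selfWronskian y t * u t‖ := (norm_mul _ _).symm
      _ ≤ ‖y t‖ * ‖ω‖ + (B + κ * ‖J‖) * ‖y t‖ := by
          rw [e5]
          refine (norm_add_le _ _).trans (add_le_add ?_ ?_)
          · rw [norm_mul, RCLike.norm_conj]
          · rw [norm_mul]
            refine mul_le_mul_of_nonneg_right ((norm_sub_le _ _).trans ?_) (norm_nonneg _)
            rw [norm_mul]
      _ ≤ (‖ω‖ + B + κ * (N * M)) * ‖y t‖ := by
          have : κ * ‖J‖ * ‖y t‖ ≤ κ * (N * M) * ‖y t‖ := by gcongr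
          linarith
  have hC0 : 0 ≤ ‖ω‖ + B + κ * (N * M) := by positivity
  have h1 : (δ * N) ^ 2 ≤ ((‖ω‖ + B + κ * (N * M)) * M) ^ 2 := by
    rw [mul_pow, mul_pow, hN2, ← integral_const_mul]
    calc ∫ x in Icc s c, δ ^ 2 * ‖u x‖ ^ 2 ∂τ.μ
        ≤ ∫ x in Icc s c, (‖ω‖ + B + κ * (N * M)) ^ 2 * ‖y x‖ ^ 2 ∂τ.μ := by
          refine setIntegral_mono_on (huc.integrable_norm_sq.const_mul _)
            (hyc.integrable_norm_sq.const_mul _) measurableSet_Icc fun x hx => ?_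
          rw [← mul_pow, ← mul_pow]
          exact pow_le_pow_left₀ (by positivity) (key x hx) 2
      _ = (‖ω‖ + B + κ * (N * M)) ^ 2 * ∫ x in Icc s c, ‖y x‖ ^ 2 ∂τ.μ := integral_const_mul _ _
      _ ≤ _ := by
          gcongr
          rw [← Real.sq_sqrt (show 0 ≤ ∫ x in Icc s c, ‖y x‖ ^ 2 ∂τ.μ from
            integral_nonneg fun _ => by positivity)]
          exact pow_le_pow_left₀ (Real.sqrt_nonneg _) (hmono s hs) 2
  have h2 : δ * N ≤ (‖ω‖ + B + κ * (N * M)) * M :=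
    le_of_sq_le_sq h1 (by positivity)
  have h3 : κ * M ^ 2 * N ≤ δ / 2 * N := by
    rw [hM2]
    exact mul_le_mul_of_nonneg_right hsmall hN0
  -- The smallness assumption bounds the term `κ M² N` by `δ N / 2`, which is absorbed on the left.
  -- The resulting bound is independent of `s`.
  have h4 : N ≤ 2 * (M * (‖ω‖ + B)) / δ := by
    rw [le_div_iff₀ hδ]
    nlinarith
  rw [← hN2]
  exact pow_le_pow_left₀ hN0 h4 2

/-- In the limit point case `W(y, ȳ)` vanishes at `a` for square integrable solutions `y`. -/
lemma IsSolution.selfWronskian_eq (hτ : τ.IsLimitPointAtLeft) (hy : τ.IsSolution lam y)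
    (hy2 : τ.SqIntegrableAtLeft y) (hc : c ∈ τ.I) : τ.selfWronskian y c =
      (lam - starRingEnd ℂ lam) * ((∫ x in Ioc τ.a c, ‖y x‖ ^ 2 ∂τ.μ : ℝ) : ℂ) := by
  by_contra hne
  -- `L` is the limit of `W(y, ȳ)` at `a`. If it were nonzero, this Wronskian would stay away from
  -- zero near `a`, and all solutions would be square integrable there.
  set L := τ.selfWronskian y c -
    (lam - starRingEnd ℂ lam) * ((∫ x in Ioc τ.a c, ‖y x‖ ^ 2 ∂τ.μ : ℝ) : ℂ) with hL
  have hL0 : 0 < ‖L‖ := norm_pos_iff.2 (sub_ne_zero.2 hne)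
  have hyL := hy2.memLp (Eqn.continuousOn hy) hc
  have hint : IntegrableOn (fun x => ‖y x‖ ^ 2) (Ioc τ.a c) τ.μ := hyL.integrable_norm_sq
  have e : ∀ s ∈ Ioo τ.a c, τ.selfWronskian y s =
      L + (lam - starRingEnd ℂ lam) * ((∫ x in Ioo τ.a s, ‖y x‖ ^ 2 ∂τ.μ : ℝ) : ℂ) := by
    intro s hs
    have h1 := hy.selfWronskian_sub (Ioc_subset_I hc (Ioo_subset_Ioc_self hs)) hc hs.2.le
    have h2 := setIntegral_Ioc_eq hint hs.1 hs.2.le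
    rw [hL, h2]
    push_cast
    linear_combination -h1
  obtain ⟨v, hva, hv, hlim⟩ := exists_seq_left_endpoint hc
  have h0 := (tendsto_setIntegral_Ioo_left hint hva hv hlim).const_mul ‖lam - starRingEnd ℂ lam‖
  rw [mul_zero] at h0
  obtain ⟨n, hn⟩ := (h0.eventually (gt_mem_nhds (show 0 < ‖L‖ / 4 by positivity))).exists
  obtain ⟨s, hs⟩ := exists_between (hv n).1
  have hsc : s < c := hs.2.trans (hv n).2
  have hmono : ∀ S : Set ℝ, S ⊆ Ioo τ.a (v n) →
      ‖lam - starRingEnd ℂ lam‖ * ∫ x in S, ‖y x‖ ^ 2 ∂τ.μ ≤ ‖L‖ / 4 := by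
    intro S hS
    refine le_trans ?_ hn.le
    gcongr
    · exact Eventually.of_forall fun _ => by positivity
    · exact hint.mono_set (Ioo_subset_Ioc_self.trans (Ioc_subset_Ioc_right (hv n).2.le))
  refine hτ ⟨lam, fun u hu => ?_⟩
  -- Near `a` the integral term is at most `‖L‖ / 4`. This leaves at least `3 ‖L‖ / 4` for the
  -- Wronskian, and it is exactly half of `δ = ‖L‖ / 2`.
  refine hy.sqIntegrableAtLeft_of_selfWronskian hy2 hu (δ := ‖L‖ / 2) (by positivity)
    (Ioc_subset_I hc ⟨hs.1, hsc.le⟩) (fun x hx => ?_) ?_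
  · have hx' : x ∈ Ioo τ.a c := ⟨hx.1, hx.2.trans_lt hsc⟩
    rw [e x hx']
    have h1 := hmono (Ioo τ.a x) (Ioo_subset_Ioo_right (hx.2.trans hs.2.le))
    have h2 := norm_sub_le_norm_add L
      ((lam - starRingEnd ℂ lam) * ((∫ x in Ioo τ.a x, ‖y x‖ ^ 2 ∂τ.μ : ℝ) : ℂ))
    rw [norm_mul, Complex.norm_of_nonneg (integral_nonneg fun _ => by positivity)] at h2
    linarith
  · refine (hmono (Ioc τ.a s) fun x hx => ⟨hx.1, hx.2.trans_lt hs.2⟩).trans ?_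
    linarith

end Weyl

end SturmLiouville

/-! ### Analytic dependence of `φ` and of `Φ` on the spectral parameter. -/

lemma differentiable_clm_comp {E F : Type*} [NormedAddCommGroup E] [NormedSpace ℂ E]
    [NormedAddCommGroup F] [NormedSpace ℂ F] {f : ℂ → E} (hf : Differentiable ℂ f)
    (T : E →L[ℂ] F) : Differentiable ℂ (fun lam => T (f lam)) :=
  T.differentiable.comp hf

lemma differentiable_eval {X : Type*} [TopologicalSpace X] [CompactSpace X] {f : ℂ → C(X, ℂ)}
    (hf : Differentiable ℂ f) (x : X) : Differentiable ℂ (fun lam => f lam x) :=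
  differentiable_clm_comp hf (ContinuousMap.evalCLM ℂ x)

namespace SturmLiouville

variable {τ : SturmLiouville} {s d c : ℝ}

variable (τ s d) in
lemma intervalIntegrable_r_mul_zero :
    IntervalIntegrable (fun x => (τ.r x : ℂ) * (fun _ => (0 : ℂ)) x) volume s d := by
  simp

lemma sol_homogeneous (hs : s ∈ τ.I) (hd : d ∈ τ.I) (hsd : s ≤ d) (y₀ w₀ lam : ℂ) :
    sol hs hd hsd (intervalIntegrable_r_mul_zero τ s d) y₀ w₀ lam =
      y₀ • sol hs hd hsd (intervalIntegrable_r_mul_zero τ s d) 1 0 lam +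
        w₀ • sol hs hd hsd (intervalIntegrable_r_mul_zero τ s d) 0 1 lam := by
  have h : source hs hd hsd (intervalIntegrable_r_mul_zero τ s d) y₀ w₀ =
      y₀ • source hs hd hsd (intervalIntegrable_r_mul_zero τ s d) 1 0 +
        w₀ • source hs hd hsd (intervalIntegrable_r_mul_zero τ s d) 0 1 := by
    ext x
    simp [source, volterra_apply, IccExtend]
  rw [sol, h, ContinuousLinearMap.map_add, ContinuousLinearMap.map_smul,
    ContinuousLinearMap.map_smul]
  rfl

/-- The solution with data `(0, 1)` does not vanish identically. -/
lemma exists_sol_ne_zero (hs : s ∈ τ.I) (hd : d ∈ τ.I) (hsd : s < d) (lam : ℂ) :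
    ∃ x, sol hs hd hsd.le (intervalIntegrable_r_mul_zero τ s d) 0 1 lam x ≠ 0 := by
  by_contra! h
  have h1 := solOn_sol hs hd hsd.le (f := fun _ => 0) (intervalIntegrable_r_mul_zero τ s d) 0 1 lam
  have h2 := h1.prim.ae_eq_zero fun x hx => by rw [IccExtend_of_mem _ _ hx, h]
  have h3 := eq_zero_of_ae_Ioc hsd h1.quasi.continuousOn (by
    filter_upwards [h2] with x hx hxI
    exact (div_eq_zero_iff.1 (hx hxI)).resolve_right
      (p_ne_zero (Icc_subset_I hs hd (Ioo_subset_Icc_self hxI)))) s ⟨le_rfl, hsd.le⟩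
  rw [IccExtend_of_mem _ _ ⟨le_rfl, hsd.le⟩, solQuasi_apply_left] at h3
  exact one_ne_zero h3

/-- The integral is the value at `d` of a fixed bounded Volterra operator applied to `y lam`, hence
a continuous linear functional of `y lam`. -/
lemma differentiable_setIntegral (hs : s ∈ τ.I) (hd : d ∈ τ.I) (hsd : s ≤ d)
    {y : ℂ → C(Icc s d, ℂ)} (hy : Differentiable ℂ y) {f : ℝ → ℂ}
    (hf : MemLp f 2 (τ.μ.restrict (Icc s d))) :
    Differentiable ℂ (fun lam => ∫ x in Icc s d, IccExtend hsd (y lam) x * f x ∂τ.μ) := by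
  have hi := intervalIntegrable_r_mul_of_memLp hs hd hsd hf
  have h1 := differentiable_eval (differentiable_clm_comp hy (volterra hsd _ hi)) ⟨d, hsd, le_rfl⟩
  refine (funext fun lam => ?_ :
    (fun lam => ∫ x in Icc s d, IccExtend hsd (y lam) x * f x ∂τ.μ) = _) ▸ h1
  rw [setIntegral_Icc_μ' hs hd hsd, volterra_apply]
  refine intervalIntegral.integral_congr fun x _ => ?_
  ring

namespace AssumptionA

variable {φ : ℝ → ℂ → ℂ}

/-- The quasi-derivative `p φ'`. -/
noncomputable def quasi (τ : SturmLiouville) (φ : ℝ → ℂ → ℂ) (x : ℝ) (lam : ℂ) : ℂ :=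
  τ.quasiDeriv (fun t => φ t lam) x

lemma solOn (hφ : τ.AssumptionA φ) (lam : ℂ) (hs : s ∈ τ.I) (hd : d ∈ τ.I) (hsd : s ≤ d) :
    τ.SolOn s d (fun x => φ x lam) (fun x => quasi τ φ x lam) (fun x => lam * φ x lam) :=
  Eqn.solOn (hφ.isSolution lam) hs hd hsd

lemma continuousOn (hφ : τ.AssumptionA φ) (lam : ℂ) : ContinuousOn (fun x => φ x lam) τ.I :=
  Eqn.continuousOn (hφ.isSolution lam)

lemma memLp (hφ : τ.AssumptionA φ) (lam : ℂ) (hc : c ∈ τ.I) :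
    MemLp (fun x => φ x lam) 2 (τ.μ.restrict (Ioc τ.a c)) :=
  (hφ.sqIntegrable lam).memLp (hφ.continuousOn lam) hc

lemma eq_sol (hφ : τ.AssumptionA φ) (hs : s ∈ τ.I) (hd : d ∈ τ.I) (hsd : s ≤ d) (lam : ℂ)
    (x : Icc s d) : φ x lam =
      sol hs hd hsd (intervalIntegrable_r_mul_zero τ s d) (φ s lam) (quasi τ φ s lam) lam x := by
  have h := hφ.solOn lam hs hd hsd
  have h' : τ.SolOn s d (fun x => φ x lam) (fun x => quasi τ φ x lam)
      (fun x => lam * φ x lam + (fun _ => 0) x) := by simpa using h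
  exact DFunLike.congr_fun (h'.eq_sol hsd (intervalIntegrable_r_mul_zero τ s d)) x

/-- The quasi-derivative of `φ` is entire in the spectral parameter. -/
lemma differentiable_quasi (hφ : τ.AssumptionA φ) (hs : s ∈ τ.I) :
    Differentiable ℂ (quasi τ φ s) := by
  obtain ⟨d, hd, hsd⟩ := exists_mem_I_gt hs
  intro lam₁
  obtain ⟨x, hx⟩ := exists_sol_ne_zero hs hd hsd lam₁
  have h₁ := differentiable_eval (differentiable_sol hs hd hsd.le
    (intervalIntegrable_r_mul_zero τ s d) 1 0) x
  have h₂ := differentiable_eval (differentiable_sol hs hd hsd.le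
    (intervalIntegrable_r_mul_zero τ s d) 0 1) x
  have hne : ∀ᶠ lam in 𝓝 lam₁,
      sol hs hd hsd.le (intervalIntegrable_r_mul_zero τ s d) 0 1 lam x ≠ 0 :=
    (h₂.continuous.continuousAt).eventually_ne hx
  -- Expanding `φ(x)` in the fundamental system at `s` and solving for the coefficient `p φ'(s)`
  -- gives this quotient. The point `x` is chosen so that the denominator does not vanish at `lam₁`.
  have hq : DifferentiableAt ℂ (fun lam =>
      (φ x lam - φ s lam * sol hs hd hsd.le (intervalIntegrable_r_mul_zero τ s d) 1 0 lam x) /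
        sol hs hd hsd.le (intervalIntegrable_r_mul_zero τ s d) 0 1 lam x) lam₁ :=
    ((hφ.entire x (Icc_subset_I hs hd x.2) lam₁).sub ((hφ.entire s hs lam₁).mul (h₁ lam₁))).div
      (h₂ lam₁) hx
  refine hq.congr_of_eventuallyEq ?_
  filter_upwards [hne] with lam hlam
  rw [eq_div_iff hlam, hφ.eq_sol hs hd hsd.le lam x,
    sol_homogeneous hs hd hsd.le (φ s lam) (quasi τ φ s lam)]
  simp

/-- The restriction of `φ(·, lam)` to `[s, d]`. -/
noncomputable def restr (hφ : τ.AssumptionA φ) (hs : s ∈ τ.I) (hd : d ∈ τ.I) (lam : ℂ) :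
    C(Icc s d, ℂ) :=
  ⟨fun x => φ x lam, ((hφ.continuousOn lam).mono (Icc_subset_I hs hd)).comp_continuous
    continuous_subtype_val fun x => x.2⟩

/-- The expansion in the fundamental system at `s` upgrades analyticity at each point to analyticity
as a map into the continuous functions on `[s, d]`. -/
lemma differentiable_restr (hφ : τ.AssumptionA φ) (hs : s ∈ τ.I) (hd : d ∈ τ.I) (hsd : s ≤ d) :
    Differentiable ℂ (hφ.restr hs hd) := by
  have h : hφ.restr hs hd = fun lam =>
      φ s lam • sol hs hd hsd (intervalIntegrable_r_mul_zero τ s d) 1 0 lam +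
        quasi τ φ s lam • sol hs hd hsd (intervalIntegrable_r_mul_zero τ s d) 0 1 lam := by
    ext lam x
    rw [← sol_homogeneous]
    exact hφ.eq_sol hs hd hsd lam x
  rw [h]
  exact ((hφ.entire s hs).smul (differentiable_sol hs hd hsd _ 1 0)).add
    ((hφ.differentiable_quasi hs).smul (differentiable_sol hs hd hsd _ 0 1))

/-- Integrals of `φ` over compact intervals are entire in the spectral parameter. -/
lemma differentiable_integral (hφ : τ.AssumptionA φ) (hs : s ∈ τ.I) (hd : d ∈ τ.I) (hsd : s ≤ d)
    {f : ℝ → ℂ} (hf : MemLp f 2 (τ.μ.restrict (Icc s d))) :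
    Differentiable ℂ (fun lam => ∫ x in Icc s d, φ x lam * f x ∂τ.μ) := by
  have h := differentiable_setIntegral hs hd hsd (hφ.differentiable_restr hs hd hsd) hf
  have e : (fun lam => ∫ x in Icc s d, φ x lam * f x ∂τ.μ) =
      fun lam => ∫ x in Icc s d, IccExtend hsd (hφ.restr hs hd lam) x * f x ∂τ.μ := by
    funext lam
    refine setIntegral_congr_fun measurableSet_Icc fun x hx => ?_
    simp only [IccExtend_of_mem _ _ hx]
    rfl
  rwa [e]

lemma conj_quasi (hφ : τ.AssumptionA φ) (hs : s ∈ τ.I) (lam : ℝ) :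
    starRingEnd ℂ (quasi τ φ s lam) = quasi τ φ s lam := by
  have h1 : HasDerivAt (fun t => φ t lam) (deriv (fun t => φ t lam) s) s :=
    ((hφ.isSolution lam).differentiableOn.differentiableAt (τ.isOpen_I.mem_nhds hs)).hasDerivAt
  have h2 : HasDerivAt (fun t => starRingEnd ℂ (φ t lam))
      (starRingEnd ℂ (deriv (fun t => φ t lam) s)) s := h1.star
  have h3 : (fun t => starRingEnd ℂ (φ t lam)) =ᶠ[𝓝 s] fun t => φ t lam := by
    filter_upwards [τ.isOpen_I.mem_nhds hs] with t ht
    exact Complex.conj_eq_iff_im.2 (hφ.real t ht lam)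
  have h4 := (h2.congr_of_eventuallyEq h3.symm).unique h1
  rw [quasi, quasiDeriv, map_mul, h4, Complex.conj_ofReal]

lemma conj_apply (hφ : τ.AssumptionA φ) (hs : s ∈ τ.I) (lam : ℝ) :
    starRingEnd ℂ (φ s lam) = φ s lam :=
  Complex.conj_eq_iff_im.2 (hφ.real s hs lam)

lemma norm_sub_conj (lam : ℂ) : ‖lam - starRingEnd ℂ lam‖ = 2 * |lam.im| := by
  rw [Complex.sub_conj]
  simp

/-- `∫_a^c |φ(x, lam)|² r dx` is bounded for `lam` in the unit disk around a real point. -/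
lemma exists_bound (hτ : τ.IsLimitPointAtLeft) (hφ : τ.AssumptionA φ) (hc : c ∈ τ.I) (lam₀ : ℝ) :
    ∃ C, 0 ≤ C ∧ ∀ lam ∈ Metric.ball (lam₀ : ℂ) 1,
      ∫ x in Ioc τ.a c, ‖φ x lam‖ ^ 2 ∂τ.μ ≤ C := by
  obtain ⟨K, hK0, hK, hKL⟩ := exists_lipschitz_of_differentiable (hφ.entire c hc) lam₀ 1
  obtain ⟨K', hK0', hK', hKL'⟩ :=
    exists_lipschitz_of_differentiable (hφ.differentiable_quasi hc) lam₀ 1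
  have hnonreal : ∀ lam ∈ Metric.ball (lam₀ : ℂ) 1, lam.im ≠ 0 →
      ∫ x in Ioc τ.a c, ‖φ x lam‖ ^ 2 ∂τ.μ ≤ 2 * K * K' := by
    intro lam hlam him
    have h1 := (hφ.isSolution lam).selfWronskian_eq hτ (hφ.sqIntegrable lam) hc
    have hb : lam ∈ Metric.closedBall (lam₀ : ℂ) 1 := Metric.ball_subset_closedBall hlam
    have hb' : (lam.re : ℂ) ∈ Metric.closedBall (lam₀ : ℂ) 1 := by
      rw [mem_closedBall_iff_norm] at hb ⊢
      refine le_trans ?_ hb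
      rw [← Complex.ofReal_sub, Complex.norm_real]
      simpa using Complex.abs_re_le_norm (lam - lam₀)
    have hd : ‖lam - lam.re‖ = |lam.im| := by
      have : lam - lam.re = lam.im * Complex.I := by
        apply Complex.ext <;> simp
      rw [this]
      simp
    -- At the real point `lam.re` the values of `φ` and `p φ'` are real and the Wronskian vanishes.
    -- Telescoping against that point leaves four terms, each at most `K K' |Im lam|`. Division by
    -- `|lam - conj lam| = 2 |Im lam|` then gives `2 K K'`.
    have e : τ.selfWronskian (fun x => φ x lam) c =
        (φ c lam - φ c lam.re) * starRingEnd ℂ (quasi τ φ c lam) +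
        φ c lam.re * starRingEnd ℂ (quasi τ φ c lam - quasi τ φ c lam.re) -
        (quasi τ φ c lam - quasi τ φ c lam.re) * starRingEnd ℂ (φ c lam) -
        quasi τ φ c lam.re * starRingEnd ℂ (φ c lam - φ c lam.re) := by
      rw [map_sub, map_sub, hφ.conj_quasi hc, hφ.conj_apply hc]
      change φ c lam * starRingEnd ℂ (quasi τ φ c lam) -
        quasi τ φ c lam * starRingEnd ℂ (φ c lam) = _
      ring
    have h2 := hKL lam hb lam.re hb'
    have h3 := hKL' lam hb lam.re hb'
    rw [hd] at h2 h3
    have h4 : ‖τ.selfWronskian (fun x => φ x lam) c‖ ≤ 4 * (K * K' * |lam.im|) := by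
      rw [e]
      have t1 : ‖(φ c lam - φ c lam.re) * starRingEnd ℂ (quasi τ φ c lam)‖ ≤
          (K * |lam.im|) * K' := by
        rw [norm_mul, RCLike.norm_conj]
        exact mul_le_mul h2 (hK' _ hb) (norm_nonneg _) (by positivity)
      have t2 : ‖φ c lam.re * starRingEnd ℂ (quasi τ φ c lam - quasi τ φ c lam.re)‖ ≤
          K * (K' * |lam.im|) := by
        rw [norm_mul, RCLike.norm_conj]
        exact mul_le_mul (hK _ hb') h3 (norm_nonneg _) (by positivity)
      have t3 : ‖(quasi τ φ c lam - quasi τ φ c lam.re) * starRingEnd ℂ (φ c lam)‖ ≤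
          (K' * |lam.im|) * K := by
        rw [norm_mul, RCLike.norm_conj]
        exact mul_le_mul h3 (hK _ hb) (norm_nonneg _) (by positivity)
      have t4 : ‖quasi τ φ c lam.re * starRingEnd ℂ (φ c lam - φ c lam.re)‖ ≤
          K' * (K * |lam.im|) := by
        rw [norm_mul, RCLike.norm_conj]
        exact mul_le_mul (hK' _ hb') h2 (norm_nonneg _) (by positivity)
      refine (norm_sub_le_of_le (norm_sub_le_of_le (norm_add_le_of_le t1 t2) t3) t4).trans ?_
      linarith
    rw [h1, norm_mul, norm_sub_conj, Complex.norm_of_nonneg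
      (integral_nonneg fun _ => by positivity)] at h4
    have h5 : 0 < |lam.im| := abs_pos.2 him
    nlinarith
  refine ⟨2 * K * K', by positivity, fun lam hlam => ?_⟩
  by_cases him : lam.im ≠ 0
  · exact hnonreal lam hlam him
  -- real points are limits of non-real ones
  have hC0 : 0 ≤ 2 * K * K' := by positivity
  have hcomp : ∀ s ∈ Ioo τ.a c, ∫ x in Icc s c, ‖φ x lam‖ ^ 2 ∂τ.μ ≤ 2 * K * K' := by
    intro s hs
    have hsI : s ∈ τ.I := Ioc_subset_I hc (Ioo_subset_Ioc_self hs)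
    have hm : ∀ z, MemLp (fun x => φ x z) 2 (τ.μ.restrict (Icc s c)) := fun z =>
      memLp_of_continuousOn hsI hc ((hφ.continuousOn z).mono (Icc_subset_I hsI hc))
    set N := ∫ x in Icc s c, ‖φ x lam‖ ^ 2 ∂τ.μ with hN
    have hN0 : 0 ≤ N := integral_nonneg fun _ => by positivity
    -- Testing against the conjugate of `φ(·, lam)` at the fixed real point makes the integral
    -- depend continuously on the approximating parameter. Cauchy-Schwarz and the bound at non-real
    -- points then give `N ≤ √(2 K K') √N` in the limit.
    have hcont := (hφ.differentiable_integral hsI hc hs.2.le (hm lam).star).continuous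
    have hlim : Tendsto (fun n : ℕ => lam + (1 / ((n : ℝ) + 1) : ℝ) * Complex.I) atTop (𝓝 lam) := by
      have h1 := (Complex.continuous_ofReal.tendsto 0).comp
        (tendsto_one_div_add_atTop_nhds_zero_nat (𝕜 := ℝ))
      have h2 := (h1.mul_const Complex.I).const_add lam
      simpa using h2
    have h3 := ((hcont.tendsto lam).comp hlim).norm
    have h4 : ‖∫ x in Icc s c, φ x lam * star (φ x lam) ∂τ.μ‖ = N := by
      have : ∀ x, φ x lam * star (φ x lam) = ((‖φ x lam‖ ^ 2 : ℝ) : ℂ) := fun x => by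
        rw [Complex.star_def, Complex.mul_conj']
        push_cast
        rfl
      simp only [this]
      rw [integral_complex_ofReal, Complex.norm_of_nonneg hN0]
    have h5 : N ≤ √(2 * K * K') * √N := by
      rw [← h4]
      refine le_of_tendsto h3 ?_
      filter_upwards [hlim.eventually (Metric.isOpen_ball.mem_nhds hlam)] with n hn
      refine (norm_integral_mul_le_sqrt (hm _) (hm lam).star).trans ?_
      simp only [Pi.star_apply, norm_star]
      rw [h4, ← hN]
      refine mul_le_mul_of_nonneg_right (Real.sqrt_le_sqrt ?_) (Real.sqrt_nonneg _)
      refine le_trans ?_ (hnonreal _ hn ?_)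
      · exact setIntegral_mono_set (hφ.memLp _ hc).integrable_norm_sq
          (Eventually.of_forall fun _ => by positivity)
          (LE.le.eventuallyLE fun x hx => ⟨hs.1.trans_le hx.1, hx.2⟩)
      · have h6 : lam.im = 0 := not_not.1 him
        have h7 : (0 : ℝ) < (n : ℝ) + 1 := by positivity
        simp only [Complex.add_im, h6, Complex.im_ofReal_mul, Complex.I_im,
          mul_one, zero_add]
        positivity
    rcases hN0.eq_or_lt with h | h
    · rw [← h]; exact hC0
    · have h8 : √N ≤ √(2 * K * K') := by
        have h9 : 0 < √N := Real.sqrt_pos.2 h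
        nlinarith [Real.mul_self_sqrt hN0]
      exact (Real.sqrt_le_sqrt_iff hC0).1 h8
  obtain ⟨v, hva, hv, hlim⟩ := exists_seq_left_endpoint hc
  have hint : IntegrableOn (fun x => ‖φ x lam‖ ^ 2) (Ioc τ.a c) τ.μ :=
    (hφ.memLp lam hc).integrable_norm_sq
  have h1 := (tendsto_setIntegral_Ioo_left hint hva hv hlim).add_const (2 * K * K')
  rw [zero_add] at h1
  refine ge_of_tendsto h1 (Eventually.of_forall fun n => ?_)
  rw [setIntegral_Ioc_eq hint (hv n).1 (hv n).2.le]
  exact add_le_add_right (hcomp _ (hv n)) _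

/-- The integrals `∫_a^c φ f r` of square integrable `f` are analytic near the real line. -/
lemma analyticAt_integral (hτ : τ.IsLimitPointAtLeft) (hφ : τ.AssumptionA φ) (hc : c ∈ τ.I)
    (f : τ.L2) (lam₀ : ℝ) :
    AnalyticAt ℂ (fun lam => ∫ x in Ioc τ.a c, φ x lam * f x ∂τ.μ) lam₀ := by
  obtain ⟨C, hC0, hC⟩ := hφ.exists_bound hτ hc lam₀
  obtain ⟨v, hva, hv, hlim⟩ := exists_seq_left_endpoint hc
  have hvI : ∀ n, v n ∈ τ.I := fun n => Ioc_subset_I hc (Ioo_subset_Ioc_self (hv n))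
  have hf := memLp_L2 f (Ioc τ.a c)
  have hsub : ∀ n, Ioo τ.a (v n) ⊆ Ioc τ.a c := fun n =>
    Ioo_subset_Ioc_self.trans (Ioc_subset_Ioc_right (hv n).2.le)
  refine DifferentiableOn.analyticAt (s := Metric.ball (lam₀ : ℂ) 1) ?_
    (Metric.ball_mem_nhds _ one_pos)
  -- The integrals over `[v n, c]` are entire. By Cauchy-Schwarz and the uniform bound on `φ`, the
  -- remainders near `a` tend to zero uniformly on the disk, so the limit is holomorphic.
  refine TendstoLocallyUniformlyOn.differentiableOn (φ := atTop)
    (F := fun n lam => ∫ x in Icc (v n) c, φ x lam * f x ∂τ.μ) ?_ (Eventually.of_forall fun n =>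
    (hφ.differentiable_integral (hvI n) hc (hv n).2.le (memLp_L2 f _)).differentiableOn)
    Metric.isOpen_ball
  refine TendstoUniformlyOn.tendstoLocallyUniformlyOn ?_
  rw [Metric.tendstoUniformlyOn_iff]
  intro ε hε
  have h0 := ((Real.continuous_sqrt.tendsto 0).comp
    (tendsto_setIntegral_Ioo_left (show IntegrableOn (fun x => ‖f x‖ ^ 2) (Ioc τ.a c) τ.μ from
      hf.integrable_norm_sq) hva hv hlim)).const_mul (√C)
  rw [Real.sqrt_zero, mul_zero] at h0
  filter_upwards [h0.eventually (gt_mem_nhds hε)] with n hn lam hlam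
  have hm := hφ.memLp lam hc
  have hi : IntegrableOn (fun x => φ x lam * f x) (Ioc τ.a c) τ.μ := hm.integrable_mul hf
  rw [setIntegral_Ioc_eq hi (hv n).1 (hv n).2.le, dist_eq_norm,
    add_sub_cancel_right]
  refine ((norm_integral_mul_le_sqrt (hm.mono_measure (Measure.restrict_mono_set _ (hsub n)))
    (hf.mono_measure (Measure.restrict_mono_set _ (hsub n)))).trans ?_).trans_lt hn
  refine mul_le_mul_of_nonneg_right (Real.sqrt_le_sqrt ?_) (Real.sqrt_nonneg _)
  refine le_trans ?_ (hC lam hlam)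
  exact setIntegral_mono_set hm.integrable_norm_sq (Eventually.of_forall fun _ => by positivity)
    (LE.le.eventuallyLE (hsub n))

lemma integrable_mul (hφ : τ.AssumptionA φ) (f : τ.manifoldL) (lam : ℂ) :
    Integrable (fun x => φ x lam * (f : τ.L2) x) τ.μ := by
  obtain ⟨c, hc, hfc⟩ := f.2
  have h : IntegrableOn (fun x => φ x lam * (f : τ.L2) x) (Ioc τ.a c) τ.μ :=
    (hφ.memLp lam hc).integrable_mul (memLp_L2 _ _)
  refine h.integrable_of_ae_notMem_eq_zero ?_
  filter_upwards [hfc, ae_μ_mem_I] with x hx hxI hn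
  rw [hx (not_le.1 fun h => hn ⟨hxI.1, h⟩), mul_zero]

lemma Φ_eq {f : τ.manifoldL} (hfc : ∀ᵐ x ∂τ.μ, c < x → (f : τ.L2) x = 0) (lam : ℂ) :
    τ.Φ φ f lam = ∫ x in Ioc τ.a c, φ x lam * (f : τ.L2) x ∂τ.μ := by
  refine (setIntegral_eq_integral_of_ae_compl_eq_zero ?_).symm
  filter_upwards [hfc, ae_μ_mem_I] with x hx hxI hn
  rw [hx (not_le.1 fun h => hn ⟨hxI.1, h⟩), mul_zero]

lemma analyticAt_Φ (hτ : τ.IsLimitPointAtLeft) (hφ : τ.AssumptionA φ) (f : τ.manifoldL)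
    (lam₀ : ℝ) : AnalyticAt ℝ (fun lam : ℝ => τ.Φ φ f (lam : ℂ)) lam₀ := by
  obtain ⟨c, hc, hfc⟩ := f.2
  simp only [Φ_eq hfc]
  exact ((hφ.analyticAt_integral hτ hc f lam₀).restrictScalars (𝕜 := ℝ)).comp
    (Complex.ofRealCLM.analyticAt lam₀)

lemma isLinearMap_Φ (hφ : τ.AssumptionA φ) (lam : ℂ) : IsLinearMap ℂ (fun f => τ.Φ φ f lam) where
  map_add f g := by
    rw [Φ, Φ, Φ, ← integral_add (hφ.integrable_mul f lam) (hφ.integrable_mul g lam)]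
    refine integral_congr_ae ?_
    filter_upwards [Lp.coeFn_add (f : τ.L2) (g : τ.L2)] with x hx
    simp only [Submodule.coe_add, hx, Pi.add_apply, mul_add]
  map_smul t f := by
    rw [Φ, Φ, smul_eq_mul, ← integral_const_mul]
    refine integral_congr_ae ?_
    filter_upwards [Lp.coeFn_smul t (f : τ.L2)] with x hx
    simp only [SetLike.val_smul, hx, Pi.smul_apply, smul_eq_mul, mul_left_comm]

end AssumptionA

end SturmLiouville

/-! ### A cutoff for solutions and the a priori estimate. -/

/-- On the circle, `ρ² = z z̄` for `z = lam - lam₀`, so `z² - ρ² = z (z - z̄)`. Multiplication by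
this polynomial compensates a singularity of order `1 / |Im lam|` at the two real points of the
circle. -/
lemma norm_sub_sq_sub_sq {lam : ℂ} {lam₀ ρ : ℝ} (h : ‖lam - lam₀‖ = ρ) :
    ‖(lam - lam₀) ^ 2 - (ρ : ℂ) ^ 2‖ = 2 * ρ * |lam.im| := by
  set z := lam - lam₀ with hz
  have h1 : (ρ : ℂ) ^ 2 = z * starRingEnd ℂ z := by rw [Complex.mul_conj', h]
  have h2 : z.im = lam.im := by simp [hz]
  have h3 : z ^ 2 - (ρ : ℂ) ^ 2 = z * (z - starRingEnd ℂ z) := by rw [h1]; ring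
  rw [h3, norm_mul, h, Complex.sub_conj, h2]
  simp
  ring

namespace SturmLiouville

variable {τ : SturmLiouville} {s d c : ℝ}

/-- The solution is multiplied by a function `χ` going from one to zero with `p χ' = -η`, where `η`
is a quadratic polynomial vanishing at both ends. Prescribing `p χ'` rather than `χ` keeps the
quasi-derivative of `χ y` absolutely continuous although `p` is merely continuous. The constant `J`
normalizes `∫ η / p` to one. -/
lemma exists_solOn_cutoff {y w : ℝ → ℂ} {lam : ℂ} (hcd : s < d)
    (hy : τ.SolOn s d y w (fun x => lam * y x)) :
    ∃ z v h, τ.SolOn s d z v h ∧ z s = y s ∧ v s = w s ∧ z d = 0 ∧ v d = 0 ∧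
      MemLp z 2 (τ.μ.restrict (Icc s d)) ∧ MemLp h 2 (τ.μ.restrict (Icc s d)) := by
  have hs := hy.left_mem
  have hd := hy.right_mem
  have hI := Icc_subset_I hs hd
  set J : ℝ := ∫ x in s..d, (x - s) * (d - x) / τ.p x with hJ
  have hpc : ContinuousOn τ.p (Icc s d) := ContinuousOn.mono τ.continuousOn_p hI
  have hJc : ContinuousOn (fun x => (x - s) * (d - x) / τ.p x) (Icc s d) := by
    refine ContinuousOn.div (by fun_prop) hpc fun x hx => (τ.p_pos x (hI hx)).ne'
  have hJi : IntervalIntegrable (fun x => (x - s) * (d - x) / τ.p x) volume s d :=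
    hJc.intervalIntegrable_of_Icc hcd.le
  have hJ0 : 0 < J := by
    refine intervalIntegral.intervalIntegral_pos_of_pos_on hJi (fun x hx => ?_) hcd
    exact div_pos (mul_pos (sub_pos.2 hx.1) (sub_pos.2 hx.2))
      (τ.p_pos x (hI (Ioo_subset_Icc_self hx)))
  set η : ℝ → ℂ := fun x => (J : ℂ)⁻¹ * ((x - s) * (d - x)) with hη
  set η' : ℝ → ℂ := fun x => (J : ℂ)⁻¹ * (s + d - 2 * x) with hη'
  have hpc' : ContinuousOn (fun x => (τ.p x : ℂ)) (Icc s d) :=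
    Complex.continuous_ofReal.comp_continuousOn hpc
  have hrc' : ContinuousOn (fun x => (τ.r x : ℂ)) (Icc s d) := continuousOn_r'.mono hI
  have hηc : Continuous η := by fun_prop
  have hηc' : Continuous η' := by fun_prop
  have hηd : ∀ x : ℝ, HasDerivAt η (η' x) x := fun x => by
    have h1 : HasDerivAt (fun x : ℝ => (x : ℂ)) 1 x := by
      simpa using (hasDerivAt_id x).ofReal_comp
    have h2 := (((h1.sub_const (s : ℂ)).mul (h1.const_sub (d : ℂ))).const_mul (J : ℂ)⁻¹)
    refine h2.congr_deriv ?_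
    simp only [hη']
    ring
  have hηprim : IsPrimitiveOn s d η η' := ⟨hcd.le, hηc'.intervalIntegrable _ _, fun x _ => by
    rw [intervalIntegral.integral_eq_sub_of_hasDerivAt (fun t _ => hηd t)
      (hηc'.intervalIntegrable _ _)]
    ring⟩
  have hχi : IntervalIntegrable (fun x => -(η x / τ.p x)) volume s d :=
    (ContinuousOn.div hηc.continuousOn hpc' fun x hx =>
      p_ne_zero (hI hx)).neg.intervalIntegrable_of_Icc hcd.le
  have hχprim := IsPrimitiveOn.integral hcd.le hχi 1
  set χ : ℝ → ℂ := fun x => 1 + ∫ t in s..x, -(η t / τ.p t) with hχ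
  have hχs : χ s = 1 := by simp [hχ]
  have hχd : χ d = 0 := by
    have h1 : ∫ t in s..d, -(η t / τ.p t) = -1 := by
      have h2 : ∀ t : ℝ, -(η t / τ.p t) =
          -(J : ℂ)⁻¹ * (((t - s) * (d - t) / τ.p t : ℝ) : ℂ) := fun t => by
        simp only [hη]
        push_cast
        ring
      simp only [h2]
      rw [intervalIntegral.integral_const_mul, intervalIntegral.integral_ofReal, ← hJ, neg_mul,
        inv_mul_cancel₀ (by exact_mod_cast hJ0.ne')]
    simp only [hχ]
    rw [h1, add_neg_cancel]
  have hηs : η s = 0 := by simp [hη]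
  have hηd0 : η d = 0 := by simp [hη]
  have hcy := hy.prim.continuousOn
  have hcw := hy.quasi.continuousOn
  have hcχ := hχprim.continuousOn
  refine ⟨fun x => χ x * y x, fun x => χ x * w x - η x * y x,
    fun x => χ x * (lam * y x) + (2 * (η x * w x) / τ.p x + η' x * y x) / τ.r x,
    ⟨hs, hd, (hχprim.mul hy.prim).congr (fun x _ => rfl) ?_,
      ((hχprim.mul hy.quasi).sub (hηprim.mul hy.prim)).congr (fun x _ => rfl) ?_⟩, ?_, ?_, ?_, ?_,
      memLp_of_continuousOn hs hd (hcχ.mul hcy), memLp_of_continuousOn hs hd ?_⟩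
  · filter_upwards with x hx
    have := p_ne_zero (hI (Ioc_subset_Icc_self hx))
    field_simp
    ring
  · filter_upwards with x hx
    have := p_ne_zero (hI (Ioc_subset_Icc_self hx))
    have := r_ne_zero (hI (Ioc_subset_Icc_self hx))
    field_simp
    ring
  · simp [hχs]
  · simp [hχs, hηs]
  · simp [hχd]
  · simp [hχd, hηd0]
  · refine (hcχ.mul (continuousOn_const.mul hcy)).add (ContinuousOn.div ((ContinuousOn.div
      (continuousOn_const.mul (hηc.continuousOn.mul hcw)) hpc' fun x hx => p_ne_zero (hI hx)).add
      (hηc'.continuousOn.mul hcy)) hrc' fun x hx => r_ne_zero (hI hx))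

namespace AssumptionA

variable {φ : ℝ → ℂ → ℂ}

/-- If `φ` vanished on all of `[c, b)`, uniqueness would make it vanish to the left as well. The
point found serves as the endpoint of a Dirichlet problem on `(a, d)` for which `lam` is not an
eigenvalue. -/
lemma exists_ne_zero (hφ : τ.AssumptionA φ) (lam : ℂ) (hc : c ∈ τ.I) :
    ∃ d ∈ τ.I, c ≤ d ∧ φ d lam ≠ 0 := by
  by_contra! h
  obtain ⟨d, hd, hcd⟩ := exists_mem_I_gt hc
  have h1 := hφ.solOn lam hc hd hcd.le
  have h2 := h1.prim.ae_eq_zero fun x hx => h x (Icc_subset_I hc hd hx) hx.1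
  have h3 := eq_zero_of_ae_Ioc hcd h1.quasi.continuousOn (by
    filter_upwards [h2] with x hx hxI
    exact (div_eq_zero_iff.1 (hx hxI)).resolve_right
      (p_ne_zero (Icc_subset_I hc hd (Ioo_subset_Icc_self hxI)))) c ⟨le_rfl, hcd.le⟩
  obtain ⟨x, hx, hne⟩ := hφ.nontrivial lam
  rcases le_total c x with hcx | hcx
  · exact hne (h x hx hcx)
  · exact hne ((hφ.solOn lam hx hc hcx).eq_zero_of_right (h c hc le_rfl) h3 x ⟨le_rfl, hcx⟩)

/-- Estimate for the problem with boundary condition `u(c) = 0` at a non-real point. -/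
lemma abs_im_mul_sqrt_le (hτ : τ.IsLimitPointAtLeft) (hφ : τ.AssumptionA φ) {u v f : ℝ → ℂ}
    {lam κ : ℂ} (hu : τ.SolOn s c u v (fun x => lam * u x + f x))
    (hf : MemLp f 2 (τ.μ.restrict (Icc s c))) (huc : u c = 0) (hus : u s = κ * φ s lam)
    (hvs : v s = κ * quasi τ φ s lam) :
    |lam.im| * √(∫ x in Icc s c, ‖u x‖ ^ 2 ∂τ.μ) ≤ √(∫ x in Icc s c, ‖f x‖ ^ 2 ∂τ.μ) := by
  have hum : MemLp u 2 (τ.μ.restrict (Icc s c)) :=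
    memLp_of_continuousOn hu.left_mem hu.right_mem hu.prim.continuousOn
  set N := √(∫ x in Icc s c, ‖u x‖ ^ 2 ∂τ.μ) with hN
  set M := √(∫ x in Icc s c, ‖f x‖ ^ 2 ∂τ.μ) with hM
  have hN2 : N ^ 2 = ∫ x in Icc s c, ‖u x‖ ^ 2 ∂τ.μ :=
    Real.sq_sqrt (integral_nonneg fun _ => by positivity)
  have hN0 : 0 ≤ N := Real.sqrt_nonneg _
  have hM0 : 0 ≤ M := Real.sqrt_nonneg _
  set P := ∫ x in Ioc τ.a s, ‖φ x lam‖ ^ 2 ∂τ.μ with hP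
  have hP0 : 0 ≤ P := integral_nonneg fun _ => by positivity
  have h1 := hu.lagrange_conj
  have h2 := (hφ.isSolution lam).selfWronskian_eq hτ (hφ.sqIntegrable lam) hu.left_mem
  set i₁ := ∫ x in Icc s c, f x * starRingEnd ℂ (u x) ∂τ.μ with hi₁
  set i₂ := ∫ x in Icc s c, u x * starRingEnd ℂ (f x) ∂τ.μ with hi₂
  have e₁ : ‖i₁‖ ≤ M * N := by
    refine (norm_integral_mul_le_sqrt hf hum.star).trans (le_of_eq ?_)
    simp only [Pi.star_apply, norm_star, hM, hN]
  have e₂ : ‖i₂‖ ≤ M * N := by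
    refine (norm_integral_mul_le_sqrt hum hf.star).trans (le_of_eq ?_)
    simp only [Pi.star_apply, norm_star, hM, hN, mul_comm]
  have j₁ : Integrable (fun x => f x * starRingEnd ℂ (u x)) (τ.μ.restrict (Icc s c)) :=
    hf.integrable_mul hum.star
  have j₂ : Integrable (fun x => u x * starRingEnd ℂ (f x)) (τ.μ.restrict (Icc s c)) :=
    hum.integrable_mul hf.star
  have e₃ : ∫ x in Icc s c, ((lam * u x + f x) * starRingEnd ℂ (u x) -
      u x * starRingEnd ℂ (lam * u x + f x)) ∂τ.μ =
      (lam - starRingEnd ℂ lam) * ((N ^ 2 : ℝ) : ℂ) + (i₁ - i₂) := by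
    rw [hN2, hi₁, hi₂, ← integral_sub j₁ j₂,
      ← integral_complex_ofReal, ← integral_const_mul, ← integral_add]
    · refine integral_congr_ae (Eventually.of_forall fun x => ?_)
      simp only [map_mul, map_add]
      push_cast
      rw [← Complex.mul_conj']
      ring
    · exact hum.integrable_norm_sq.ofReal.const_mul _
    · exact j₁.sub j₂
  rw [e₃, huc, hus, hvs] at h1
  have h3 : τ.selfWronskian (fun x => φ x lam) s =
      φ s lam * starRingEnd ℂ (quasi τ φ s lam) - quasi τ φ s lam * starRingEnd ℂ (φ s lam) := rfl
  -- The boundary term at `c` vanishes since `u c = 0`. The one at `s` is `|κ|² W(φ, φ̄)(s) = |κ|²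
  -- (lam - conj lam) P` by the limit point property; it has the favourable sign and is dropped
  -- below.
  have h4 : (lam - starRingEnd ℂ lam) * ((N ^ 2 + ‖κ‖ ^ 2 * P : ℝ) : ℂ) = i₂ - i₁ := by
    push_cast at h1 ⊢
    rw [← Complex.mul_conj' κ]
    simp only [map_mul, map_zero] at h1
    linear_combination (-1 : ℂ) * h1 + κ * starRingEnd ℂ κ * (h2.symm.trans h3)
  have h5 := congr_arg norm h4
  rw [norm_mul, norm_sub_conj, Complex.norm_of_nonneg (by positivity)] at h5
  have h6 : 2 * |lam.im| * (N ^ 2 + ‖κ‖ ^ 2 * P) ≤ 2 * (M * N) := by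
    rw [h5]
    exact (norm_sub_le _ _).trans (by linarith)
  have h7 : 0 ≤ |lam.im| * (‖κ‖ ^ 2 * P) := by positivity
  rcases hN0.eq_or_lt with h | h
  · rw [← h, mul_zero]; exact hM0
  · refine le_of_mul_le_mul_right ?_ h
    nlinarith

/-- An a priori estimate for solutions with compact support in `(a, c]`. -/
lemma exists_apriori (hτ : τ.IsLimitPointAtLeft) (hφ : τ.AssumptionA φ) (hc : c ∈ τ.I)
    {lam₀ : ℝ} (hne : φ c lam₀ ≠ 0) :
    ∃ C, 0 ≤ C ∧ ∀ s ∈ Ioo τ.a c, ∀ f y w : ℝ → ℂ, MemLp f 2 (τ.μ.restrict (Icc s c)) →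
      τ.SolOn s c y w (fun x => lam₀ * y x + f x) → y s = 0 → w s = 0 → y c = 0 →
      √(∫ x in Icc s c, ‖y x‖ ^ 2 ∂τ.μ) ≤ C * √(∫ x in Icc s c, ‖f x‖ ^ 2 ∂τ.μ) := by
  -- The radius, and with it the constant `2 / ρ`, depends on `φ(c, ·)` only and not on `s` or `f`.
  obtain ⟨ρ, hρ, hρne⟩ := Metric.nhds_basis_closedBall.eventually_iff.1
    (((hφ.entire c hc).continuous.continuousAt (x := (lam₀ : ℂ))).eventually_ne hne)
  refine ⟨2 / ρ, by positivity, fun s hsc f y w hf hy hys hws hyc => ?_⟩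
  have hs := hy.left_mem
  have hr := intervalIntegrable_r_mul_of_memLp hs hc hsc.2.le hf
  have hym : MemLp y 2 (τ.μ.restrict (Icc s c)) :=
    memLp_of_continuousOn hs hc hy.prim.continuousOn
  set M := √(∫ x in Icc s c, ‖f x‖ ^ 2 ∂τ.μ) with hM
  set N := √(∫ x in Icc s c, ‖y x‖ ^ 2 ∂τ.μ) with hN
  have hN0 : 0 ≤ N := Real.sqrt_nonneg _
  have hM0 : 0 ≤ M := Real.sqrt_nonneg _
  have hN2 : N ^ 2 = ∫ x in Icc s c, ‖y x‖ ^ 2 ∂τ.μ :=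
    Real.sq_sqrt (integral_nonneg fun _ => by positivity)
  set Y : ℂ → C(Icc s c, ℂ) := sol hs hc hsc.2.le hr 0 0 with hY
  set κ : ℂ → ℂ := fun lam => Y lam ⟨c, hsc.2.le, le_rfl⟩ / φ c lam with hκ
  set V : ℂ → ℝ → ℂ := fun lam => IccExtend hsc.2.le (solQuasi hs hc hsc.2.le hr 0 0 lam) with hV
  -- `u lam` solves the inhomogeneous equation with parameter `lam`. The multiple of `φ` is chosen
  -- so that `u lam` vanishes at `c`; at `s` its data remain proportional to those of `φ`.
  set u : ℂ → ℝ → ℂ := fun lam x => IccExtend hsc.2.le (Y lam) x - κ lam * φ x lam with hu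
  have hYsol : ∀ lam, τ.SolOn s c (IccExtend hsc.2.le (Y lam)) (V lam)
      (fun x => lam * IccExtend hsc.2.le (Y lam) x + f x) := solOn_sol hs hc hsc.2.le hr 0 0
  have hYs : ∀ lam, IccExtend hsc.2.le (Y lam) s = 0 := fun lam => by
    rw [IccExtend_of_mem _ _ ⟨le_rfl, hsc.2.le⟩]
    exact sol_apply_left hs hc hsc.2.le hr 0 0 lam
  have hVs : ∀ lam, V lam s = 0 := fun lam => by
    simp only [hV]
    rw [IccExtend_of_mem _ _ ⟨le_rfl, hsc.2.le⟩]
    exact solQuasi_apply_left hs hc hsc.2.le hr 0 0 lam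
  have hYc : ∀ lam, IccExtend hsc.2.le (Y lam) c = Y lam ⟨c, hsc.2.le, le_rfl⟩ := fun lam =>
    IccExtend_of_mem _ _ ⟨hsc.2.le, le_rfl⟩
  have husol : ∀ lam, τ.SolOn s c (u lam) (fun x => V lam x - κ lam * quasi τ φ x lam)
      (fun x => lam * u lam x + f x) := fun lam => by
    refine ((hYsol lam).sub ((hφ.solOn lam hs hc hsc.2.le).const_mul (κ lam))).congr
      (fun x _ => rfl) (fun x _ => rfl) ?_
    filter_upwards with x _
    simp only [hu]
    ring
  have huc : ∀ lam ∈ Metric.closedBall (lam₀ : ℂ) ρ, u lam c = 0 := fun lam hlam => by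
    simp only [hu, hκ]
    rw [hYc, div_mul_cancel₀ _ (hρne hlam), sub_self]
  have hum : ∀ lam, MemLp (u lam) 2 (τ.μ.restrict (Icc s c)) := fun lam =>
    memLp_of_continuousOn hs hc (husol lam).prim.continuousOn
  -- the function to which the maximum principle is applied
  set F : ℂ → ℂ := fun lam => ∫ x in Icc s c, u lam x * star (y x) ∂τ.μ with hF
  have hFb : ∀ lam ∈ Metric.closedBall (lam₀ : ℂ) ρ, |lam.im| * ‖F lam‖ ≤ M * N := by
    intro lam hlam
    have h1 := hφ.abs_im_mul_sqrt_le hτ (κ := -κ lam) (husol lam) hf (huc lam hlam)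
      (by simp only [hu, hYs]; ring) (by rw [hVs]; ring)
    have h2 := norm_integral_mul_le_sqrt (hum lam) hym.star
    simp only [Pi.star_apply, norm_star] at h2
    calc |lam.im| * ‖F lam‖ ≤ |lam.im| * (√(∫ x in Icc s c, ‖u lam x‖ ^ 2 ∂τ.μ) * N) :=
          mul_le_mul_of_nonneg_left h2 (abs_nonneg _)
      _ ≤ M * N := by
          rw [← mul_assoc]
          exact mul_le_mul_of_nonneg_right h1 hN0
  have hFd : ∀ lam ∈ Metric.closedBall (lam₀ : ℂ) ρ, DifferentiableAt ℂ F lam := by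
    intro lam hlam
    have hYd := differentiable_sol hs hc hsc.2.le hr 0 0
    have d1 := differentiable_setIntegral hs hc hsc.2.le hYd hym.star
    have d2 := hφ.differentiable_integral hs hc hsc.2.le hym.star
    have d3 := differentiable_eval hYd ⟨c, hsc.2.le, le_rfl⟩
    have e : F = fun lam => (∫ x in Icc s c, IccExtend hsc.2.le (Y lam) x * (star y) x ∂τ.μ) -
        κ lam * ∫ x in Icc s c, φ x lam * (star y) x ∂τ.μ := by
      funext lam
      rw [← integral_const_mul, ← integral_sub]
      · refine integral_congr_ae (Eventually.of_forall fun x => ?_)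
        simp only [hu, Pi.star_apply]
        ring
      · exact (memLp_of_continuousOn hs hc (hYsol lam).prim.continuousOn).integrable_mul hym.star
      · exact ((memLp_of_continuousOn hs hc ((hφ.continuousOn lam).mono
          (Icc_subset_I hs hc))).integrable_mul hym.star).const_mul _
    rw [e]
    exact (d1 lam).sub (((d3 lam).div (hφ.entire c hc lam) (hρne hlam)).mul (d2 lam))
  -- The bound `|Im lam| ‖F lam‖ ≤ M N` alone says nothing at real points. With the quadratic factor
  -- it becomes the uniform bound `2 ρ M N` on the circle.
  have hGd : DiffContOnCl ℂ (fun lam => ((lam - lam₀) ^ 2 - (ρ : ℂ) ^ 2) * F lam)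
      (Metric.ball (lam₀ : ℂ) ρ) := by
    refine DifferentiableOn.diffContOnCl fun lam hlam => ?_
    rw [closure_ball _ hρ.ne'] at hlam
    exact (DifferentiableAt.mul (by fun_prop) (hFd lam hlam)).differentiableWithinAt
  have hmax := Complex.norm_le_of_forall_mem_frontier_norm_le Metric.isBounded_ball hGd
    (C := 2 * ρ * (M * N)) (fun lam hlam => by
      rw [frontier_ball _ hρ.ne', mem_sphere_iff_norm] at hlam
      have h1 := hFb lam (mem_closedBall_iff_norm.2 hlam.le)
      rw [norm_mul, norm_sub_sq_sub_sq hlam, mul_assoc]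
      exact mul_le_mul_of_nonneg_left h1 (by positivity))
    (subset_closure (Metric.mem_ball_self hρ) : (lam₀ : ℂ) ∈ _)
  have hyY : ∀ x ∈ Icc s c, IccExtend hsc.2.le (Y lam₀) x - y x = 0 := by
    have h1 : τ.SolOn s c _ _ (fun x => (lam₀ : ℂ) * (IccExtend hsc.2.le (Y lam₀) x - y x)) :=
      ((hYsol lam₀).sub hy).congr (fun x _ => rfl) (fun x _ => rfl) (by
        filter_upwards with x _
        ring)
    exact (h1.eq_zero_of_left (by rw [hYs, hys, sub_zero]) (by rw [hVs, hws, sub_zero])).1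
  -- At the centre `Y lam₀` is `y` by uniqueness, and `y c = 0`. Hence `F lam₀ = N²`, and the
  -- maximum principle reads `ρ² N² ≤ 2 ρ M N`.
  have hκ0 : κ lam₀ = 0 := by
    have h1 := hyY c ⟨hsc.2.le, le_rfl⟩
    rw [hYc, hyc, sub_zero] at h1
    simp only [hκ, h1, zero_div]
  have hF0 : F lam₀ = ((N ^ 2 : ℝ) : ℂ) := by
    rw [hN2, ← integral_complex_ofReal]
    refine setIntegral_congr_fun measurableSet_Icc fun x hx => ?_
    simp only [hu, hκ0, zero_mul, sub_zero]
    rw [sub_eq_zero.1 (hyY x hx), Complex.star_def, Complex.mul_conj']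
    push_cast
    rfl
  rw [hF0, sub_self, norm_mul, Complex.norm_of_nonneg (sq_nonneg N)] at hmax
  have h8 : ‖(0 : ℂ) ^ 2 - (ρ : ℂ) ^ 2‖ = ρ ^ 2 := by
    rw [zero_pow two_ne_zero, zero_sub, norm_neg, norm_pow, Complex.norm_of_nonneg hρ.le]
  rw [h8] at hmax
  rcases hN0.eq_or_lt with h | h
  · rw [← h]; positivity
  · rw [div_mul_eq_mul_div, le_div_iff₀ hρ]
    refine le_of_mul_le_mul_right ?_ (mul_pos hρ h)
    nlinarith

end AssumptionA

end SturmLiouville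

/-! ### Solvability of the inhomogeneous equation in the minimal operator. -/

namespace SturmLiouville

variable {τ : SturmLiouville} {s d c : ℝ}

instance nullSingletonClass_μ : NullSingletonClass τ.μ := by
  unfold μ
  infer_instance

lemma inner_cut_sub {S : Set ℝ} (hS : MeasurableSet S) {F G : ℝ → ℂ}
    (hF : MemLp F 2 (τ.μ.restrict S)) (hG : MemLp G 2 (τ.μ.restrict S)) (f g : τ.L2) :
    inner ℂ f (cut S hS F hF) - inner ℂ g (cut S hS G hG) =
      ∫ x in S, (starRingEnd ℂ (f x) * F x - starRingEnd ℂ (g x) * G x) ∂τ.μ := by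
  have h : ∀ (f : τ.L2) {F : ℝ → ℂ} (hF : MemLp F 2 (τ.μ.restrict S)),
      inner ℂ f (cut S hS F hF) = ∫ x in S, starRingEnd ℂ (f x) * F x ∂τ.μ := fun f F hF => by
    rw [inner_L2, ← integral_indicator hS]
    refine integral_congr_ae ?_
    filter_upwards [coeFn_cut (hS := hS) (hF := hF)] with x hx
    rw [hx]
    by_cases hxS : x ∈ S <;> simp [hxS]
  rw [h, h, ← integral_sub]
  · exact (memLp_L2 f S).star.integrable_mul hF
  · exact (memLp_L2 g S).star.integrable_mul hG

lemma norm_L2 (f : τ.L2) : ‖f‖ = √(∫ x, ‖f x‖ ^ 2 ∂τ.μ) := by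
  have h1 := inner_self_eq_norm_sq_to_K (𝕜 := ℂ) f
  have h2 : ∀ x, starRingEnd ℂ (f x) * f x = ((‖f x‖ ^ 2 : ℝ) : ℂ) := fun x => by
    rw [Complex.conj_mul']
    push_cast
    rfl
  rw [inner_L2] at h1
  simp only [h2] at h1
  rw [integral_complex_ofReal] at h1
  have h3 : ∫ x, ‖f x‖ ^ 2 ∂τ.μ = ‖f‖ ^ 2 := Complex.ofReal_injective (h1.trans (by simp))
  rw [h3, Real.sqrt_sq (norm_nonneg f)]

lemma sqIntegrableAtLeft_of_memLp {u : ℝ → ℂ} (hc : c ∈ τ.I)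
    (hu : MemLp u 2 (τ.μ.restrict (Ioc τ.a c))) : τ.SqIntegrableAtLeft u := by
  have h : IntegrableOn (fun x => ‖u x‖ ^ 2) (Ioc τ.a c) τ.μ := hu.integrable_norm_sq
  rw [integrableOn_μ_iff measurableSet_Ioc (Ioc_subset_I hc)] at h
  refine ⟨c, hc, IntegrableOn.mono_set ?_ Ioo_subset_Ioc_self⟩
  simpa [mul_comm] using h

/-- The preminimal operator has no eigenvalues. -/
lemma eq_zero_of_mem_preminimalOp {g : τ.L2} {lam : ℂ}
    (hg : (g, lam • g) ∈ τ.preminimalOp.graph) : g = 0 := by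
  obtain ⟨y, hgy, hy, s, hs, d, hd, hsd, hy0, hw0, -⟩ := exists_rep_of_mem_preminimalOp hg
  have h1 : τ.SolOn s d y (τ.quasiDeriv y) (fun x => lam * y x) := by
    refine (Eqn.solOn hy hs hd hsd.le).congr (fun _ _ => rfl) (fun _ _ => rfl) ?_
    filter_upwards [ae_of_ae_μ hgy, ae_of_ae_μ (Lp.coeFn_smul lam g)] with x h1 h2 hx
    have hxI := Icc_subset_I hs hd (Ioc_subset_Icc_self hx)
    rw [h2 hxI, Pi.smul_apply, h1 hxI, smul_eq_mul]
  have h2 := h1.eq_zero_of_left (hy0 s hs fun h => h.1.ne rfl) (hw0 s hs fun h => h.1.ne rfl)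
  refine (Lp.eq_zero_iff_ae_eq_zero).2 ?_
  filter_upwards [hgy, ae_μ_mem_I] with x hx hxI
  rw [hx, Pi.zero_apply]
  by_cases hxs : x ∈ Ioo s d
  · exact h2.1 x (Ioo_subset_Icc_self hxs)
  · exact hy0 x hxI hxs

lemma ae_eq_zero_of_tendsto {g : ℕ → τ.L2} {g' : τ.L2} (h : Tendsto g atTop (𝓝 g'))
    {P : ℝ → Prop} (hg : ∀ n, ∀ᵐ x ∂τ.μ, P x → g n x = 0) : ∀ᵐ x ∂τ.μ, P x → g' x = 0 := by
  obtain ⟨ns, -, h1⟩ := (tendstoInMeasure_of_tendsto_Lp h).exists_seq_tendsto_ae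
  filter_upwards [h1, ae_all_iff.2 hg] with x hx h0 hP
  refine tendsto_nhds_unique hx ?_
  simp only [h0 _ hP]
  exact tendsto_const_nhds

namespace AssumptionA

variable {φ : ℝ → ℂ → ℂ} {lam : ℝ}

/-- The range of `A - lam` on functions supported in `(a, c]` is orthogonal to `φ(·, lam)`. -/
lemma integral_eq_zero_of_mem_minimalOp (hφ : τ.AssumptionA φ) (hc : c ∈ τ.I) {g k : τ.L2}
    (hgk : (g, k) ∈ τ.minimalOp.graph) (hg : ∀ᵐ x ∂τ.μ, c < x → g x = 0)
    (hk : ∀ᵐ x ∂τ.μ, c < x → k x = 0) :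
    ∫ x in Ioc τ.a c, φ x lam * (k x - lam * g x) ∂τ.μ = 0 := by
  obtain ⟨c', hc', hcc'⟩ := exists_mem_I_gt hc
  obtain ⟨z, v, h, hz, hzc, hvc, hzc', hvc', hzm, hhm⟩ :=
    exists_solOn_cutoff hcc' (hφ.solOn lam hc hc' hcc'.le)
  have hsub : Ioc c c' ⊆ Icc c c' := Ioc_subset_Icc_self
  have hzm' := hzm.mono_measure (Measure.restrict_mono_set τ.μ hsub)
  have hhm' := hhm.mono_measure (Measure.restrict_mono_set τ.μ hsub)
  have hφm := hφ.memLp lam hc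
  have hφm' : MemLp (fun x => (lam : ℂ) * φ x lam) 2 (τ.μ.restrict (Ioc τ.a c)) :=
    hφm.const_mul _
  -- `Y` is `φ` up to `c`, continued by a cutoff that reaches zero data at `c'`, and `H` is formally
  -- `τ Y`. Since `g` and `k` vanish beyond `c`, the continuation does not contribute to the final
  -- identity.
  set Y : τ.L2 := cut _ measurableSet_Ioc _ hφm + cut _ measurableSet_Ioc _ hzm'
  set H : τ.L2 := cut _ measurableSet_Ioc _ hφm' + cut _ measurableSet_Ioc _ hhm'
  have key : ∀ f e : τ.L2, inner ℂ e Y - inner ℂ f H =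
      (∫ x in Ioc τ.a c, (starRingEnd ℂ (e x) * φ x lam -
        starRingEnd ℂ (f x) * (lam * φ x lam)) ∂τ.μ) +
      ∫ x in Ioc c c', (starRingEnd ℂ (e x) * z x - starRingEnd ℂ (f x) * h x) ∂τ.μ := by
    intro f e
    rw [← inner_cut_sub measurableSet_Ioc hφm hφm', ← inner_cut_sub measurableSet_Ioc hzm' hhm',
      inner_add_right, inner_add_right]
    ring
  rw [graph_minimalOp] at hgk
  -- It suffices to pair with elements of the preminimal graph. There the Lagrange identity is
  -- applied on both sides of `c`: the terms at `c` cancel, and those at the outer ends are zero.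
  have h0 := inner_of_mem_closure hgk (g := Y) (k := H) (by
    rintro ⟨f, e⟩ hfe
    rw [← sub_eq_zero, key]
    obtain ⟨y, hfy, hy, s, hs, d, hd, hsd, hy0, hw0, he0⟩ := exists_rep_of_mem_preminimalOp hfe
    obtain ⟨s', hs'⟩ := exists_between (lt_min hs.1 hc.1)
    have hs's : s' < s := hs'.2.trans_le (min_le_left _ _)
    have hs'c : s' < c := hs'.2.trans_le (min_le_right _ _)
    have hs'I : s' ∈ τ.I := Ioc_subset_I hc ⟨hs'.1, hs'c.le⟩
    have e₁ := (Eqn.solOn hy hs'I hc hs'c.le).conj.lagrange_eq (hφ.solOn lam hs'I hc hs'c.le)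
    have e₂ := (Eqn.solOn hy hc hc' hcc'.le).conj.lagrange_eq hz
    rw [← setIntegral_Icc_μ' hs'I hc hs'c.le, hy0 s' hs'I fun h => hs's.not_gt h.1,
      hw0 s' hs'I fun h => hs's.not_gt h.1] at e₁
    rw [← setIntegral_Icc_μ' hc hc' hcc'.le, integral_Icc_eq_integral_Ioc, hzc, hvc, hzc', hvc']
      at e₂
    have e₃ : ∫ x in Ioc c c', (starRingEnd ℂ (e x) * z x - starRingEnd ℂ (f x) * h x) ∂τ.μ =
        ∫ x in Ioc c c', (starRingEnd ℂ (e x) * z x - starRingEnd ℂ (y x) * h x) ∂τ.μ := by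
      refine integral_congr_ae (ae_restrict_of_ae ?_)
      filter_upwards [hfy] with x hx
      rw [hx]
    have e₄ : ∫ x in Ioc τ.a c, (starRingEnd ℂ (e x) * φ x lam -
        starRingEnd ℂ (f x) * (lam * φ x lam)) ∂τ.μ =
        ∫ x in Icc s' c, (starRingEnd ℂ (e x) * φ x lam -
          starRingEnd ℂ (y x) * (lam * φ x lam)) ∂τ.μ := by
      rw [← integral_indicator measurableSet_Ioc, ← integral_indicator measurableSet_Icc]
      refine integral_congr_ae ?_
      filter_upwards [hfy, he0, ae_μ_mem_I] with x hx hx0 hxI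
      by_cases hxc : x ∈ Icc s' c
      · rw [indicator_of_mem hxc, indicator_of_mem (show x ∈ Ioc τ.a c from ⟨hxI.1, hxc.2⟩), hx]
      · rw [indicator_of_notMem hxc]
        by_cases hxc' : x ∈ Ioc τ.a c
        · have hxs : x ∉ Ioo s d := fun hm => hxc ⟨(hs's.trans hm.1).le, hxc'.2⟩
          rw [indicator_of_mem hxc', hx, hx0 hxs, hy0 x hxI hxs]
          simp
        · rw [indicator_of_notMem hxc']
    rw [e₃, e₄, ← e₁, ← e₂]
    simp)
  rw [← sub_eq_zero, key] at h0
  have h1 : ∫ x in Ioc c c', (starRingEnd ℂ (k x) * z x - starRingEnd ℂ (g x) * h x) ∂τ.μ = 0 := by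
    refine integral_eq_zero_of_ae ?_
    filter_upwards [ae_restrict_of_ae hg, ae_restrict_of_ae hk, ae_restrict_mem measurableSet_Ioc]
      with x hx hx' hxc
    simp [hx hxc.1, hx' hxc.1]
  rw [h1, add_zero] at h0
  have h2 := congr_arg (starRingEnd ℂ) h0
  rw [← integral_conj, map_zero] at h2
  rw [← h2]
  refine setIntegral_congr_fun measurableSet_Ioc fun x hx => ?_
  simp only [map_sub, map_mul, Complex.conj_conj, Complex.conj_ofReal,
    hφ.conj_apply (Ioc_subset_I hc hx)]
  ring

/-- A solution that is not square integrable at `a` is linearly independent of `φ(·, lam)`. -/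
lemma wronskian_ne_zero (hφ : τ.AssumptionA φ) (hc : c ∈ τ.I) (hne : φ c lam ≠ 0) {θ : ℝ → ℂ}
    (hθ : τ.IsSolution lam θ) (hθ2 : ¬ τ.SqIntegrableAtLeft θ) :
    φ c lam * τ.quasiDeriv θ c - quasi τ φ c lam * θ c ≠ 0 := by
  intro hW
  refine hθ2 (sqIntegrableAtLeft_of_memLp hc ?_)
  refine MemLp.ae_eq ?_ ((hφ.memLp lam hc).const_mul (θ c / φ c lam))
  filter_upwards [ae_restrict_mem measurableSet_Ioc] with x hx
  have hxI := Ioc_subset_I hc hx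
  -- A zero Wronskian makes the data of `θ - (θ c / φ c) φ` vanish at `c`. So `θ` is a multiple of
  -- `φ` on `(a, c]`, contrary to `hθ2`.
  have h1 := ((Eqn.solOn hθ hxI hc hx.2).sub
    ((hφ.solOn lam hxI hc hx.2).const_mul (θ c / φ c lam))).congr (fun _ _ => rfl) (fun _ _ => rfl)
      (h' := fun x => lam * (θ x - θ c / φ c lam * φ x lam)) (by
        filter_upwards with x _
        ring)
  have h2 := h1.eq_zero_of_right (by field_simp; ring) (by
    field_simp
    linear_combination hW) x ⟨le_rfl, hx.2⟩
  exact (sub_eq_zero.1 h2).symm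

/-- Solvability of `A g - lam g = f` for `f` supported away from `a`. -/
lemma exists_mem_preminimalOp (hφ : τ.AssumptionA φ) (hc : c ∈ τ.I) (hne : φ c lam ≠ 0) {C : ℝ}
    (hC0 : 0 ≤ C) (hC : ∀ s ∈ Ioo τ.a c, ∀ f y w : ℝ → ℂ, MemLp f 2 (τ.μ.restrict (Icc s c)) →
      τ.SolOn s c y w (fun x => lam * y x + f x) → y s = 0 → w s = 0 → y c = 0 →
      √(∫ x in Icc s c, ‖y x‖ ^ 2 ∂τ.μ) ≤ C * √(∫ x in Icc s c, ‖f x‖ ^ 2 ∂τ.μ))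
    {θ : ℝ → ℂ} (hθ : τ.IsSolution lam θ) (hθ2 : ¬ τ.SqIntegrableAtLeft θ) {f : τ.L2}
    (hf : f ∈ τ.suppIoc τ.a c hc.1) (hfφ : ∫ x, f x * φ x lam ∂τ.μ = 0)
    (hfθ : ∫ x, f x * θ x ∂τ.μ = 0) :
    ∃ g : τ.L2, (g, f + (lam : ℂ) • g) ∈ τ.preminimalOp.graph ∧
      (∀ᵐ x ∂τ.μ, c < x → g x = 0) ∧ ‖g‖ ≤ C * ‖f‖ := by
  obtain ⟨s, hs, hfs⟩ := hf
  have hsI : s ∈ τ.I := Ioc_subset_I hc (Ioo_subset_Ioc_self hs)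
  have hfm := memLp_L2 f (Icc s c)
  -- The solution starts with zero data at `s`. Orthogonality of `f` to the two independent
  -- solutions `φ` and `θ` makes the data at `c` vanish too, so extension by zero is admissible.
  obtain ⟨y, w, hy, hys, hws⟩ := exists_solOn hsI hc hs.2.le
    (intervalIntegrable_r_mul_of_memLp hsI hc hs.2.le hfm) 0 0 lam
  have hW : ∀ {u : ℝ → ℂ}, τ.IsSolution lam u → ∫ x, f x * u x ∂τ.μ = 0 →
      y c * τ.quasiDeriv u c - w c * u c = 0 := by
    intro u hu hfu
    have h1 := hy.lagrange_eq (Eqn.solOn hu hsI hc hs.2.le)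
    rw [hys, hws, zero_mul, zero_mul, sub_zero, sub_zero] at h1
    rw [h1, ← hfu, integral_μ_of_supp hsI hc hs.2.le (by
      filter_upwards [hfs] with x hx hn
      rw [hx hn, zero_mul])]
    refine intervalIntegral.integral_congr fun x _ => ?_
    ring
  have h1 := hW (hφ.isSolution lam) hfφ
  have h2 := hW hθ hfθ
  have h3 := hφ.wronskian_ne_zero hc hne hθ hθ2
  have hyc : y c = 0 := by
    refine (mul_eq_zero.1 ?_).resolve_right h3
    change y c * quasi τ φ c lam - _ = 0 at h1
    linear_combination φ c lam * h2 - θ c * h1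
  have hwc : w c = 0 := by
    rw [hyc, zero_mul, zero_sub, neg_eq_zero] at h1
    exact (mul_eq_zero.1 h1).resolve_right hne
  have hym : MemLp y 2 (τ.μ.restrict (Icc s c)) :=
    memLp_of_continuousOn hsI hc hy.prim.continuousOn
  have hg := coeFn_cut (hS := measurableSet_Icc) (hF := hym)
  refine ⟨cut (Icc s c) measurableSet_Icc y hym, hy.mem_preminimalOp hys hws hyc hwc hg ?_, ?_, ?_⟩
  · filter_upwards [hg, hfs, Lp.coeFn_add f ((lam : ℂ) • cut (Icc s c) measurableSet_Icc y hym),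
      Lp.coeFn_smul (lam : ℂ) (cut (Icc s c) measurableSet_Icc y hym)] with x e₁ e₂ e₃ e₄
    rw [e₃, Pi.add_apply, e₄, Pi.smul_apply, e₁]
    by_cases hx : x ∈ Icc s c
    · simp [indicator_of_mem hx, add_comm]
    · simp [indicator_of_notMem hx, e₂ hx]
  · filter_upwards [hg] with x hx hcx
    rw [hx, indicator_of_notMem fun h => hcx.not_ge h.2]
  · have e₁ : ‖cut (Icc s c) measurableSet_Icc y hym‖ = √(∫ x in Icc s c, ‖y x‖ ^ 2 ∂τ.μ) := by
      rw [norm_L2, ← integral_indicator measurableSet_Icc]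
      congr 1
      refine integral_congr_ae ?_
      filter_upwards [hg] with x hx
      rw [hx]
      by_cases hx : x ∈ Icc s c <;> simp [hx]
    rw [e₁, norm_L2]
    refine (hC s hs f y w hfm hy hys hws hyc).trans ?_
    refine mul_le_mul_of_nonneg_left (Real.sqrt_le_sqrt ?_) hC0
    exact setIntegral_le_integral (by simpa using (memLp_L2 f univ).integrable_norm_sq)
      (Eventually.of_forall fun _ => by positivity)

/-- Functions orthogonal to `φ(·, lam)` are limits of functions supported away from `a` that are
orthogonal to all solutions. -/
lemma mem_closure_of_integral_eq_zero (hφ : τ.AssumptionA φ) (hc : c ∈ τ.I)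
    {θ : ℝ → ℂ} (hθ : τ.IsSolution lam θ) (hθ2 : ¬ τ.SqIntegrableAtLeft θ) {f : τ.L2}
    (hf : ∀ᵐ x ∂τ.μ, c < x → f x = 0) (hfφ : ∫ x in Ioc τ.a c, φ x lam * f x ∂τ.μ = 0) :
    f ∈ closure {z : τ.L2 | z ∈ τ.suppIoc τ.a c hc.1 ∧ ∫ x, z x * φ x lam ∂τ.μ = 0 ∧
      ∫ x, z x * θ x ∂τ.μ = 0} := by
  have hφl : τ.LocSqIntegrable τ.a c (fun x => φ x lam) :=
    locSqIntegrable_of_continuousOn le_rfl hc ((hφ.continuousOn lam).mono (Ioc_subset_I hc))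
  have hθl : τ.LocSqIntegrable τ.a c θ :=
    locSqIntegrable_of_continuousOn le_rfl hc ((Eqn.continuousOn hθ).mono (Ioc_subset_I hc))
  set Z : Submodule ℂ τ.L2 := ((LinearMap.ker (pairing hφl hc.1) ⊓
    LinearMap.ker (pairing hθl hc.1)).map (τ.suppIoc τ.a c hc.1).subtype) with hZ
  have hZset : (Z : Set τ.L2) = {z : τ.L2 | z ∈ τ.suppIoc τ.a c hc.1 ∧
      ∫ x, z x * φ x lam ∂τ.μ = 0 ∧ ∫ x, z x * θ x ∂τ.μ = 0} := by
    ext z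
    simp only [SetLike.mem_coe, hZ, Submodule.mem_map, mem_ofPred_eq]
    constructor
    · rintro ⟨z, ⟨h1, h2⟩, rfl⟩
      exact ⟨z.2, h1, h2⟩
    · rintro ⟨h0, h1, h2⟩
      exact ⟨⟨z, h0⟩, ⟨h1, h2⟩, rfl⟩
  -- The closure is the double orthogonal complement, so it is enough that `f` is orthogonal to
  -- every `h` orthogonal to `Z`. By duality such an `h̄` is a combination of `φ` and `θ` on `(a,
  -- c]`.
  rw [← hZset, ← Submodule.topologicalClosure_coe, ← Submodule.orthogonal_orthogonal_eq_closure]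
  intro h hh
  have hl : τ.LocSqIntegrable τ.a c (fun x => starRingEnd ℂ (h x)) := fun s _ =>
    (memLp_L2 h (Icc s c)).star
  obtain ⟨α, β, hαβ⟩ := hl.exists_ae_eq hc.1 hφl hθl fun z hz h1 h2 => by
    have hzZ : z ∈ (Z : Set τ.L2) := by
      rw [hZset]
      exact ⟨hz, h1, h2⟩
    have h3 := Submodule.inner_left_of_mem_orthogonal hzZ hh
    rw [inner_L2] at h3
    rw [← h3]
    exact integral_congr_ae (Eventually.of_forall fun x => mul_comm _ _)
  -- Both `h` and `φ` are square integrable at `a`, but `θ` is not. This is what removes the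
  -- orthogonality to `θ` as a condition on `f`.
  have hβ : β = 0 := by
    by_contra hβ
    refine hθ2 (sqIntegrableAtLeft_of_memLp hc ?_)
    refine MemLp.ae_eq ?_ (((memLp_L2 h (Ioc τ.a c)).star.sub
      ((hφ.memLp lam hc).const_mul α)).const_mul β⁻¹)
    filter_upwards [ae_restrict_of_ae hαβ, ae_restrict_mem measurableSet_Ioc] with x hx hxc
    simp only [Pi.sub_apply, Pi.star_apply, Complex.star_def]
    rw [hx hxc]
    field_simp
    ring
  rw [inner_L2]
  have h1 : ∫ x, starRingEnd ℂ (h x) * f x ∂τ.μ =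
      α * ∫ x in Ioc τ.a c, φ x lam * f x ∂τ.μ := by
    rw [← integral_const_mul, ← integral_indicator measurableSet_Ioc]
    refine integral_congr_ae ?_
    filter_upwards [hαβ, hf, ae_μ_mem_I] with x hx hx0 hxI
    by_cases hxc : x ∈ Ioc τ.a c
    · rw [indicator_of_mem hxc, hx hxc, hβ]
      ring
    · rw [indicator_of_notMem hxc, hx0 (not_le.1 fun h => hxc ⟨hxI.1, h⟩), mul_zero]
  rw [h1, hfφ, mul_zero]

/-- Solvability of `A g - lam g = f`. -/
lemma exists_mem_minimalOp (hτ : τ.IsLimitPointAtLeft) (hφ : τ.AssumptionA φ) (hc : c ∈ τ.I)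
    (hne : φ c lam ≠ 0) {f : τ.L2} (hf : ∀ᵐ x ∂τ.μ, c < x → f x = 0)
    (hfφ : ∫ x in Ioc τ.a c, φ x lam * f x ∂τ.μ = 0) :
    ∃ g : τ.L2, (g, f + (lam : ℂ) • g) ∈ τ.minimalOp.graph ∧ ∀ᵐ x ∂τ.μ, c < x → g x = 0 := by
  obtain ⟨C, hC0, hC⟩ := hφ.exists_apriori hτ hc hne
  obtain ⟨θ, hθ, hθ2⟩ : ∃ θ, τ.IsSolution lam θ ∧ ¬ τ.SqIntegrableAtLeft θ := by
    by_contra! h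
    exact hτ ⟨lam, h⟩
  have hsolv := fun (z : τ.L2) (hz : z ∈ {z : τ.L2 | z ∈ τ.suppIoc τ.a c hc.1 ∧
      ∫ x, z x * φ x lam ∂τ.μ = 0 ∧ ∫ x, z x * θ x ∂τ.μ = 0}) =>
    hφ.exists_mem_preminimalOp hc hne hC0 hC hθ hθ2 hz.1 hz.2.1 hz.2.2
  obtain ⟨F, hF, hFlim⟩ := mem_closure_iff_seq_limit.1
    (hφ.mem_closure_of_integral_eq_zero hc hθ hθ2 hf hfφ)
  choose g hg hgc hgn using fun n => hsolv (F n) (hF n)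
  have hsub : ∀ m n, ‖g m - g n‖ ≤ C * ‖F m - F n‖ := by
    intro m n
    have hφl : τ.LocSqIntegrable τ.a c (fun x => φ x lam) :=
      locSqIntegrable_of_continuousOn le_rfl hc ((hφ.continuousOn lam).mono (Ioc_subset_I hc))
    have hθl : τ.LocSqIntegrable τ.a c θ :=
      locSqIntegrable_of_continuousOn le_rfl hc ((Eqn.continuousOn hθ).mono (Ioc_subset_I hc))
    have hint : ∀ {u : ℝ → ℂ} (hu : τ.LocSqIntegrable τ.a c u), ∫ x, F m x * u x ∂τ.μ = 0 →
        ∫ x, F n x * u x ∂τ.μ = 0 → ∫ x, (F m - F n : τ.L2) x * u x ∂τ.μ = 0 := by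
      intro u hu h1 h2
      have h3 := (pairing hu hc.1).map_sub ⟨F m, (hF m).1⟩ ⟨F n, (hF n).1⟩
      exact h3.trans ((congr_arg₂ (· - ·) h1 h2).trans (sub_zero 0))
    obtain ⟨g', hg', -, hgn'⟩ := hsolv (F m - F n) ⟨Submodule.sub_mem _ (hF m).1 (hF n).1,
      hint hφl (hF m).2.1 (hF n).2.1, hint hθl (hF m).2.2 (hF n).2.2⟩
    -- The estimate belongs to some solution `g'` for `F m - F n`. Absence of eigenvalues identifies
    -- it with `g m - g n`.
    have h1 : g m - g n - g' = 0 := eq_zero_of_mem_preminimalOp (lam := lam) (by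
      have h2 := Submodule.sub_mem _ (Submodule.sub_mem _ (hg m) (hg n)) hg'
      convert h2 using 1
      refine Prod.ext rfl ?_
      simp only [Prod.snd_sub, smul_sub]
      abel)
    rw [sub_eq_zero.1 h1]
    exact hgn'
  have hcauchy : CauchySeq g := by
    rw [Metric.cauchySeq_iff]
    intro ε hε
    -- `C + 1` rather than `C`, since `C` may be zero.
    obtain ⟨N, hN⟩ := Metric.cauchySeq_iff.1 hFlim.cauchySeq (ε / (C + 1)) (by positivity)
    refine ⟨N, fun m hm n hn => ?_⟩
    have h1 := hN m hm n hn
    rw [dist_eq_norm] at h1 ⊢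
    rw [lt_div_iff₀ (by positivity)] at h1
    nlinarith [hsub m n, norm_nonneg (F m - F n)]
  obtain ⟨g', hg'⟩ := cauchySeq_tendsto_of_complete hcauchy
  refine ⟨g', ?_, ae_eq_zero_of_tendsto hg' hgc⟩
  rw [graph_minimalOp, ← SetLike.mem_coe, Submodule.topologicalClosure_coe]
  exact mem_closure_of_tendsto (hg'.prodMk_nhds (hFlim.add (hg'.const_smul (lam : ℂ))))
    (Eventually.of_forall hg)

/-- Necessity is the orthogonality of the range to `φ`, applied at a point `c` beyond the supports
of both `g` and `A₀ g`. For sufficiency the support bound of `f` is enlarged to a point where `φ(·,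
lam)` does not vanish. -/
lemma solvable_iff (hτ : τ.IsLimitPointAtLeft) (hφ : τ.AssumptionA φ) (f : τ.manifoldL) (lam : ℝ) :
    (∃ g : τ.A₀.domain, τ.A₀ g - (lam : ℂ) • (g : τ.manifoldL) = f) ↔ τ.Φ φ f lam = 0 := by
  constructor
  · rintro ⟨g, hg⟩
    obtain ⟨c₁, hc₁, h₁⟩ := (g : τ.manifoldL).2
    obtain ⟨c₂, hc₂, h₂⟩ := (τ.A₀ g).2
    have hc : max c₁ c₂ ∈ τ.I := by
      rcases max_choice c₁ c₂ with h | h <;> rw [h] <;> assumption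
    have hgr := mem_graph_A₀.1 (τ.A₀.mem_graph g)
    have h₁' : ∀ᵐ x ∂τ.μ, max c₁ c₂ < x → (g : τ.manifoldL).1 x = 0 := by
      filter_upwards [h₁] with x hx hxc using hx ((le_max_left _ _).trans_lt hxc)
    have h₂' : ∀ᵐ x ∂τ.μ, max c₁ c₂ < x → (τ.A₀ g).1 x = 0 := by
      filter_upwards [h₂] with x hx hxc using hx ((le_max_right _ _).trans_lt hxc)
    have hfx : ∀ᵐ x ∂τ.μ, (f : τ.L2) x = (τ.A₀ g).1 x - lam * (g : τ.manifoldL).1 x := by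
      rw [← hg]
      filter_upwards [Lp.coeFn_sub (τ.A₀ g).1 ((lam : ℂ) • (g : τ.manifoldL).1),
        Lp.coeFn_smul (lam : ℂ) (g : τ.manifoldL).1] with x hx hx'
      refine hx.trans ?_
      rw [Pi.sub_apply, hx', Pi.smul_apply, smul_eq_mul]
    have hfc : ∀ᵐ x ∂τ.μ, max c₁ c₂ < x → (f : τ.L2) x = 0 := by
      filter_upwards [h₁', h₂', hfx] with x e₁ e₂ e₃ hx
      rw [e₃, e₁ hx, e₂ hx, mul_zero, sub_zero]
    rw [Φ_eq hfc, ← hφ.integral_eq_zero_of_mem_minimalOp (lam := lam) hc hgr h₁' h₂']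
    refine integral_congr_ae (ae_restrict_of_ae ?_)
    filter_upwards [hfx] with x hx
    rw [hx]
  · intro h
    obtain ⟨c₀, hc₀, hfc₀⟩ := f.2
    obtain ⟨c, hc, hcc, hne⟩ := hφ.exists_ne_zero lam hc₀
    have hfc : ∀ᵐ x ∂τ.μ, c < x → (f : τ.L2) x = 0 := by
      filter_upwards [hfc₀] with x hx hxc using hx (hcc.trans_lt hxc)
    rw [Φ_eq hfc] at h
    obtain ⟨g, hg, hgc⟩ := hφ.exists_mem_minimalOp hτ hc hne hfc h
    set g' : τ.manifoldL := ⟨g, c, hc, hgc⟩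
    have h1 : (g', f + (lam : ℂ) • g') ∈ τ.A₀.graph := mem_graph_A₀.2 hg
    obtain ⟨y, hy1, hy2⟩ := (LinearPMap.mem_graph_iff _).1 h1
    refine ⟨y, ?_⟩
    rw [hy2, hy1, add_sub_cancel_right]

end AssumptionA

end SturmLiouville

/-- `A` is well defined (the preminimal operator is closable), `A₀` is a symmetric operator in `𝓛`
with domain `𝓛 ∩ dom A`, which is quasidense in `𝓛`, the integral `Φ(f; lam)` converges absolutely
for all complex `lam`, and `Φ` is a directing functional for `A₀`. -/
theorem proposition3p2 (τ : SturmLiouville) (hτ : τ.IsLimitPointAtLeft)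
    (φ : ℝ → ℂ → ℂ) (hφ : τ.AssumptionA φ) :
    τ.preminimalOp.IsClosable ∧
    (∀ g : τ.manifoldL, g ∈ τ.A₀.domain ↔ (g : τ.L2) ∈ τ.minimalOp.domain) ∧
    SymmetricOp τ.A₀ ∧
    Dense (τ.A₀.domain : Set τ.manifoldL) ∧
    (∀ (f : τ.manifoldL) (lam : ℂ), Integrable (fun x => φ x lam * (f : τ.L2) x) τ.μ) ∧
    IsDirectingFunctional τ.A₀ (fun f lam => τ.Φ φ f (lam : ℂ)) :=
  ⟨τ.isClosable_preminimalOp, SturmLiouville.mem_domain_A₀, τ.symmetricOp_A₀, τ.dense_domain_A₀,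
    hφ.integrable_mul, fun lam => hφ.isLinearMap_Φ lam, hφ.analyticAt_Φ hτ, hφ.solvable_iff hτ⟩
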